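/- Let $X$ be a complex manifold and let $A$ be an effective divisor in $X$, i.e. a coherent sheaf $\mathcal I_A\subset\mathcal O_X$ of ideals all of whose stalks are principal and nonzero; its support, also written $A$, is the set of points $p$ with $\mathcal I_{A,p}\neq\mathcal O_{X,p}$. Write $\mathrm{PSH}(X)$ for the plurisubharmonic functions on $X$ (the value $-\infty$ is allowed, also identically), and $$\nu_u(p)=\lim_{r\to 0}\frac{\sup_{|z|=r}u(z)}{\log r}$$ (in local coordinates $z$ centred at $p$) for the Lelong number of $u$ at $p$. Let $\nu_A(p)$ be the Lelong number at $p$ of $\max_i\log|f_i|$, where $f_1,\dots,f_m$ generate the stalk $\mathcal I_{A,p}$ (it does not depend on the generators), and let $$G_A=\sup\{u\in\mathrm{PSH}(X)\,;\,u\le 0,\ \nu_u\ge\nu_A\}$$ be the pluricomplex Green function with a logarithmic pole along $A$. (1) If $f$ is a holomorphic function generating $\mathcal I_A$ on an open set $U\subset X$, then $G_A-\log|f|$ on $U\setminus A$ is bounded above near every point of $A\cap U$, and it extends to a plurisubharmonic function on $U$. (2) On every connected component of $X$ on which $G_A$ is not identically $-\infty$, the function $G_A$ is locally integrable and $$\mathcal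 L(G_A)\ge\pi[A]$$ as currents. Here $\mathcal L(u)=i\partial\bar\partial u$ is the Levi form of $u$, and $[A]$ is the current of integration over $A$, the closed positive $(1,1)$-current that equals $\frac1\pi\mathcal L(\log|h|)$ on every open set on which $h$ generates $\mathcal I_A$ ($\log|h|$ is locally integrable there). -/

import Mathlib

open Set Filter Topology MeasureTheory
open scoped Manifold ContDiff

noncomputable section

namespace GreenDivisor

/-- Complex Euclidean space `ℂⁿ`. -/
abbrev Cn (n : ℕ) : Type := EuclideanSpace ℂ (Fin n)

variable {n : ℕ} {X : Type*} [TopologicalSpace X] [ChartedSpace (Cn n) X]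

/-- `log |f|`, with value `-∞` at the zeros of `f`. -/
def logAbs (f : X → ℂ) (x : X) : EReal := ENNReal.log ‖f x‖ₑ

/-! ### Plurisubharmonic functions -/

/-- The sub-mean value inequality `w(0) ≤ (1/2π) ∫ w(e^{iθ}) dθ` for a function with values in
`[-∞, ∞)` that is bounded above on the unit circle: if `w(0) ≠ -∞`, then the integral is finite
and at least `w(0)`. -/
def SubMean (w : ℂ → EReal) : Prop :=
  w 0 ≠ ⊥ →
    (∀ᵐ θ : ℝ, w (circleMap 0 1 θ) ≠ ⊥) ∧
    CircleIntegrable (fun ζ => (w ζ).toReal) 0 1 ∧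
    (w 0).toReal ≤ Real.circleAverage (fun ζ => (w ζ).toReal) 0 1

variable (n) in
/-- `u` is plurisubharmonic on the open set `Ω` (the value `-∞` is allowed, also identically):
it is upper semicontinuous, `< +∞`, and in all holomorphic coordinates it satisfies the sub-mean
value inequality on every closed disc in a complex line. -/
def IsPSHOn (u : X → EReal) (Ω : Set X) : Prop :=
  UpperSemicontinuousOn u Ω ∧ (∀ x ∈ Ω, u x ≠ ⊤) ∧
    ∀ e ∈ IsManifold.maximalAtlas 𝓘(ℂ, Cn n) ω X, ∀ a b : Cn n,
      (∀ ζ ∈ Metric.closedBall (0 : ℂ) 1, a + ζ • b ∈ e.target ∧ e.symm (a + ζ • b) ∈ Ω) →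
        SubMean fun ζ => u (e.symm (a + ζ • b))

variable (n) in
/-- The Lelong number `lim_{r → 0} (sup_{|z| = r} u(z)) / log r`, in the coordinates of the
preferred chart at `p`, translated to be centred at `p`. The limit exists in `[0, ∞]` if `u` is
plurisubharmonic near `p`, and is `∞` if `u = -∞` near `p`. -/
def lelongNumber (u : X → EReal) (p : X) : EReal :=
  liminf (fun r : ℝ =>
    (⨆ z ∈ Metric.sphere (chartAt (Cn n) p p) r, u ((chartAt (Cn n) p).symm z)) /
      ((Real.log r : ℝ) : EReal)) (𝓝[>] 0)

/-! ### Complex subspaces and effective divisors -/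

variable (n) in
/-- The ring `𝒪_{X,p}` of germs at `p` of holomorphic functions. -/
def HolGerm (p : X) : Subring (Germ (𝓝 p) ℂ) where
  carrier := {g | ∃ f : X → ℂ, ContMDiffAt 𝓘(ℂ, Cn n) 𝓘(ℂ) ω f p ∧ (f : Germ (𝓝 p) ℂ) = g}
  mul_mem' := by
    rintro _ _ ⟨f, hf, rfl⟩ ⟨g, hg, rfl⟩
    exact ⟨f * g, hf.mul hg, rfl⟩
  one_mem' := ⟨1, contMDiffAt_const, rfl⟩
  add_mem' := by
    rintro _ _ ⟨f, hf, rfl⟩ ⟨g, hg, rfl⟩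
    exact ⟨f + g, hf.add hg, rfl⟩
  zero_mem' := ⟨0, contMDiffAt_const, rfl⟩
  neg_mem' := by
    rintro _ ⟨f, hf, rfl⟩
    exact ⟨-f, hf.neg, rfl⟩

/-- The functions `f i` are holomorphic near `p` and their germs generate the ideal `I` of
`𝒪_{X,p}`. -/
def GeneratesAt {ι : Type*} (p : X) (I : Ideal (HolGerm n p)) (f : ι → X → ℂ) : Prop :=
  (∀ i, ContMDiffAt 𝓘(ℂ, Cn n) 𝓘(ℂ) ω (f i) p) ∧
    I = Ideal.span {g : HolGerm n p | ∃ i, (g : Germ (𝓝 p) ℂ) = (f i : Germ (𝓝 p) ℂ)}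

variable (n X) in
/-- A closed complex subspace of `X`, i.e. a coherent sheaf of ideals in `𝒪_X`, given by its
stalks. The sheaf being of finite type says that near each point the stalks are generated by
finitely many holomorphic functions; for ideal sheaves in `𝒪_X` this is the same as coherence. -/
structure ComplexSubspace where
  /-- the stalks of the ideal sheaf -/
  stalk : ∀ p : X, Ideal (HolGerm n p)
  finiteType : ∀ p : X, ∃ V ∈ 𝓝 p, ∃ (m : ℕ) (f : Fin m → X → ℂ),
    ∀ q ∈ V, GeneratesAt q (stalk q) f

namespace ComplexSubspace

variable (A : ComplexSubspace n X)

/-- The underlying point set of the complex subspace. -/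
def support : Set X := {p | A.stalk p ≠ ⊤}

/-- `f` is a holomorphic function on `U` that generates the ideal sheaf of `A` on `U`. -/
def GeneratedOn (f : X → ℂ) (U : Set X) : Prop :=
  ∀ q ∈ U, GeneratesAt q (A.stalk q) fun _ : Unit => f

/-- An effective divisor: every stalk of the ideal sheaf is principal and nonzero. (If `X` is
connected and all stalks are principal, then all stalks are nonzero as soon as one is.) -/
def IsEffectiveDivisor : Prop :=
  ∀ p, (A.stalk p).IsPrincipal ∧ A.stalk p ≠ ⊥

/-- `ν_A(p)`: the Lelong number at `p` of `max_i log |f_i|`, where `f_1, …, f_m` generate the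
stalk at `p`. It does not depend on the generators, so the infimum is over equal numbers. -/
def nu (p : X) : EReal :=
  ⨅ (m : ℕ) (f : Fin m → X → ℂ) (_ : GeneratesAt p (A.stalk p) f),
    lelongNumber n (fun x => ⨆ i, logAbs (f i) x) p

/-- The class `ℱ_A` of negative plurisubharmonic functions `u` on `X` with `ν_u ≥ ν_A`. -/
def family : Set (X → EReal) :=
  {u | IsPSHOn n u univ ∧ (∀ x, u x ≤ 0) ∧ ∀ p, A.nu p ≤ lelongNumber n u p}

/-- The pluricomplex Green function `G_A = sup ℱ_A` with a logarithmic pole along `A`. -/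
def green (x : X) : EReal := ⨆ u ∈ A.family, u x

end ComplexSubspace

/-! ### Levi forms as currents, in coordinates -/

/-- The Levi form `∑ ∂²φ/∂z_j∂z̄_k (z) ξ_j ξ̄_k` of a smooth real function `φ` on `ℂⁿ`, which is
`(D²φ(z)(ξ, ξ) + D²φ(z)(iξ, iξ)) / 4`. -/
def leviSmooth (φ : Cn n → ℝ) (ξ z : Cn n) : ℝ :=
  (iteratedFDeriv ℝ 2 φ z ![ξ, ξ] +
    iteratedFDeriv ℝ 2 φ z ![Complex.I • ξ, Complex.I • ξ]) / 4

/-- In the coordinates `e`, the (1,1)-current `ℒ(u) = i∂∂̄u` is `i ∑ T_{jk} dz_j ∧ dz̄_k` with the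
distributions `T_{jk} = ∂²u/∂z_j∂z̄_k`. This is the distribution `∑ T_{jk} ξ_j ξ̄_k`, evaluated
at the test function `φ`. -/
def levi (e : OpenPartialHomeomorph X (Cn n)) (u : X → EReal) (ξ : Cn n) (φ : Cn n → ℝ) : ℝ :=
  ∫ z, (u (e.symm z)).toReal * leviSmooth φ ξ z

/-- The current of integration over an effective divisor with local generator `h`, namely
`(1/π) ℒ(log |h|)`, in the same form. -/
def integrationCurrent (e : OpenPartialHomeomorph X (Cn n)) (h : X → ℂ) (ξ : Cn n)
    (φ : Cn n → ℝ) : ℝ :=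
  1 / Real.pi * levi e (logAbs h) ξ φ

/-- In the coordinates `e`, `u` is finite almost everywhere and locally integrable on `S`, so that
it defines a distribution there. -/
def IsLocInt (e : OpenPartialHomeomorph X (Cn n)) (u : X → EReal) (S : Set (Cn n)) : Prop :=
  (∀ᵐ z ∂volume.restrict S, u (e.symm z) ≠ ⊥ ∧ u (e.symm z) ≠ ⊤) ∧
    LocallyIntegrableOn (fun z => (u (e.symm z)).toReal) S

/-- Nonnegative smooth functions on `ℂⁿ` with compact support in `S`. -/
def IsNonnegTest (φ : Cn n → ℝ) (S : Set (Cn n)) : Prop :=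
  ContDiff ℝ ∞ φ ∧ HasCompactSupport φ ∧ tsupport φ ⊆ S ∧ ∀ z, 0 ≤ φ z

/-- `ℒ(u) ≥ π [A]` on the open set `W`, as currents. The inequality is local and `[A]` is given
locally, so it is stated in all holomorphic coordinates `e` and on all open sets `V ⊆ W` on which
the ideal sheaf of `A` has a generator `h`. A current `i ∑ T_{jk} dz_j ∧ dz̄_k` is positive if
`∑ T_{jk} ξ_j ξ̄_k` is a positive distribution for all `ξ`. -/
def LeviGePiIntegration (A : ComplexSubspace n X) (u : X → EReal) (W : Set X) : Prop :=
  ∀ e ∈ IsManifold.maximalAtlas 𝓘(ℂ, Cn n) ω X, ∀ (V : Set X) (h : X → ℂ),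
    IsOpen V → V ⊆ W → A.GeneratedOn h V →
      IsLocInt e u (e.target ∩ e.symm ⁻¹' V) ∧
      IsLocInt e (logAbs h) (e.target ∩ e.symm ⁻¹' V) ∧
      ∀ φ, IsNonnegTest φ (e.target ∩ e.symm ⁻¹' V) → ∀ ξ,
        Real.pi * integrationCurrent e h ξ φ ≤ levi e u ξ φ

end GreenDivisor

end

noncomputable section

namespace GreenDivisor

variable {n : ℕ} {X : Type*} [TopologicalSpace X] [ChartedSpace (Cn n) X]

/-! ### Sub-mean values and lower integrals -/

/-! Everything rests on one estimate, `exists_uniform_bound`: near each point, all competitors `u`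
satisfy `u ≤ log |f| + C` with the same `C` and on the same neighbourhood. Choose a complex line
through the point on whose unit circle the generator `f` has no zeros; then `|f| ≥ c₀` on all nearby
parallel circles. On a parallel disc, `u - log |f|` is at most `-log c₀` on the boundary, and the
maximum principle gives the bound at the centre, provided the pole of `u` at each zero of `f` on the
disc is at least as strong as that of `log |f|` restricted to the line. The condition `ν_u ≥ ν_A`
only controls the order of `f` in the whole space, which may be smaller than its order along the
line. Lines through points where this happens form a null set (`volume_lines_meeting_badSet`), so
the estimate holds almost everywhere, and solid means carry it to every point.

Consequently the upper semicontinuous regularization of `G_A` obeys the same bound, hence is itself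
a competitor, and `G_A` equals it (`green_mem_family`). Near the divisor `G_A - log |f|` is bounded
above; it is approximated from below by `G_A - (1 - ε) log |f| - ε log M`, which tend to `-∞` at the
zeros of `f` and are therefore plurisubharmonic. So its regularization is a plurisubharmonic
extension (`isPSHOn_greenQuotient`).

For the currents, almost everywhere `G_A` is the sum of `log |h|` and this extension, and the Levi
form of a plurisubharmonic function is positive (`PshFlat.integral_mul_leviSmooth_nonneg`).

Since plurisubharmonicity is formulated on all discs while subtraction of `log |f|` is only
controlled on small ones, a passage from small circles to the whole disc is needed
(`subMean_of_locallySubMean`). -/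

lemma ae_of_ae_Ioc_of_periodic {p : ℝ → Prop} {T : ℝ} (hT : 0 < T) (hp : Function.Periodic p T)
    (h : ∀ᵐ θ ∂volume.restrict (Ioc 0 T), p θ) : ∀ᵐ θ : ℝ, p θ := by
  have hz : ∀ m : ℤ, ∀ᵐ θ : ℝ, θ + m • T ∈ Ioc 0 T → p θ := by
    intro m
    rw [ae_restrict_iff' measurableSet_Ioc] at h
    have := (measurePreserving_add_right volume (m • T)).quasiMeasurePreserving.ae h
    filter_upwards [this] with θ hθ h1
    have := hθ h1
    rwa [hp.zsmul m θ] at this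
  filter_upwards [ae_all_iff.2 hz] with θ hθ
  obtain ⟨m, hm, -⟩ := existsUnique_add_zsmul_mem_Ioc hT θ 0
  exact hθ m (by simpa using hm)

lemma periodic_comp_circleMap {α : Type*} (w : ℂ → α) :
    Function.Periodic (fun θ => w (circleMap 0 1 θ)) (2 * Real.pi) := fun θ => by
  simp only [periodic_circleMap 0 1 θ]

lemma SubMean.congr {w w' : ℂ → EReal} (h : SubMean w) (h0 : w 0 = w' 0)
    (hc : ∀ θ : ℝ, w (circleMap 0 1 θ) = w' (circleMap 0 1 θ)) : SubMean w' := by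
  intro hw
  obtain ⟨h1, h2, h3⟩ := h (h0 ▸ hw)
  refine ⟨by simpa only [hc] using h1, ?_, ?_⟩
  · unfold CircleIntegrable at *; simpa only [hc] using h2
  · unfold Real.circleAverage at *; simpa only [hc, h0] using h3

/-- The nonnegative function `M - w` along the unit circle. -/
def defect (M : ℝ) (x : EReal) : ENNReal := ((M : EReal) - x).toENNReal

lemma defect_coe (M x : ℝ) : defect M (x : EReal) = ENNReal.ofReal (M - x) := by
  rw [defect, ← EReal.coe_sub, EReal.toENNReal_of_ne_top (EReal.coe_ne_top _), EReal.toReal_coe]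

lemma defect_bot (M : ℝ) : defect M ⊥ = ⊤ := by
  simp [defect]

lemma defect_anti (M : ℝ) : Antitone (defect M) := fun _ _ h =>
  EReal.toENNReal_le_toENNReal (EReal.sub_le_sub le_rfl h)

lemma defect_eq_top_iff {M : ℝ} {x : EReal} : defect M x = ⊤ ↔ x = ⊥ := by
  refine ⟨fun h => ?_, fun h => h ▸ defect_bot M⟩
  induction x with
  | bot => rfl
  | coe x => simp [defect_coe] at h
  | top => simp [defect] at h

lemma continuous_defect (M : ℝ) : Continuous (defect M) := by
  have : defect M = fun x => (-x + (M : EReal)).toENNReal := by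
    funext x; rw [defect, sub_eq_add_neg, add_comm]
  rw [this]
  refine EReal.continuous_toENNReal.comp ?_
  refine continuous_iff_continuousAt.2 fun x => ?_
  have h1 : ContinuousAt (fun p : EReal × EReal => p.1 + p.2) (-x, (M : EReal)) :=
    EReal.continuousAt_add (Or.inr (EReal.coe_ne_bot M)) (Or.inr (EReal.coe_ne_top M))
  exact ContinuousAt.comp (f := fun x : EReal => (-x, (M : EReal))) h1
    (by fun_prop)

/-- Writing the inequality for `M - w` with values in `[0, ∞]` lets `-∞` contribute `∞` and removes
all integrability conditions, so that Tonelli, Fatou and monotone convergence apply directly. -/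
lemma SubMean.lintegral_le {w : ℂ → EReal} {M : ℝ} (h : SubMean w) (h0 : w 0 ≠ ⊥) (h0' : w 0 ≠ ⊤)
    (hM : ∀ θ : ℝ, w (circleMap 0 1 θ) ≤ M) :
    w 0 ≤ M ∧ ∫⁻ θ in Ioc 0 (2 * Real.pi), defect M (w (circleMap 0 1 θ)) ≤
      ENNReal.ofReal (2 * Real.pi) * defect M (w 0) := by
  obtain ⟨h1, h2, h3⟩ := h h0
  have hpi : 0 < 2 * Real.pi := by positivity
  rw [CircleIntegrable, intervalIntegrable_iff_integrableOn_Ioc_of_le hpi.le] at h2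
  rw [Real.circleAverage, intervalIntegral.integral_of_le hpi.le, smul_eq_mul] at h3
  lift w 0 to ℝ using ⟨h0', h0⟩ with c hc
  simp only [EReal.toReal_coe] at h3
  have hle : ∀ᵐ θ : ℝ, (w (circleMap 0 1 θ)).toReal ≤ M := by
    filter_upwards [h1] with θ hθ
    exact EReal.toReal_le_toReal (hM θ) hθ (EReal.coe_ne_top M)
  have hI : Integrable (fun θ : ℝ => M - (w (circleMap 0 1 θ)).toReal)
      (volume.restrict (Ioc 0 (2 * Real.pi))) := (integrable_const M).sub h2
  have hint : ∫⁻ θ in Ioc 0 (2 * Real.pi), defect M (w (circleMap 0 1 θ)) =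
      ENNReal.ofReal (∫ θ in Ioc 0 (2 * Real.pi), (M - (w (circleMap 0 1 θ)).toReal)) := by
    rw [ofReal_integral_eq_lintegral_ofReal hI]
    · refine lintegral_congr_ae (ae_restrict_of_ae ?_)
      filter_upwards [h1] with θ hθ
      have h4 : w (circleMap 0 1 θ) ≠ ⊤ := ne_top_of_le_ne_top (EReal.coe_ne_top M) (hM θ)
      rw [← defect_coe, EReal.coe_toReal h4 hθ]
    · refine ae_restrict_of_ae ?_
      filter_upwards [hle] with θ hθ
      simpa using hθ
  have hI2 : ∫ θ in Ioc 0 (2 * Real.pi), (M - (w (circleMap 0 1 θ)).toReal) =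
      2 * Real.pi * M - ∫ θ in Ioc 0 (2 * Real.pi), (w (circleMap 0 1 θ)).toReal := by
    rw [integral_sub (integrable_const M) h2]
    simp [hpi.le]
  have h5 : 2 * Real.pi * c ≤ ∫ θ in Ioc 0 (2 * Real.pi), (w (circleMap 0 1 θ)).toReal := by
    rwa [← le_inv_mul_iff₀ hpi]
  constructor
  · have : 0 ≤ ∫ θ in Ioc 0 (2 * Real.pi), (M - (w (circleMap 0 1 θ)).toReal) := by
      refine integral_nonneg_of_ae (ae_restrict_of_ae ?_)
      filter_upwards [hle] with θ hθ
      simpa using hθ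
    rw [hI2] at this
    exact_mod_cast le_of_mul_le_mul_left (by linarith) hpi
  · rw [hint, defect_coe, ← ENNReal.ofReal_mul hpi.le, hI2]
    exact ENNReal.ofReal_le_ofReal (by linarith)

/-- Converse of `SubMean.lintegral_le`: finiteness of the lower integral forces `w` to be finite
almost everywhere and integrable on the circle. Measurability is the price of starting from a lower
integral. -/
lemma subMean_of_lintegral_le {w : ℂ → EReal} {M : ℝ}
    (hw : Measurable fun θ : ℝ => w (circleMap 0 1 θ))
    (hM : ∀ θ : ℝ, w (circleMap 0 1 θ) ≤ M) (h0 : w 0 ≤ M)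
    (h : w 0 ≠ ⊥ → ∫⁻ θ in Ioc 0 (2 * Real.pi), defect M (w (circleMap 0 1 θ)) ≤
      ENNReal.ofReal (2 * Real.pi) * defect M (w 0)) : SubMean w := by
  intro hb
  specialize h hb
  have hpi : 0 < 2 * Real.pi := by positivity
  have h0' : w 0 ≠ ⊤ := ne_top_of_le_ne_top (EReal.coe_ne_top M) h0
  lift w 0 to ℝ using ⟨h0', hb⟩ with c hc
  have hcM : c ≤ M := by exact_mod_cast h0
  rw [defect_coe, ← ENNReal.ofReal_mul hpi.le] at h
  have hm : Measurable fun θ : ℝ => defect M (w (circleMap 0 1 θ)) :=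
    (continuous_defect M).measurable.comp hw
  have hfin : ∀ᵐ θ ∂volume.restrict (Ioc 0 (2 * Real.pi)), w (circleMap 0 1 θ) ≠ ⊥ := by
    filter_upwards [ae_lt_top hm (ne_top_of_le_ne_top ENNReal.ofReal_ne_top h)] with θ hθ hbot
    rw [hbot, defect_bot] at hθ
    exact hθ.ne rfl
  have hcongr : (fun θ : ℝ => defect M (w (circleMap 0 1 θ))) =ᵐ[volume.restrict
      (Ioc 0 (2 * Real.pi))] fun θ => ENNReal.ofReal (M - (w (circleMap 0 1 θ)).toReal) := by
    filter_upwards [hfin] with θ hθ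
    have h4 : w (circleMap 0 1 θ) ≠ ⊤ := ne_top_of_le_ne_top (EReal.coe_ne_top M) (hM θ)
    rw [← defect_coe, EReal.coe_toReal h4 hθ]
  have hnn : 0 ≤ᵐ[volume.restrict (Ioc 0 (2 * Real.pi))]
      fun θ => M - (w (circleMap 0 1 θ)).toReal := by
    filter_upwards [hfin] with θ hθ
    simpa using EReal.toReal_le_toReal (hM θ) hθ (EReal.coe_ne_top M)
  rw [lintegral_congr_ae hcongr] at h
  have hmr : Measurable fun θ : ℝ => (w (circleMap 0 1 θ)).toReal :=
    hw.ereal_toReal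
  have hI : Integrable (fun θ : ℝ => M - (w (circleMap 0 1 θ)).toReal)
      (volume.restrict (Ioc 0 (2 * Real.pi))) := by
    refine ⟨(measurable_const.sub hmr).aestronglyMeasurable, ?_⟩
    rw [hasFiniteIntegral_iff_ofReal hnn]
    exact h.trans_lt ENNReal.ofReal_lt_top
  have hI' : Integrable (fun θ : ℝ => (w (circleMap 0 1 θ)).toReal)
      (volume.restrict (Ioc 0 (2 * Real.pi))) := by
    exact ((integrable_const M).sub hI).congr (.of_forall fun θ => by simp)
  refine ⟨ae_of_ae_Ioc_of_periodic hpi (periodic_comp_circleMap (fun ζ => w ζ ≠ ⊥)) hfin, ?_, ?_⟩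
  · rw [CircleIntegrable, intervalIntegrable_iff_integrableOn_Ioc_of_le hpi.le]
    exact hI'
  · rw [Real.circleAverage, intervalIntegral.integral_of_le hpi.le, smul_eq_mul,
      le_inv_mul_iff₀ hpi]
    rw [← ofReal_integral_eq_lintegral_ofReal hI hnn, integral_sub (integrable_const M) hI',
      ENNReal.ofReal_le_ofReal_iff (mul_nonneg hpi.le (by linarith))] at h
    simp only [integral_const, measureReal_restrict_apply_univ, smul_eq_mul] at h
    simp [hpi.le] at h
    rw [EReal.toReal_coe]
    linarith

lemma SubMean.sub {w : ℂ → EReal} {g : ℂ → ℝ} (h : SubMean w) (h0 : w 0 ≠ ⊤)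
    (hw : ∀ θ : ℝ, w (circleMap 0 1 θ) ≠ ⊤)
    (hg : CircleIntegrable g 0 1) (hgm : Real.circleAverage g 0 1 ≤ g 0) :
    SubMean fun ζ => w ζ - (g ζ : EReal) := by
  intro hb
  have hb' : w 0 ≠ ⊥ := by
    intro hb'; simp [hb'] at hb
  obtain ⟨h1, h2, h3⟩ := h hb'
  have hpi : 0 < 2 * Real.pi := by positivity
  have hae : ∀ᵐ θ : ℝ, (w (circleMap 0 1 θ) - (g (circleMap 0 1 θ) : EReal)).toReal =
      (w (circleMap 0 1 θ)).toReal - g (circleMap 0 1 θ) := by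
    filter_upwards [h1] with θ hθ
    rw [EReal.toReal_sub (hw θ) hθ (EReal.coe_ne_top _) (EReal.coe_ne_bot _), EReal.toReal_coe]
  refine ⟨?_, ?_, ?_⟩
  · filter_upwards [h1] with θ hθ hbot
    have := hw θ
    lift w (circleMap 0 1 θ) to ℝ using ⟨this, hθ⟩ with c
    rw [← EReal.coe_sub] at hbot
    exact EReal.coe_ne_bot _ hbot
  · exact IntervalIntegrable.congr_ae (IntervalIntegrable.sub h2 hg)
      (ae_restrict_of_ae (by filter_upwards [hae] with θ hθ using hθ.symm))
  · have : Real.circleAverage (fun ζ => (w ζ - (g ζ : EReal)).toReal) 0 1 =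
        Real.circleAverage (fun ζ => (w ζ).toReal) 0 1 - Real.circleAverage g 0 1 := by
      rw [← Real.circleAverage_fun_sub h2 hg, Real.circleAverage, Real.circleAverage]
      congr 1
      refine intervalIntegral.integral_congr_ae ?_
      filter_upwards [hae] with θ hθ _ using hθ
    rw [this, EReal.toReal_sub h0 hb' (EReal.coe_ne_top _) (EReal.coe_ne_bot _), EReal.toReal_coe]
    linarith

/-! ### The maximum principle on the unit disc -/

lemma circleMap_zero_one_mem_sphere (θ : ℝ) : circleMap 0 1 θ ∈ Metric.sphere (0 : ℂ) 1 :=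
  circleMap_mem_sphere 0 zero_le_one θ

/-- Sub-mean value inequality on all small circles around every point of the open unit disc. -/
def LocallySubMean (s : ℂ → EReal) : Prop :=
  ∀ a ∈ Metric.ball (0 : ℂ) 1, s a ≠ ⊥ → ∀ᶠ r : ℝ in 𝓝[>] 0, SubMean fun ζ => s (a + r * ζ)

/-- With `M = m` the defect vanishes at the centre, so a nonnegative function on the circle has
integral zero. -/
lemma SubMean.eq_on_circle_of_le {w : ℂ → EReal} {m : ℝ} (h : SubMean w) (h0 : w 0 = m)
    (hle : ∀ θ : ℝ, w (circleMap 0 1 θ) ≤ m) : ∀ᵐ θ : ℝ, w (circleMap 0 1 θ) = m := by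
  obtain ⟨-, h2⟩ := h.lintegral_le (M := m) (by simp [h0]) (by simp [h0]) hle
  obtain ⟨h1, h3, -⟩ := h (by simp [h0])
  rw [h0, defect_coe, sub_self, ENNReal.ofReal_zero, mul_zero, nonpos_iff_eq_zero] at h2
  have hpi : 0 < 2 * Real.pi := by positivity
  rw [CircleIntegrable, intervalIntegrable_iff_integrableOn_Ioc_of_le hpi.le] at h3
  have hm : AEMeasurable (fun θ : ℝ => defect m (w (circleMap 0 1 θ)))
      (volume.restrict (Ioc 0 (2 * Real.pi))) := by
    have : AEMeasurable (fun θ : ℝ => ENNReal.ofReal (m - (w (circleMap 0 1 θ)).toReal))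
      (volume.restrict (Ioc 0 (2 * Real.pi))) :=
      (aemeasurable_const.sub h3.1.aemeasurable).ennreal_ofReal
    refine this.congr (ae_restrict_of_ae ?_)
    filter_upwards [h1] with θ hθ
    have h4 : w (circleMap 0 1 θ) ≠ ⊤ := ne_top_of_le_ne_top (EReal.coe_ne_top m) (hle θ)
    rw [← defect_coe, EReal.coe_toReal h4 hθ]
  rw [lintegral_eq_zero_iff' hm] at h2
  refine ae_of_ae_Ioc_of_periodic hpi (periodic_comp_circleMap (fun ζ => w ζ = m)) ?_
  filter_upwards [h2, ae_restrict_of_ae h1] with θ hθ hb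
  have h4 : w (circleMap 0 1 θ) ≠ ⊤ := ne_top_of_le_ne_top (EReal.coe_ne_top m) (hle θ)
  have h5 := hle θ
  lift w (circleMap 0 1 θ) to ℝ using ⟨h4, hb⟩ with c
  simp only [defect_coe, Pi.zero_apply, ENNReal.ofReal_eq_zero] at hθ
  norm_cast at h5 ⊢
  linarith

/-- Suppose the maximum exceeds the boundary bound, and take the maximum point with the largest real
part. A small circle around it consists almost everywhere of maximum points. Its rightmost point is
not one, and by semicontinuity neither is any point of an arc around it, which has positive measure.
-/
theorem le_of_locallySubMean {s : ℂ → EReal} {M : EReal}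
    (hs : UpperSemicontinuousOn s (Metric.closedBall 0 1))
    (htop : ∀ ζ ∈ Metric.closedBall (0 : ℂ) 1, s ζ ≠ ⊤)
    (hsub : LocallySubMean s) (hM : ∀ ζ ∈ Metric.sphere (0 : ℂ) 1, s ζ ≤ M) :
    ∀ ζ ∈ Metric.closedBall (0 : ℂ) 1, s ζ ≤ M := by
  have hK : IsCompact (Metric.closedBall (0 : ℂ) 1) := isCompact_closedBall 0 1
  obtain ⟨z, hz, hmax⟩ := hs.exists_isMaxOn (Metric.nonempty_closedBall.2 zero_le_one) hK
  by_contra! hcon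
  obtain ⟨ζ₀, hζ₀, hlt⟩ := hcon
  have hmM : M < s z := hlt.trans_le (hmax hζ₀)
  -- the set of maximum points
  have hKm : IsCompact {ζ ∈ Metric.closedBall (0 : ℂ) 1 | s z ≤ s ζ} := by
    obtain ⟨v, hv, hv'⟩ := upperSemicontinuousOn_iff_preimage_Ici.1 hs (s z)
    have : {ζ ∈ Metric.closedBall (0 : ℂ) 1 | s z ≤ s ζ} = Metric.closedBall (0 : ℂ) 1 ∩ v := by
      rw [← hv']; rfl
    rw [this]
    exact hK.inter_right hv
  obtain ⟨a, ⟨haD, haz⟩, ha⟩ := hKm.exists_isMaxOn ⟨z, hz, le_rfl⟩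
    (Complex.continuous_re.continuousOn)
  have hsa : s a = s z := le_antisymm (hmax haD) haz
  have haB : a ∈ Metric.ball (0 : ℂ) 1 := by
    rw [Metric.mem_closedBall] at haD
    rcases haD.lt_or_eq with h | h
    · exact h
    · exact absurd (hM a h) (not_le.2 (hmM.trans_le haz))
  have hbot : s a ≠ ⊥ := by rw [hsa]; exact (bot_le.trans_lt hmM).ne'
  have htop' : s a ≠ ⊤ := htop a haD
  have hball : ∀ᶠ r : ℝ in 𝓝[>] 0, r < 1 - ‖a‖ :=
    nhdsWithin_le_nhds (gt_mem_nhds (by simpa using haB))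
  obtain ⟨r, ⟨hr, hr1⟩, hr0⟩ := (((hsub a haB hbot).and hball).and
    (eventually_mem_nhdsWithin)).exists
  have hr0 : 0 < r := hr0
  have hin : ∀ ζ : ℂ, ‖ζ‖ = 1 → a + r * ζ ∈ Metric.closedBall (0 : ℂ) 1 := by
    intro ζ hζ
    rw [mem_closedBall_zero_iff]
    refine (norm_add_le _ _).trans ?_
    rw [norm_mul, hζ, mul_one, Complex.norm_real, Real.norm_of_nonneg hr0.le]
    linarith
  have hcirc : ∀ θ : ℝ, a + r * circleMap 0 1 θ ∈ Metric.closedBall (0 : ℂ) 1 := fun θ =>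
    hin _ (by simp)
  lift s a to ℝ using ⟨htop', hbot⟩ with m hm
  have hae : ∀ᵐ θ : ℝ, s (a + r * circleMap 0 1 θ) = m := by
    refine hr.eq_on_circle_of_le (m := m) (by simp [← hm]) fun θ => ?_
    rw [hsa]
    exact hmax (hcirc θ)
  have hlt1 : s (a + r * circleMap 0 1 0) < m := by
    by_contra! hcon
    have h1 : a + r * circleMap 0 1 0 ∈ {ζ ∈ Metric.closedBall (0 : ℂ) 1 | s z ≤ s ζ} :=
      ⟨hcirc 0, by rw [← hsa]; exact hcon⟩
    have h2 : (a + r * circleMap 0 1 0).re ≤ a.re := ha h1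
    simp [circleMap] at h2
    linarith
  have husc := hs _ (hcirc 0) m hlt1
  have htend : Tendsto (fun θ : ℝ => a + r * circleMap 0 1 θ) (𝓝 0)
      (𝓝[Metric.closedBall 0 1] (a + r * circleMap 0 1 0)) := by
    refine tendsto_nhdsWithin_iff.2 ⟨?_, .of_forall hcirc⟩
    exact Continuous.tendsto (by fun_prop) 0
  have hev : ∀ᶠ θ : ℝ in 𝓝 0, s (a + r * circleMap 0 1 θ) < m := htend.eventually husc
  have hzero : volume {θ : ℝ | s (a + r * circleMap 0 1 θ) < m} = 0 :=
    measure_mono_null (fun θ hθ => (hθ : _ < _).ne) hae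
  exact (Measure.measure_pos_of_mem_nhds volume hev).ne' hzero

/-! ### From local to global sub-mean values -/

/-- On the unit circle `c * ζ ^ (-m)` is the conjugate of `conj c * ζ ^ m` and has the same real
part. This gives the harmonic extension of a trigonometric polynomial to the disc. The factor `c` is
carried along because taking real parts is not `ℂ`-linear. -/
lemma exists_entire_re_eq {p : C(AddCircle (2 * Real.pi), ℂ)}
    (hp : p ∈ Submodule.span ℂ (range (fourier (T := 2 * Real.pi)))) (c : ℂ) :
    ∃ Q : ℂ → ℂ, Differentiable ℂ Q ∧
      ∀ θ : ℝ, (c * p (θ : AddCircle (2 * Real.pi))).re = (Q (circleMap 0 1 θ)).re := by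
  induction hp using Submodule.span_induction generalizing c with
  | mem x h =>
    obtain ⟨k, rfl⟩ := h
    have hk : ∀ θ : ℝ, fourier k (θ : AddCircle (2 * Real.pi)) = circleMap 0 1 θ ^ k := by
      intro θ
      rw [fourier_coe_apply, circleMap, zero_add, Complex.ofReal_one, one_mul, ← Complex.exp_int_mul]
      congr 1
      push_cast
      field_simp
    obtain ⟨m, rfl | rfl⟩ := k.eq_nat_or_neg
    · exact ⟨fun ζ => c * ζ ^ m, by fun_prop, fun θ => by rw [hk]; simp⟩
    · refine ⟨fun ζ => (starRingEnd ℂ c) * ζ ^ m, by fun_prop, fun θ => ?_⟩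
      rw [hk, ← Complex.conj_re, map_mul, map_zpow₀]
      congr 2
      have h1 : ‖circleMap 0 1 θ‖ = 1 := by simp
      have h2 : (starRingEnd ℂ) (circleMap 0 1 θ) = (circleMap 0 1 θ)⁻¹ := by
        rw [Complex.inv_def, Complex.normSq_eq_norm_sq, h1]; simp
      rw [h2]
      simp
  | zero => exact ⟨0, by fun_prop, by simp⟩
  | add x y _ _ hx hy =>
    obtain ⟨Q, hQ, hQ'⟩ := hx c
    obtain ⟨R, hR, hR'⟩ := hy c
    refine ⟨Q + R, hQ.add hR, fun θ => ?_⟩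
    simp [mul_add, ← hQ', ← hR']
  | smul a x _ hx =>
    obtain ⟨Q, hQ, hQ'⟩ := hx (c * a)
    refine ⟨Q, hQ, fun θ => ?_⟩
    rw [← hQ', ContinuousMap.smul_apply, smul_eq_mul, mul_assoc]

lemma usc_sub_coe {Y : Type*} [TopologicalSpace Y] {s : Y → EReal} {g : Y → ℝ} {D : Set Y}
    (hs : UpperSemicontinuousOn s D) (hg : ContinuousOn g D) :
    UpperSemicontinuousOn (fun y => s y - (g y : EReal)) D := by
  have h : UpperSemicontinuousOn (fun y => ((-g y : ℝ) : EReal)) D :=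
    (continuous_coe_real_ereal.comp_continuousOn hg.neg).upperSemicontinuousOn
  have := hs.add' h fun x _ =>
    EReal.continuousAt_add (Or.inr (EReal.coe_ne_bot _)) (Or.inr (EReal.coe_ne_top _))
  simpa only [EReal.coe_neg, ← sub_eq_add_neg] using this

/-- A lower semicontinuous nonnegative function on a metric space is the supremum of an increasing
sequence of continuous functions. -/
lemma exists_monotone_continuous_iSup_eq {Y : Type*} [PseudoMetricSpace Y] {g : Y → ENNReal}
    (hg : LowerSemicontinuous g) : ∃ φ : ℕ → Y → ℝ, (∀ k, Continuous (φ k)) ∧ (∀ k y, 0 ≤ φ k y) ∧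
      Monotone (fun k y => ENNReal.ofReal (φ k y)) ∧ ∀ y, ⨆ k, ENNReal.ofReal (φ k y) = g y := by
  -- Lipschitz regularization by inf-convolution; the cap `k` keeps it finite where `g` is `∞`.
  let h : ℕ → Y → ENNReal := fun k y => min (k : ENNReal) (⨅ z, g z + k * edist y z)
  have hcont : ∀ k, Continuous (h k) := by
    intro k
    refine continuous_const.min
      (continuous_of_le_add_edist k (ENNReal.natCast_ne_top k) fun x y => ?_)
    rw [ENNReal.iInf_add]
    refine le_iInf fun z => (iInf_le _ z).trans ?_
    rw [add_assoc, ← mul_add]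
    gcongr
    rw [add_comm]
    exact edist_triangle x y z
  have hfin : ∀ k y, h k y ≠ ⊤ := fun k y =>
    ne_top_of_le_ne_top (ENNReal.natCast_ne_top k) (min_le_left _ _)
  have hof : ∀ k y, ENNReal.ofReal (h k y).toReal = h k y := fun k y =>
    ENNReal.ofReal_toReal (hfin k y)
  refine ⟨fun k y => (h k y).toReal, fun k => ?_, fun k y => ENNReal.toReal_nonneg, ?_, ?_⟩
  · exact continuous_iff_continuousAt.2 fun y =>
      (ENNReal.tendsto_toReal (hfin k y)).comp (hcont k).continuousAt
  · intro k l hkl y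
    simp only [hof, h]
    gcongr
  · intro y
    simp only [hof]
    refine le_antisymm (iSup_le fun k => (min_le_right _ _).trans ((iInf_le _ y).trans (by simp))) ?_
    refine le_of_forall_lt fun c hc => ?_
    obtain ⟨c', hcc', hc'⟩ := exists_between hc
    have hev := hg y c' hc'
    obtain ⟨δ, hδ, hball⟩ := EMetric.mem_nhds_iff.1 hev
    have hc't : c' ≠ ⊤ := hc'.ne_top
    -- The first summand makes the penalty `k * edist` exceed `c'` outside the `δ`-ball, the second
    -- makes the cap exceed `c'`; `min δ 1` guards against `δ = ∞`.
    obtain ⟨k, hk⟩ := ENNReal.exists_nat_gt (r := c' / min δ 1 + c')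
      (by simp [ENNReal.div_eq_top, hc't, hδ.ne'])
    refine hcc'.trans_le (le_trans ?_ (le_iSup _ k))
    refine le_min (le_trans le_add_self hk.le) (le_iInf fun z => ?_)
    by_cases hz : edist z y < δ
    · exact (le_of_lt (hball hz)).trans le_self_add
    · refine le_trans ?_ le_add_self
      rw [edist_comm]
      calc c' ≤ c' / min δ 1 * min δ 1 := by
            rw [ENNReal.div_mul_cancel] <;> simp [hδ.ne']
        _ ≤ k * edist z y := by
            gcongr
            · exact le_self_add.trans hk.le
            · exact (min_le_left _ _).trans (not_lt.1 hz)

lemma exists_real_bound_of_usc {Y : Type*} [TopologicalSpace Y] {s : Y → EReal} {K : Set Y}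
    (hK : IsCompact K) (hs : UpperSemicontinuousOn s K) (htop : ∀ y ∈ K, s y ≠ ⊤) :
    ∃ M : ℝ, ∀ y ∈ K, s y ≤ M := by
  rcases K.eq_empty_or_nonempty with rfl | hne
  · exact ⟨0, by simp⟩
  obtain ⟨z, hz, hmax⟩ := hs.exists_isMaxOn hne hK
  exact ⟨(s z).toReal, fun y hy => (hmax hy).trans (EReal.le_coe_toReal (htop z hz))⟩

lemma measurable_comp_circleMap {s : ℂ → EReal}
    (hs : UpperSemicontinuousOn s (Metric.sphere 0 1)) :
    Measurable fun θ : ℝ => s (circleMap 0 1 θ) := by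
  refine UpperSemicontinuous.measurable fun θ => ?_
  intro c hc
  have htend : Tendsto (circleMap 0 1) (𝓝 θ) (𝓝[Metric.sphere 0 1] (circleMap 0 1 θ)) :=
    tendsto_nhdsWithin_iff.2 ⟨(continuous_circleMap 0 1).tendsto θ,
      .of_forall circleMap_zero_one_mem_sphere⟩
  exact htend.eventually (hs _ (circleMap_zero_one_mem_sphere θ) c hc)

lemma circleAverage_comp_add_mul (g : ℂ → ℝ) (a : ℂ) (r : ℝ) :
    Real.circleAverage (fun ζ => g (a + r * ζ)) 0 1 = Real.circleAverage g a r := by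
  rw [Real.circleAverage_eq_circleAverage_zero_one (c := a)]
  simp only [add_comm]

lemma circleAverage_re_of_differentiable {Q : ℂ → ℂ} (hQ : Differentiable ℂ Q) (a : ℂ) (r : ℝ) :
    Real.circleAverage (fun ζ => (Q ζ).re) a r = (Q a).re :=
  InnerProductSpace.HarmonicOnNhd.circleAverage_eq fun z _ => (hQ.analyticAt z).harmonicAt_re

/-- The boundary values of `s` are a decreasing limit of continuous functions `M - φ k`. Each of
these is uniformly close to `Re Q` with `Q` entire, by density of trigonometric polynomials. The
maximum principle for `s - Re Q` and the mean value property of `Re Q` give the inequality at the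
centre. -/
theorem subMean_of_locallySubMean {s : ℂ → EReal}
    (hs : UpperSemicontinuousOn s (Metric.closedBall 0 1))
    (htop : ∀ ζ ∈ Metric.closedBall (0 : ℂ) 1, s ζ ≠ ⊤)
    (hsub : LocallySubMean s) : SubMean s := by
  have : Fact (0 < 2 * Real.pi) := ⟨by positivity⟩
  have hpi : 0 < 2 * Real.pi := by positivity
  obtain ⟨M, hM⟩ := exists_real_bound_of_usc (isCompact_closedBall 0 1) hs htop
  have hcD : ∀ θ : ℝ, circleMap 0 1 θ ∈ Metric.closedBall (0 : ℂ) 1 := fun θ =>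
    Metric.sphere_subset_closedBall (circleMap_zero_one_mem_sphere θ)
  have h0D : (0 : ℂ) ∈ Metric.closedBall (0 : ℂ) 1 := Metric.mem_closedBall_self zero_le_one
  refine subMean_of_lintegral_le (M := M)
    (measurable_comp_circleMap (hs.mono Metric.sphere_subset_closedBall))
    (fun θ => hM _ (hcD θ)) (hM 0 h0D) fun hb => ?_
  have hmem : ∀ x : AddCircle (2 * Real.pi), ((AddCircle.toCircle x : Circle) : ℂ) ∈
      Metric.closedBall (0 : ℂ) 1 := fun x =>
    mem_closedBall_zero_iff.2 (Circle.norm_coe _).le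
  have hcoe : ∀ θ : ℝ, ((AddCircle.toCircle (θ : AddCircle (2 * Real.pi)) : Circle) : ℂ) =
      circleMap 0 1 θ := fun θ => by
    rw [AddCircle.toCircle_apply_mk, Circle.coe_exp, circleMap]
    field_simp
    simp
  have hlsc : LowerSemicontinuous fun x : AddCircle (2 * Real.pi) =>
      defect M (s (AddCircle.toCircle x : Circle)) := by
    have husc : UpperSemicontinuous fun x : AddCircle (2 * Real.pi) =>
        s (AddCircle.toCircle x : Circle) := by
      intro x c hc
      have htend : Tendsto (fun x : AddCircle (2 * Real.pi) => ((AddCircle.toCircle x : Circle) : ℂ))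
          (𝓝 x) (𝓝[Metric.closedBall 0 1] ((AddCircle.toCircle x : Circle) : ℂ)) :=
        tendsto_nhdsWithin_iff.2 ⟨(continuous_subtype_val.comp
          AddCircle.continuous_toCircle).tendsto x, .of_forall hmem⟩
      exact htend.eventually (hs _ (hmem x) c hc)
    exact (continuous_defect M).comp_upperSemicontinuous_antitone husc (defect_anti M)
  obtain ⟨φ, hφc, hφ0, hφm, hφs⟩ := exists_monotone_continuous_iSup_eq hlsc
  have hrw : ∀ θ : ℝ, defect M (s (circleMap 0 1 θ)) =
      ⨆ k, ENNReal.ofReal (φ k (θ : AddCircle (2 * Real.pi))) := fun θ => by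
    rw [hφs, hcoe]
  have hφc' : ∀ k, Continuous fun θ : ℝ => φ k (θ : AddCircle (2 * Real.pi)) := fun k =>
    (hφc k).comp continuous_quotient_mk'
  simp only [hrw]
  rw [lintegral_iSup (fun k => (hφc' k).measurable.ennreal_ofReal)
    (fun k l hkl θ => hφm hkl _)]
  refine iSup_le fun k => ?_
  have hint : IntegrableOn (fun θ : ℝ => φ k (θ : AddCircle (2 * Real.pi)))
      (Ioc 0 (2 * Real.pi)) :=
    ((hφc' k).integrableOn_Icc (a := 0) (b := 2 * Real.pi)).mono_set Ioc_subset_Icc_self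
  rw [← ofReal_integral_eq_lintegral_ofReal hint (.of_forall fun θ => hφ0 k _)]
  have h0t := htop 0 h0D
  lift s 0 to ℝ using ⟨h0t, hb⟩ with c hc
  rw [defect_coe, ← ENNReal.ofReal_mul hpi.le]
  refine ENNReal.ofReal_le_ofReal ?_
  -- One `δ` comes from the maximum principle for `s - Re Q`, the other from comparing the mean of
  -- `Re Q` with that of `M - φ k`.
  suffices H : ∀ δ > 0, c ≤ M - (2 * Real.pi)⁻¹ *
      (∫ θ in Ioc 0 (2 * Real.pi), φ k (θ : AddCircle (2 * Real.pi))) + 2 * δ by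
    have h1 : c ≤ M - (2 * Real.pi)⁻¹ *
        (∫ θ in Ioc 0 (2 * Real.pi), φ k (θ : AddCircle (2 * Real.pi))) :=
      le_of_forall_pos_le_add fun ε hε => (H (ε / 2) (by positivity)).trans (by linarith)
    have h2 : (2 * Real.pi)⁻¹ * (∫ θ in Ioc 0 (2 * Real.pi), φ k (θ : AddCircle (2 * Real.pi)))
        ≤ M - c := by linarith
    rwa [inv_mul_le_iff₀ hpi] at h2
  intro δ hδ
  let ψ : C(AddCircle (2 * Real.pi), ℂ) := ⟨fun x => ((M - φ k x : ℝ) : ℂ), by fun_prop⟩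
  have hψ : ψ ∈ (Submodule.span ℂ (range (fourier (T := 2 * Real.pi)))).topologicalClosure := by
    rw [span_fourier_closure_eq_top]; trivial
  obtain ⟨p, hp, hdist⟩ := Metric.mem_closure_iff.1 hψ δ hδ
  obtain ⟨Q, hQ, hQp⟩ := exists_entire_re_eq hp 1
  have hclose : ∀ θ : ℝ, |M - φ k (θ : AddCircle (2 * Real.pi)) - (Q (circleMap 0 1 θ)).re| ≤ δ := by
    intro θ
    rw [← hQp, one_mul]
    have h1 := (ContinuousMap.dist_apply_le_dist (f := ψ) (g := p)
      (θ : AddCircle (2 * Real.pi))).trans hdist.le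
    rw [dist_eq_norm] at h1
    refine le_trans ?_ h1
    have h2 := Complex.abs_re_le_norm (ψ (θ : AddCircle (2 * Real.pi)) - p θ)
    simpa [ψ] using h2
  have hle0 : ∀ ζ ∈ Metric.closedBall (0 : ℂ) 1, s ζ - ((Q ζ).re : EReal) ≤ δ := by
    refine le_of_locallySubMean (usc_sub_coe hs
      (Complex.continuous_re.comp hQ.continuous).continuousOn) ?_ ?_ ?_
    · intro ζ hζ h
      have := htop ζ hζ
      induction h' : s ζ with
      | bot => simp [h'] at h
      | top => exact this h'
      | coe x => rw [h', ← EReal.coe_sub] at h; exact EReal.coe_ne_top _ h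
    · intro a ha hb
      have hb' : s a ≠ ⊥ := fun h => by simp [h] at hb
      have hball : ∀ᶠ r : ℝ in 𝓝[>] 0, r < 1 - ‖a‖ :=
        nhdsWithin_le_nhds (gt_mem_nhds (by simpa using ha))
      filter_upwards [hsub a ha hb', hball, self_mem_nhdsWithin] with r hr hr1 hr0
      have hr0 : 0 < r := hr0
      refine hr.sub (g := fun ζ => (Q (a + r * ζ)).re) ?_ ?_ ?_ ?_
      · simpa using htop a (Metric.ball_subset_closedBall ha)
      · intro θ
        refine htop _ ?_
        rw [mem_closedBall_zero_iff]
        refine (norm_add_le _ _).trans ?_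
        simp [abs_of_pos hr0]
        linarith
      · have : Continuous fun ζ : ℂ => (Q (a + r * ζ)).re := by
          have := hQ.continuous
          fun_prop
        exact this.continuousOn.circleIntegrable zero_le_one
      · rw [circleAverage_comp_add_mul (fun ζ => (Q ζ).re),
          circleAverage_re_of_differentiable hQ]
        simp
    · intro ζ hζ
      obtain ⟨θ, rfl⟩ : ∃ θ : ℝ, circleMap 0 1 θ = ζ := by
        have : ζ ∈ range (circleMap 0 1) := by rw [range_circleMap]; simpa using hζ
        exact this
      have h1 := abs_le.1 (hclose θ)
      have h2 : s (circleMap 0 1 θ) ≤ ((M - φ k (θ : AddCircle (2 * Real.pi)) : ℝ) : EReal) := by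
        have h3 : ENNReal.ofReal (φ k (θ : AddCircle (2 * Real.pi))) ≤
            defect M (s (circleMap 0 1 θ)) := by
          rw [hrw]; exact le_iSup (fun k => ENNReal.ofReal (φ k (θ : AddCircle (2 * Real.pi)))) k
        have h4 := htop _ (hcD θ)
        have h5 := hM _ (hcD θ)
        induction h' : s (circleMap 0 1 θ) with
        | bot => exact bot_le
        | top => exact absurd h' h4
        | coe x =>
          rw [h'] at h3 h5
          have h5 : x ≤ M := by exact_mod_cast h5
          rw [defect_coe, ENNReal.ofReal_le_ofReal_iff (by linarith)] at h3
          exact_mod_cast (by linarith : x ≤ M - φ k (θ : AddCircle (2 * Real.pi)))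
      rw [EReal.sub_le_iff_le_add (Or.inl (EReal.coe_ne_bot _)) (Or.inl (EReal.coe_ne_top _))]
      refine h2.trans ?_
      rw [← EReal.coe_add, EReal.coe_le_coe_iff]
      linarith
  have h1 := hle0 0 h0D
  rw [← hc, ← EReal.coe_sub, EReal.coe_le_coe_iff] at h1
  have hQint : CircleIntegrable (fun ζ => (Q ζ).re) 0 1 := by
    have := hQ.continuous
    exact (by fun_prop : Continuous fun ζ => (Q ζ).re).continuousOn.circleIntegrable zero_le_one
  have h2 := circleAverage_re_of_differentiable hQ 0 1
  rw [Real.circleAverage, intervalIntegral.integral_of_le hpi.le, smul_eq_mul] at h2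
  rw [CircleIntegrable, intervalIntegrable_iff_integrableOn_Ioc_of_le hpi.le] at hQint
  have h3 : ∫ θ in Ioc 0 (2 * Real.pi), (Q (circleMap 0 1 θ)).re ≤
      ∫ θ in Ioc 0 (2 * Real.pi), (M + δ - φ k (θ : AddCircle (2 * Real.pi))) := by
    refine integral_mono hQint ((integrable_const _).sub hint) fun θ => ?_
    have := abs_le.1 (hclose θ)
    simp only
    linarith
  rw [integral_sub (integrable_const _) hint] at h3
  have h4 : ∫ θ in Ioc 0 (2 * Real.pi), (M + δ) = 2 * Real.pi * (M + δ) := by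
    simp [hpi.le]
  rw [h4] at h3
  have h5 := mul_le_mul_of_nonneg_left h3 (inv_nonneg.2 hpi.le)
  rw [h2, mul_sub, inv_mul_cancel_left₀ hpi.ne'] at h5
  linarith

/-! ### Plurisubharmonic functions on open subsets of `ℂⁿ` -/

/-- Plurisubharmonicity on a subset of `ℂⁿ`, in the standard coordinates. -/
def PshFlat (w : Cn n → EReal) (S : Set (Cn n)) : Prop :=
  UpperSemicontinuousOn w S ∧ (∀ x ∈ S, w x ≠ ⊤) ∧
    ∀ a b : Cn n, (∀ ζ ∈ Metric.closedBall (0 : ℂ) 1, a + ζ • b ∈ S) →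
      SubMean fun ζ => w (a + ζ • b)

lemma PshFlat.mono {w : Cn n → EReal} {S T : Set (Cn n)} (h : PshFlat w S) (hT : T ⊆ S) :
    PshFlat w T :=
  ⟨h.1.mono hT, fun x hx => h.2.1 x (hT hx), fun a b hab => h.2.2 a b fun ζ hζ => hT (hab ζ hζ)⟩

lemma usc_comp_line {w : Cn n → EReal} {S : Set (Cn n)} (hw : UpperSemicontinuousOn w S)
    {a b : Cn n} {D : Set ℂ} (hab : ∀ ζ ∈ D, a + ζ • b ∈ S) :
    UpperSemicontinuousOn (fun ζ : ℂ => w (a + ζ • b)) D := by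
  intro ζ hζ c hc
  have htend : Tendsto (fun ζ : ℂ => a + ζ • b) (𝓝[D] ζ) (𝓝[S] (a + ζ • b)) :=
    tendsto_nhdsWithin_iff.2 ⟨(Continuous.tendsto (by fun_prop) ζ).mono_left nhdsWithin_le_nhds,
      eventually_mem_nhdsWithin.mono hab⟩
  exact htend.eventually (hw _ (hab ζ hζ) c hc)

lemma eventually_disc_subset {T : Set (Cn n)} (hT : IsOpen T) {a b : Cn n}
    (hab : ∀ ζ ∈ Metric.closedBall (0 : ℂ) 1, a + ζ • b ∈ T) :
    ∀ᶠ z in 𝓝 a, ∀ ζ ∈ Metric.closedBall (0 : ℂ) 1, z + ζ • b ∈ T := by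
  refine (isCompact_closedBall (0 : ℂ) 1).eventually_forall_of_forall_eventually fun ζ hζ => ?_
  have hc : Continuous fun p : Cn n × ℂ => p.1 + p.2 • b := by fun_prop
  exact hc.continuousAt.eventually (hT.mem_nhds (hab ζ hζ))

lemma eventually_small_disc_subset {E : Type*} [NormedAddCommGroup E] [NormedSpace ℂ E]
    {T : Set E} (hT : IsOpen T) {a : E} (ha : a ∈ T) (b : E) :
    ∀ᶠ r : ℝ in 𝓝[>] 0, ∀ ζ ∈ Metric.closedBall (0 : ℂ) 1, a + ((r : ℂ) * ζ) • b ∈ T := by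
  refine nhdsWithin_le_nhds ?_
  refine (isCompact_closedBall (0 : ℂ) 1).eventually_forall_of_forall_eventually fun ζ hζ => ?_
  have hc : Continuous fun p : ℝ × ℂ => a + ((p.1 : ℂ) * p.2) • b := by fun_prop
  exact hc.continuousAt.eventually (hT.mem_nhds (by simpa using ha))

/-- Only centres with a finite value are tested, so a function that is set to `-∞` on a zero set
needs no check there beyond semicontinuity. -/
theorem pshFlat_of_local {w : Cn n → EReal} {S : Set (Cn n)}
    (hw : UpperSemicontinuousOn w S) (htop : ∀ x ∈ S, w x ≠ ⊤)
    (h : ∀ a ∈ S, w a ≠ ⊥ → ∀ b, ∀ᶠ r : ℝ in 𝓝[>] 0, SubMean fun ζ => w (a + ((r : ℂ) * ζ) • b)) :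
    PshFlat w S := by
  refine ⟨hw, htop, fun a b hab => ?_⟩
  refine subMean_of_locallySubMean (usc_comp_line hw hab) (fun ζ hζ => htop _ (hab ζ hζ)) ?_
  intro ζ₀ hζ₀ hb
  filter_upwards [h _ (hab ζ₀ (Metric.ball_subset_closedBall hζ₀)) hb b] with r hr
  simpa only [add_smul, add_assoc] using hr

lemma isOpen_usc_lt {Y : Type*} [TopologicalSpace Y] {w : Y → EReal} {S : Set Y} (hS : IsOpen S)
    (hw : UpperSemicontinuousOn w S) (c : EReal) : IsOpen {x ∈ S | w x < c} := by
  rw [isOpen_iff_mem_nhds]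
  rintro x ⟨hxS, hx⟩
  have := hw x hxS c hx
  rw [hS.nhdsWithin_eq hxS] at this
  filter_upwards [this, hS.mem_nhds hxS] with y h1 h2 using ⟨h2, h1⟩

/-- The sub-mean value inequality passes to an upper semicontinuous function that is approximated
from below, at nearby centres, by functions satisfying it. -/
theorem subMean_of_frequently {w : Cn n → EReal} {S : Set (Cn n)} (hS : IsOpen S)
    (hw : UpperSemicontinuousOn w S) (htop : ∀ x ∈ S, w x ≠ ⊤) {a b : Cn n}
    (hab : ∀ ζ ∈ Metric.closedBall (0 : ℂ) 1, a + ζ • b ∈ S)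
    (h : ∀ c : ℝ, (c : EReal) < w a → ∃ᶠ z in 𝓝 a, ∃ s : ℂ → EReal, SubMean s ∧ (c : EReal) ≤ s 0 ∧
      s 0 ≤ w z ∧ ∀ θ : ℝ, s (circleMap 0 1 θ) ≤ w (z + circleMap 0 1 θ • b)) :
    SubMean fun ζ => w (a + ζ • b) := by
  have hcD : ∀ θ : ℝ, circleMap 0 1 θ ∈ Metric.closedBall (0 : ℂ) 1 := fun θ =>
    Metric.sphere_subset_closedBall (circleMap_zero_one_mem_sphere θ)
  have h0D : (0 : ℂ) ∈ Metric.closedBall (0 : ℂ) 1 := Metric.mem_closedBall_self zero_le_one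
  have huscl := usc_comp_line hw hab
  obtain ⟨M, hM⟩ := exists_real_bound_of_usc (isCompact_closedBall (0 : ℂ) 1) huscl
    fun ζ hζ => htop _ (hab ζ hζ)
  -- On this open set one constant bounds `w` from above, so all discs with centres close to `a` can
  -- use the same defect.
  set T : Set (Cn n) := {x ∈ S | w x < ((M + 1 : ℝ) : EReal)} with hTdef
  have hT : IsOpen T := isOpen_usc_lt hS hw _
  have habT : ∀ ζ ∈ Metric.closedBall (0 : ℂ) 1, a + ζ • b ∈ T := fun ζ hζ =>
    ⟨hab ζ hζ, (hM ζ hζ).trans_lt (by exact_mod_cast lt_add_one M)⟩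
  have htube := eventually_disc_subset hT habT
  refine subMean_of_lintegral_le (M := M + 1)
    (measurable_comp_circleMap (huscl.mono Metric.sphere_subset_closedBall))
    (fun θ => (habT _ (hcD θ)).2.le) (habT 0 h0D).2.le fun hb => ?_
  simp only [zero_smul, add_zero] at hb ⊢
  have haT : w a ≠ ⊤ := by simpa using htop _ (hab 0 h0D)
  have hex : ∀ j : ℕ, ∃ z : Cn n, dist z a < 1 / (j + 1) ∧
      (∀ ζ ∈ Metric.closedBall (0 : ℂ) 1, z + ζ • b ∈ T) ∧
      ∫⁻ θ in Ioc 0 (2 * Real.pi), defect (M + 1) (w (z + circleMap 0 1 θ • b)) ≤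
        ENNReal.ofReal (2 * Real.pi) * defect (M + 1) (((w a).toReal - 1 / (j + 1) : ℝ)) := by
    intro j
    have hj : (0 : ℝ) < 1 / (j + 1) := by positivity
    have hlt : (((w a).toReal - 1 / (j + 1) : ℝ) : EReal) < w a := by
      conv_rhs => rw [← EReal.coe_toReal haT hb]
      exact_mod_cast sub_lt_self _ hj
    obtain ⟨z, ⟨s, hs, hcs, hsz, hsθ⟩, hz1, hz2⟩ :=
      ((h _ hlt).and_eventually (htube.and (Metric.ball_mem_nhds a hj))).exists
    refine ⟨z, hz2, hz1, ?_⟩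
    have hzT : z ∈ T := by simpa using hz1 0 h0D
    have hs0 : s 0 ≠ ⊥ := (lt_of_lt_of_le (EReal.bot_lt_coe _) hcs).ne'
    have hs0' : s 0 ≠ ⊤ := ne_top_of_le_ne_top (htop z hzT.1) hsz
    refine le_trans (lintegral_mono fun θ => defect_anti _ (hsθ θ)) ?_
    refine (hs.lintegral_le hs0 hs0' fun θ => (hsθ θ).trans (hz1 _ (hcD θ)).2.le).2.trans ?_
    gcongr
    exact defect_anti _ hcs
  choose z hz hzT hzI using hex
  have hlim : Tendsto z atTop (𝓝 a) :=
    tendsto_iff_dist_tendsto_zero.2 (squeeze_zero (fun _ => dist_nonneg) (fun j => (hz j).le)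
      tendsto_one_div_add_atTop_nhds_zero_nat)
  have hmeas : ∀ j, Measurable fun θ : ℝ => defect (M + 1) (w (z j + circleMap 0 1 θ • b)) :=
    fun j => (continuous_defect _).measurable.comp (measurable_comp_circleMap
      (s := fun ζ => w (z j + ζ • b)) ((usc_comp_line hw fun ζ hζ => (hzT j ζ hζ).1).mono
      Metric.sphere_subset_closedBall))
  -- Along centres `z j → a` the defect of `w` is lower semicontinuous, and Fatou's lemma passes the
  -- inequality to the limit.
  calc ∫⁻ θ in Ioc 0 (2 * Real.pi), defect (M + 1) (w (a + circleMap 0 1 θ • b))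
      ≤ ∫⁻ θ in Ioc 0 (2 * Real.pi),
          liminf (fun j => defect (M + 1) (w (z j + circleMap 0 1 θ • b))) atTop := by
        refine lintegral_mono fun θ => ?_
        refine le_of_forall_lt fun c hc => ?_
        obtain ⟨c', hcc', hc'⟩ := exists_between hc
        refine hcc'.trans_le (le_liminf_of_le (by isBoundedDefault) ?_)
        have hlsc : LowerSemicontinuousAt (fun x => defect (M + 1) (w x))
            (a + circleMap 0 1 θ • b) := by
          have h1 : UpperSemicontinuousAt w (a + circleMap 0 1 θ • b) := by
            intro c hc
            have := hw _ (hab _ (hcD θ)) c hc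
            rwa [hS.nhdsWithin_eq (hab _ (hcD θ))] at this
          exact (continuous_defect _).continuousAt.comp_upperSemicontinuousAt_antitone h1
            (defect_anti _)
        have h2 : Tendsto (fun j => z j + circleMap 0 1 θ • b) atTop
            (𝓝 (a + circleMap 0 1 θ • b)) := hlim.add_const _
        exact (h2.eventually (hlsc c' hc')).mono fun j hj => le_of_lt hj
    _ ≤ liminf (fun j => ∫⁻ θ in Ioc 0 (2 * Real.pi),
          defect (M + 1) (w (z j + circleMap 0 1 θ • b))) atTop := lintegral_liminf_le hmeas
    _ ≤ liminf (fun j : ℕ => ENNReal.ofReal (2 * Real.pi) *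
          defect (M + 1) (((w a).toReal - 1 / (j + 1) : ℝ))) atTop :=
        liminf_le_liminf (.of_forall hzI)
    _ = ENNReal.ofReal (2 * Real.pi) * defect (M + 1) (w a) := by
        refine Tendsto.liminf_eq (ENNReal.Tendsto.const_mul ?_ (Or.inr ENNReal.ofReal_ne_top))
        refine ((continuous_defect _).tendsto (w a)).comp ?_
        conv_rhs => rw [← EReal.coe_toReal haT hb]
        refine (continuous_coe_real_ereal.tendsto _).comp ?_
        simpa using tendsto_const_nhds.sub
          (tendsto_one_div_add_atTop_nhds_zero_nat (𝕜 := ℝ))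

/-! ### Solid means -/

lemma measurable_ite_usc {Y : Type*} [TopologicalSpace Y] [MeasurableSpace Y]
    [OpensMeasurableSpace Y] {w : Y → EReal} {S : Set Y} [DecidablePred (· ∈ S)]
    (hS : MeasurableSet S) (hw : UpperSemicontinuousOn w S) :
    Measurable fun x => if x ∈ S then w x else ⊥ := by
  refine measurable_of_Iio fun c => ?_
  rcases eq_bot_or_bot_lt c with rfl | hc
  · simp
  obtain ⟨u, hu, huc⟩ := upperSemicontinuousOn_iff_preimage_Iio.1 hw c
  have : (fun x => if x ∈ S then w x else ⊥) ⁻¹' Iio c = S ∩ u ∪ Sᶜ := by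
    rw [← huc]
    ext x
    by_cases hx : x ∈ S <;> simp [hx, hc]
  rw [this]
  exact (hS.inter hu.measurableSet).union hS.compl

lemma measurePreserving_circle_smul (θ : ℝ) :
    MeasurePreserving (fun z : Cn n => circleMap 0 1 θ • z) := by
  let L : Cn n ≃ₗᵢ[ℝ] Cn n :=
    { toFun := fun z => circleMap 0 1 θ • z
      invFun := fun z => (circleMap 0 1 θ)⁻¹ • z
      map_add' := fun x y => smul_add _ _ _
      map_smul' := fun r x => smul_comm _ _ _
      left_inv := fun x => by
        have : circleMap 0 1 θ ≠ 0 := circleMap_ne_center one_ne_zero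
        simp [smul_smul, this]
      right_inv := fun x => by
        have : circleMap 0 1 θ ≠ 0 := circleMap_ne_center one_ne_zero
        simp [smul_smul, this]
      norm_map' := fun x => by
        change ‖circleMap 0 1 θ • x‖ = ‖x‖
        rw [norm_smul]; simp }
  exact L.measurePreserving

/-- Integrate the inequality on the circle of direction `b` over all `b` in the ball. Rotations
preserve the ball and the measure, so after Tonelli the inner integral does not depend on the angle,
and the solid mean appears without polar coordinates. -/
theorem PshFlat.lintegral_le {w : Cn n → EReal} {q : Cn n} {ρ M : ℝ}
    (hw : PshFlat w (Metric.closedBall q ρ)) (hM : ∀ x ∈ Metric.closedBall q ρ, w x ≤ M)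
    (hq : w q ≠ ⊥) (hρ : 0 ≤ ρ) :
    ∫⁻ x in Metric.closedBall q ρ, defect M (w x) ≤
      volume (Metric.closedBall q ρ) * defect M (w q) := by
  classical
  let B : Set (Cn n) := Metric.closedBall 0 ρ
  have hB : MeasurableSet B := measurableSet_closedBall
  let W : Cn n → ENNReal := fun b =>
    defect M (if b ∈ B then w (q + b) else ⊥)
  have hqB : ∀ b ∈ B, q + b ∈ Metric.closedBall q ρ := fun b hb => by
    simpa [B] using hb
  have hW : Measurable W := by
    refine (continuous_defect M).measurable.comp (measurable_ite_usc hB ?_)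
    intro b hb c hc
    have htend : Tendsto (fun b : Cn n => q + b) (𝓝[B] b) (𝓝[Metric.closedBall q ρ] (q + b)) :=
      tendsto_nhdsWithin_iff.2 ⟨(Continuous.tendsto (by fun_prop) b).mono_left nhdsWithin_le_nhds,
        eventually_mem_nhdsWithin.mono hqB⟩
    exact htend.eventually (hw.1 _ (hqB b hb) c hc)
  have hrotB : ∀ (θ : ℝ) (b : Cn n), circleMap 0 1 θ • b ∈ B ↔ b ∈ B := fun θ b => by
    simp [B, norm_smul]
  have hI : ∫⁻ x in Metric.closedBall q ρ, defect M (w x) = ∫⁻ b in B, W b := by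
    have hmp := measurePreserving_add_left (volume : Measure (Cn n)) q
    have hemb : MeasurableEmbedding (fun b : Cn n => q + b) := measurableEmbedding_addLeft q
    rw [← hmp.setLIntegral_comp_preimage_emb hemb]
    have hpre : (fun b : Cn n => q + b) ⁻¹' Metric.closedBall q ρ = B := by
      ext b; simp [B]
    rw [hpre]
    refine setLIntegral_congr_fun hB fun b hb => ?_
    simp only [W, if_pos hb]
  have hrot : ∀ θ : ℝ, ∫⁻ b in B, W (circleMap 0 1 θ • b) = ∫⁻ b in B, W b := by
    intro θ
    have hmp := measurePreserving_circle_smul (n := n) θ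
    have hpre : (fun b : Cn n => circleMap 0 1 θ • b) ⁻¹' B = B := by
      ext b; exact hrotB θ b
    conv_lhs => rw [← hpre]
    exact hmp.setLIntegral_comp_preimage hB hW
  have hpi : 0 < 2 * Real.pi := by positivity
  have hswap : ∫⁻ θ in Ioc 0 (2 * Real.pi), ∫⁻ b in B, W (circleMap 0 1 θ • b) =
      ∫⁻ b in B, ∫⁻ θ in Ioc 0 (2 * Real.pi), W (circleMap 0 1 θ • b) := by
    refine lintegral_lintegral_swap (Measurable.aemeasurable ?_)
    refine hW.comp ?_
    exact Continuous.measurable (by fun_prop)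
  simp only [hrot, lintegral_const, Measure.restrict_apply_univ, Real.volume_Ioc, sub_zero] at hswap
  have hle : ∫⁻ b in B, ∫⁻ θ in Ioc 0 (2 * Real.pi), W (circleMap 0 1 θ • b) ≤
      ∫⁻ _ in B, ENNReal.ofReal (2 * Real.pi) * defect M (w q) := by
    refine setLIntegral_mono' hB fun b hb => ?_
    have hdisc : ∀ ζ ∈ Metric.closedBall (0 : ℂ) 1, q + ζ • b ∈ Metric.closedBall q ρ := by
      intro ζ hζ
      simp only [B, mem_closedBall_zero_iff] at hb hζ
      simp only [Metric.mem_closedBall, dist_self_add_left, norm_smul]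
      exact (mul_le_mul hζ hb (norm_nonneg _) zero_le_one).trans (by simp)
    have := (hw.2.2 q b hdisc).lintegral_le (M := M) (by simpa using hq)
      (by simpa using hw.2.1 q (Metric.mem_closedBall_self hρ))
      (fun θ => hM _ (hdisc _ (Metric.sphere_subset_closedBall (circleMap_zero_one_mem_sphere θ))))
    simp only [W, hrotB, if_pos hb]
    simpa using this.2
  rw [← hswap, lintegral_const, Measure.restrict_apply_univ] at hle
  rw [hI]
  have hvol : volume B = volume (Metric.closedBall q ρ) :=
    (Measure.addHaar_closedBall_center volume q ρ).symm
  rw [← hvol]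
  have h2 : ENNReal.ofReal (2 * Real.pi) * ∫⁻ b in B, W b ≤
      ENNReal.ofReal (2 * Real.pi) * (volume B * defect M (w q)) := by
    calc _ = (∫⁻ b in B, W b) * ENNReal.ofReal (2 * Real.pi) := mul_comm _ _
      _ ≤ _ := hle
      _ = _ := by ring
  exact (ENNReal.mul_le_mul_iff_right (by simpa using hpi) ENNReal.ofReal_ne_top).1 h2

theorem PshFlat.integrableOn_closedBall {w : Cn n → EReal} {q : Cn n} {ρ : ℝ}
    (hw : PshFlat w (Metric.closedBall q ρ)) (hq : w q ≠ ⊥) (hρ : 0 ≤ ρ) :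
    (∀ᵐ x ∂volume.restrict (Metric.closedBall q ρ), w x ≠ ⊥) ∧
      IntegrableOn (fun x => (w x).toReal) (Metric.closedBall q ρ) := by
  classical
  obtain ⟨M, hM⟩ := exists_real_bound_of_usc (isCompact_closedBall q ρ) hw.1 hw.2.1
  have hle := hw.lintegral_le hM hq hρ
  have hBm : MeasurableSet (Metric.closedBall q ρ) := measurableSet_closedBall
  have hfinv : volume (Metric.closedBall q ρ) ≠ ⊤ := measure_closedBall_lt_top.ne
  have hfin : ∫⁻ x in Metric.closedBall q ρ, defect M (w x) ≠ ⊤ :=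
    ne_top_of_le_ne_top (ENNReal.mul_ne_top hfinv (by rwa [Ne, defect_eq_top_iff])) hle
  have hmeas : AEMeasurable w (volume.restrict (Metric.closedBall q ρ)) := by
    refine (measurable_ite_usc hBm hw.1).aemeasurable.congr ?_
    filter_upwards [ae_restrict_mem hBm] with x hx
    simp [hx]
  have hdm : AEMeasurable (fun x => defect M (w x)) (volume.restrict (Metric.closedBall q ρ)) :=
    (continuous_defect M).measurable.comp_aemeasurable hmeas
  have hbot : ∀ᵐ x ∂volume.restrict (Metric.closedBall q ρ), w x ≠ ⊥ := by
    filter_upwards [ae_lt_top' hdm hfin] with x hx hb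
    rw [hb, defect_bot] at hx
    exact hx.ne rfl
  refine ⟨hbot, ?_⟩
  have hI : IntegrableOn (fun x => M - (w x).toReal) (Metric.closedBall q ρ) := by
    refine ⟨(aemeasurable_const.sub hmeas.ereal_toReal).aestronglyMeasurable, ?_⟩
    rw [hasFiniteIntegral_iff_ofReal]
    · refine lt_of_eq_of_lt (lintegral_congr_ae ?_) (lt_top_iff_ne_top.2 hfin)
      filter_upwards [hbot, ae_restrict_mem hBm] with x hx hxB
      rw [← defect_coe, EReal.coe_toReal (hw.2.1 x hxB) hx]
    · filter_upwards [hbot, ae_restrict_mem hBm] with x hx hxB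
      simpa using EReal.toReal_le_toReal (hM x hxB) hx (EReal.coe_ne_top M)
  have hc : IntegrableOn (fun _ : Cn n => M) (Metric.closedBall q ρ) := integrableOn_const hfinv
  exact (hc.sub hI).congr (.of_forall fun x => by simp)

/-- This is how a bound known off a null set reaches every point: a larger value at the centre would
contradict the solid mean inequality. -/
theorem PshFlat.le_of_ae_le {w : Cn n → EReal} {q : Cn n} {ρ : ℝ} {c : EReal}
    (hw : PshFlat w (Metric.closedBall q ρ)) (hρ : 0 < ρ)
    (hc : ∀ᵐ x ∂volume.restrict (Metric.closedBall q ρ), w x ≤ c) : w q ≤ c := by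
  by_contra! hlt
  have hq : w q ≠ ⊥ := (bot_le.trans_lt hlt).ne'
  obtain ⟨M, hM⟩ := exists_real_bound_of_usc (isCompact_closedBall q ρ) hw.1 hw.2.1
  have hle := hw.lintegral_le hM hq hρ.le
  have hqM := hM q (Metric.mem_closedBall_self hρ.le)
  have hge : volume (Metric.closedBall q ρ) * defect M c ≤
      ∫⁻ x in Metric.closedBall q ρ, defect M (w x) := by
    calc _ = ∫⁻ _ in Metric.closedBall q ρ, defect M c := by
          rw [lintegral_const, Measure.restrict_apply_univ, mul_comm]
      _ ≤ _ := lintegral_mono_ae (hc.mono fun x hx => defect_anti M hx)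
  have h3 := (ENNReal.mul_le_mul_iff_right (Metric.measure_closedBall_pos volume q hρ).ne'
    measure_closedBall_lt_top.ne).1 (hge.trans hle)
  have hqt : w q ≠ ⊤ := hw.2.1 q (Metric.mem_closedBall_self hρ.le)
  lift w q to ℝ using ⟨hqt, hq⟩ with x
  have hct : c ≠ ⊤ := hlt.ne_top
  induction c with
  | bot => simp [defect_bot, defect_coe] at h3
  | top => exact hct rfl
  | coe c =>
    have h4 : x ≤ M := by exact_mod_cast hqM
    have h5 : c < x := by exact_mod_cast hlt
    rw [defect_coe, defect_coe, ENNReal.ofReal_le_ofReal_iff (by linarith)] at h3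
    linarith

/-! ### Logarithms of holomorphic functions -/

lemma logAbs_of_ne_zero {Y : Type*} {f : Y → ℂ} {x : Y} (h : f x ≠ 0) :
    logAbs f x = (Real.log ‖f x‖ : ℝ) := by
  rw [logAbs, ← ofReal_norm, ENNReal.log_ofReal_of_pos (norm_pos_iff.2 h)]

lemma logAbs_of_eq_zero {Y : Type*} {f : Y → ℂ} {x : Y} (h : f x = 0) : logAbs f x = ⊥ := by
  simp [logAbs, h]

lemma logAbs_eq_bot_iff {Y : Type*} {f : Y → ℂ} {x : Y} : logAbs f x = ⊥ ↔ f x = 0 := by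
  simp [logAbs]

lemma logAbs_ne_top {Y : Type*} {f : Y → ℂ} {x : Y} : logAbs f x ≠ ⊤ := by
  simp [logAbs]

lemma continuousAt_logAbs {Y : Type*} [TopologicalSpace Y] {f : Y → ℂ} {x : Y}
    (hf : ContinuousAt f x) : ContinuousAt (logAbs f) x :=
  ENNReal.continuous_log.continuousAt.comp (continuous_enorm.continuousAt.comp hf)

/-- On small discs around a point where the holomorphic function `h` does not vanish, `log |h|` is
harmonic. -/
lemma eventually_log_norm_mean {E : Type*} [NormedAddCommGroup E] [NormedSpace ℂ E] {h : E → ℂ}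
    {S : Set E} (hS : IsOpen S) (hh : AnalyticOnNhd ℂ h S) {a : E} (ha : a ∈ S) (h0 : h a ≠ 0)
    (b : E) :
    ∀ᶠ r : ℝ in 𝓝[>] 0,
      (∀ ζ ∈ Metric.closedBall (0 : ℂ) 1, a + ((r : ℂ) * ζ) • b ∈ S ∧
        h (a + ((r : ℂ) * ζ) • b) ≠ 0) ∧
      CircleIntegrable (fun ζ => Real.log ‖h (a + ((r : ℂ) * ζ) • b)‖) 0 1 ∧
      Real.circleAverage (fun ζ => Real.log ‖h (a + ((r : ℂ) * ζ) • b)‖) 0 1 =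
        Real.log ‖h a‖ := by
  have hT : IsOpen (S ∩ h ⁻¹' {0}ᶜ) := hh.continuousOn.isOpen_inter_preimage hS isOpen_compl_singleton
  filter_upwards [eventually_small_disc_subset hT ⟨ha, h0⟩ b] with r hr
  have hr' : ∀ ζ ∈ Metric.closedBall (0 : ℂ) 1, h (a + ((r : ℂ) * ζ) • b) ≠ 0 :=
    fun ζ hζ => (hr ζ hζ).2
  have hA : AnalyticOnNhd ℂ (fun ζ : ℂ => h (a + ((r : ℂ) * ζ) • b))
      (Metric.closedBall (0 : ℂ) |1|) := by
    intro ζ hζ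
    rw [abs_one] at hζ
    have hline : AnalyticAt ℂ (fun ζ : ℂ => a + ((r : ℂ) * ζ) • b) ζ := by fun_prop
    exact AnalyticAt.fun_comp (hh _ (hr ζ hζ).1) hline
  refine ⟨fun ζ hζ => ⟨(hr ζ hζ).1, (hr ζ hζ).2⟩, ?_, ?_⟩
  · refine ContinuousOn.circleIntegrable zero_le_one ?_
    have hc : ContinuousOn (fun ζ : ℂ => h (a + ((r : ℂ) * ζ) • b)) (Metric.sphere (0 : ℂ) 1) :=
      hA.continuousOn.mono (by simpa using Metric.sphere_subset_closedBall)
    exact hc.norm.log fun ζ hζ => norm_ne_zero_iff.2 (hr' ζ (Metric.sphere_subset_closedBall hζ))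
  · rw [AnalyticOnNhd.circleAverage_log_norm_of_ne_zero hA (by simpa using hr')]
    simp

lemma subMean_coe {g : ℂ → ℝ} (hg : CircleIntegrable g 0 1)
    (hm : g 0 ≤ Real.circleAverage g 0 1) : SubMean fun ζ => (g ζ : EReal) := fun _ =>
  ⟨.of_forall fun _ => EReal.coe_ne_bot _, by simpa using hg, by simpa using hm⟩

theorem pshFlat_logAbs {h : Cn n → ℂ} {S : Set (Cn n)} (hS : IsOpen S)
    (hh : AnalyticOnNhd ℂ h S) : PshFlat (logAbs h) S := by
  refine pshFlat_of_local (fun x hx => ?_) (fun x _ => logAbs_ne_top) fun a ha hb b => ?_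
  · exact (continuousAt_logAbs (hh x hx).continuousAt).continuousWithinAt.upperSemicontinuousWithinAt
  · have h0 : h a ≠ 0 := fun h0 => hb (logAbs_of_eq_zero h0)
    filter_upwards [eventually_log_norm_mean hS hh ha h0 b] with r ⟨hr1, hr2, hr3⟩
    refine (subMean_coe hr2 (by simp [hr3])).congr ?_ fun θ => ?_
    · rw [logAbs_of_ne_zero]; simpa using h0
    · rw [logAbs_of_ne_zero]
      exact (hr1 _ (Metric.sphere_subset_closedBall (circleMap_zero_one_mem_sphere θ))).2

/-- The zero set of a holomorphic function is locally a null set, unless it contains an open set. -/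
lemma exists_null_zeros {h : Cn n → ℂ} {q : Cn n} (hh : AnalyticAt ℂ h q)
    (hne : ∃ᶠ z in 𝓝 q, h z ≠ 0) : ∃ ρ > 0, volume {z ∈ Metric.ball q ρ | h z = 0} = 0 := by
  obtain ⟨R, hR, hball⟩ := Metric.eventually_nhds_iff_ball.1 hh.eventually_analyticAt
  -- The radii are such that the ball of radius `R / 2` about `z` lies in the ball of radius `R`
  -- about `q` and contains the one of radius `R / 6`. Integrability of `log |h|` there makes its
  -- zeros a null set.
  obtain ⟨z, hz0, hz⟩ := (hne.and_eventually (Metric.ball_mem_nhds q (ε := R / 3)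
    (by positivity))).exists
  have hsub : Metric.closedBall z (R / 2) ⊆ Metric.ball q R := by
    intro x hx
    rw [Metric.mem_closedBall] at hx
    rw [Metric.mem_ball]
    have hz : dist z q < R / 3 := hz
    linarith [dist_triangle x z q]
  have hp := (pshFlat_logAbs Metric.isOpen_ball fun x hx => hball x hx).mono hsub
  have := (hp.integrableOn_closedBall (fun hb => hz0 (logAbs_eq_bot_iff.1 hb)) (by positivity)).1
  rw [ae_restrict_iff' measurableSet_closedBall] at this
  refine ⟨R / 6, by positivity, measure_mono_null ?_ this⟩
  rintro x ⟨hx, hx0⟩ hcon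
  refine hcon ?_ (logAbs_of_eq_zero hx0)
  rw [Metric.mem_closedBall]
  have hz : dist z q < R / 3 := hz
  rw [Metric.mem_ball] at hx
  linarith [dist_triangle_right x z q]

/-! ### Lines on which a function vanishes to a higher order than in the whole space -/

/-- The iterated derivatives of `F` in the direction `b`. -/
def dirDeriv (b : Cn n) (F : Cn n → ℂ) : ℕ → Cn n → ℂ
  | 0 => F
  | j + 1 => fun q => fderiv ℂ (dirDeriv b F j) q b

lemma analyticOnNhd_dirDeriv {b : Cn n} {F : Cn n → ℂ} {S : Set (Cn n)}
    (hF : AnalyticOnNhd ℂ F S) (j : ℕ) : AnalyticOnNhd ℂ (dirDeriv b F j) S := by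
  induction j with
  | zero => exact hF
  | succ j ih =>
    intro q hq
    exact ((ContinuousLinearMap.apply ℂ ℂ b).analyticAt _).fun_comp (ih q hq).fderiv

lemma analyticAt_slice {F : Cn n → ℂ} {b q : Cn n} (hF : AnalyticAt ℂ F q) :
    AnalyticAt ℂ (fun ζ : ℂ => F (q + ζ • b)) 0 := by
  have h1 : AnalyticAt ℂ (fun ζ : ℂ => q + ζ • b) 0 := by fun_prop
  exact AnalyticAt.fun_comp (by simpa using hF) h1

lemma iteratedDeriv_slice {b : Cn n} {F : Cn n → ℂ} {S : Set (Cn n)} (hS : IsOpen S)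
    (hF : AnalyticOnNhd ℂ F S) {q : Cn n} (hq : q ∈ S) (j : ℕ) :
    iteratedDeriv j (fun ζ : ℂ => F (q + ζ • b)) =ᶠ[𝓝 0] fun ζ => dirDeriv b F j (q + ζ • b) := by
  induction j with
  | zero => exact .of_eq (by simp [dirDeriv])
  | succ j ih =>
    rw [iteratedDeriv_succ]
    refine ih.deriv.trans ?_
    have hc : Continuous fun ζ : ℂ => q + ζ • b := by fun_prop
    have hev : ∀ᶠ ζ : ℂ in 𝓝 0, q + ζ • b ∈ S :=
      hc.continuousAt.eventually (hS.mem_nhds (by simpa using hq))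
    filter_upwards [hev] with ζ hζ
    have h1 : HasDerivAt (fun ζ : ℂ => q + ζ • b) b ζ := by
      simpa using ((hasDerivAt_id ζ).smul_const b).const_add q
    have h2 := (analyticOnNhd_dirDeriv (b := b) hF j _ hζ).differentiableAt.hasFDerivAt
    exact (h2.comp_hasDerivAt ζ h1).deriv

/-- The order along a line moving with `q` becomes the joint vanishing at `q` of fixed holomorphic
functions. -/
lemma le_order_slice_iff {b : Cn n} {F : Cn n → ℂ} {S : Set (Cn n)} (hS : IsOpen S)
    (hF : AnalyticOnNhd ℂ F S) {q : Cn n} (hq : q ∈ S) (k : ℕ) :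
    (k : ℕ∞) ≤ analyticOrderAt (fun ζ : ℂ => F (q + ζ • b)) 0 ↔ ∀ j < k, dirDeriv b F j q = 0 := by
  rw [natCast_le_analyticOrderAt_iff_iteratedDeriv_eq_zero (analyticAt_slice (hF q hq))]
  refine forall₂_congr fun j _ => ?_
  rw [(iteratedDeriv_slice hS hF hq j).eq_of_nhds]
  simp

/-- The points at which the restriction of `F` to the line in the direction `b` vanishes exactly to
order `k`, but `F` itself does not vanish to order `k`. -/
def badSet (b : Cn n) (F : Cn n → ℂ) (S : Set (Cn n)) (k : ℕ) : Set (Cn n) :=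
  {q ∈ S | analyticOrderAt (fun ζ : ℂ => F (q + ζ • b)) 0 = k ∧
    ¬ F =O[𝓝 q] fun z => ‖z - q‖ ^ k}

/-- Exact order `m + 1` along the line means that the `m`-th directional derivative vanishes at `q₀`
and has nonzero derivative along `b`. By the implicit function theorem its zeros near `q₀` are the
points `q + G q • b`, so every bad point nearby lies on this graph, and the derivatives of order at
most `m` vanish there. If they all vanished identically along the graph, the Schwarz lemma would
give `F = O(‖z - q₀‖ ^ (m + 1))`, against badness of `q₀`. Otherwise one of them is a nontrivial
holomorphic function of `q`, whose zeros are null. -/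
lemma exists_null_badSet_local {b : Cn n} {F : Cn n → ℂ} {S : Set (Cn n)} (hS : IsOpen S)
    (hF : AnalyticOnNhd ℂ F S) {m : ℕ} {q₀ : Cn n} (hq₀ : q₀ ∈ badSet b F S (m + 1)) :
    ∃ ρ > 0, volume {q ∈ Metric.ball q₀ ρ |
      ∃ ζ : ℂ, ‖ζ‖ < ρ ∧ q + ζ • b ∈ badSet b F S (m + 1)} = 0 := by
  obtain ⟨hqS, hord, hbad⟩ := hq₀
  have hD := fun j => analyticOnNhd_dirDeriv (b := b) hF j
  have hvan : ∀ j < m + 1, dirDeriv b F j q₀ = 0 :=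
    (le_order_slice_iff hS hF hqS (m + 1)).1 hord.ge
  have hnv : dirDeriv b F (m + 1) q₀ ≠ 0 := by
    intro h
    have : ((m + 2 : ℕ) : ℕ∞) ≤ analyticOrderAt (fun ζ : ℂ => F (q₀ + ζ • b)) 0 := by
      rw [le_order_slice_iff hS hF hqS]
      intro j hj
      rcases Nat.lt_succ_iff_lt_or_eq.1 hj with h1 | rfl
      · exact hvan j h1
      · exact h
    rw [hord] at this
    have : m + 2 ≤ m + 1 := by exact_mod_cast this
    omega
  -- the implicit function
  let Φ : Cn n × ℂ → ℂ := fun v => dirDeriv b F m (v.1 + v.2 • b)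
  have hΦ : ContDiffAt ℂ ω Φ (q₀, 0) := by
    have h1 : ContDiffAt ℂ ω (dirDeriv b F m) (q₀ + (0 : ℂ) • b) := by
      simpa using (hD m q₀ hqS).contDiffAt
    have h2 : ContDiffAt ℂ ω (fun v : Cn n × ℂ => v.1 + v.2 • b) (q₀, 0) := by fun_prop
    exact h1.comp (q₀, (0 : ℂ)) h2
  -- The partial derivative in the line parameter is multiplication by `dirDeriv b F (m + 1) q₀`.
  have hinv : (fderiv ℂ Φ (q₀, 0) ∘L .inr ℂ (Cn n) ℂ).IsInvertible := by
    have hlin : HasFDerivAt (fun v : Cn n × ℂ => v.1 + v.2 • b)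
        (ContinuousLinearMap.fst ℂ (Cn n) ℂ +
          (ContinuousLinearMap.snd ℂ (Cn n) ℂ).smulRight b) (q₀, 0) :=
      hasFDerivAt_fst.add (hasFDerivAt_snd.smul_const b)
    have h1 : HasFDerivAt (dirDeriv b F m) (fderiv ℂ (dirDeriv b F m) q₀)
        ((fun v : Cn n × ℂ => v.1 + v.2 • b) (q₀, 0)) := by
      simpa using (hD m q₀ hqS).differentiableAt.hasFDerivAt
    have h2 : fderiv ℂ Φ (q₀, 0) = _ := (h1.comp (q₀, (0 : ℂ)) hlin).fderiv
    refine ⟨ContinuousLinearEquiv.unitsEquivAut ℂ (Units.mk0 _ hnv), ?_⟩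
    ext
    rw [h2]
    simp [dirDeriv]
  have hω : (ω : WithTop ℕ∞) ≠ 0 := by simp
  set G := hΦ.implicitFunction hω hinv with hG
  have hΦ0 : Φ (q₀, 0) = 0 := by simpa [Φ] using hvan m (by omega)
  have hG0 : G q₀ = 0 := hΦ.implicitFunction_apply_self hω hinv
  have hGuniq : ∀ᶠ v in 𝓝 (q₀, (0 : ℂ)), Φ v = 0 ↔ G v.1 = v.2 := by
    have := hΦ.eventually_apply_eq_iff_implicitFunction hω hinv
    rwa [hΦ0] at this
  have hGA : AnalyticAt ℂ G q₀ := (hΦ.contDiffAt_implicitFunction hω hinv).analyticAt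
  have hqG : AnalyticAt ℂ (fun q => q + G q • b) q₀ :=
    analyticAt_id.add (hGA.smul analyticAt_const)
  have hFj : ∀ j, AnalyticAt ℂ (fun q => dirDeriv b F j (q + G q • b)) q₀ := fun j =>
    AnalyticAt.fun_comp (by simpa [hG0] using hD j q₀ hqS) hqG
  by_cases hcase : ∀ j < m + 1, ∀ᶠ q in 𝓝 q₀, dirDeriv b F j (q + G q • b) = 0
  · -- `F` vanishes to order `m + 1` along the graph
    exfalso
    apply hbad
    obtain ⟨M, hM⟩ : ∃ M, ∀ᶠ z in 𝓝 q₀, ‖F z‖ ≤ M :=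
      ((hF q₀ hqS).continuousAt.norm.isBoundedUnder_le)
    obtain ⟨R, hR, hRb⟩ := Metric.eventually_nhds_iff_ball.1 ((hS.eventually_mem hqS).and hM)
    have hc : Continuous fun v : Cn n × ℂ => v.1 + v.2 • b := by fun_prop
    have hev : ∀ᶠ v in 𝓝 (q₀, (0 : ℂ)), v.1 + v.2 • b ∈ Metric.ball q₀ R :=
      hc.continuousAt.eventually (Metric.isOpen_ball.eventually_mem (by simpa using hR))
    obtain ⟨δ, hδ, hδb⟩ := Metric.eventually_nhds_iff_ball.1 hev
    have hmem : ∀ q ∈ Metric.ball q₀ δ, ∀ η : ℂ, ‖η‖ < δ → q + η • b ∈ Metric.ball q₀ R := by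
      intro q hq η hη
      refine hδb (q, η) ?_
      rw [← ball_prod_same]
      exact ⟨hq, by simpa using hη⟩
    have hGlim : ∀ᶠ q in 𝓝 q₀, ‖G q‖ < δ / 2 := by
      have : Tendsto (fun q => ‖G q‖) (𝓝 q₀) (𝓝 0) := by
        simpa [hG0] using hGA.continuousAt.norm.tendsto
      exact this.eventually (gt_mem_nhds (by positivity))
    have hall : ∀ᶠ q in 𝓝 q₀, ∀ j < m + 1, dirDeriv b F j (q + G q • b) = 0 :=
      (Set.finite_lt_nat (m + 1)).eventually_all.2 hcase
    have hbound : ∀ᶠ q in 𝓝 q₀, ‖F q‖ ≤ M * (‖G q‖ / (δ / 2)) ^ (m + 1) := by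
      filter_upwards [hGlim, hall, Metric.ball_mem_nhds q₀ hδ] with q hGq hvq hq
      set p := q + G q • b with hp
      have hpR : p ∈ Metric.ball q₀ R := hmem q hq _ (by linarith)
      have hline : ∀ ζ ∈ Metric.ball (0 : ℂ) (δ / 2), p + ζ • b ∈ Metric.ball q₀ R := by
        intro ζ hζ
        rw [hp, add_assoc, ← add_smul]
        refine hmem q hq _ ((norm_add_le _ _).trans_lt ?_)
        rw [mem_ball_zero_iff] at hζ
        linarith
      have hord' := (le_order_slice_iff hS hF (hRb p hpR).1 (m + 1)).2 hvq
      have hp0 : F p = 0 := hvq 0 (by omega)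
      have hpA := analyticAt_slice (b := b) (hF p (hRb p hpR).1)
      have hlit : ((fun ζ : ℂ => F (p + ζ • b)) · - (fun ζ : ℂ => F (p + ζ • b)) 0) =o[𝓝 0]
          (fun ζ : ℂ => ‖ζ - 0‖ ^ m) := by
        obtain ⟨g, hg, hgeq⟩ := (natCast_le_analyticOrderAt hpA).1 hord'
        have h1 : (fun ζ : ℂ => F (p + ζ • b)) =O[𝓝 0] fun ζ : ℂ => ζ ^ (m + 1) := by
          have h2 : (fun ζ : ℂ => (ζ - 0) ^ (m + 1) • g ζ) =O[𝓝 0]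
              fun ζ : ℂ => ζ ^ (m + 1) * 1 := by
            simp only [sub_zero, smul_eq_mul]
            exact (Asymptotics.isBigO_refl _ _).mul (hg.continuousAt.isBigO_one ℂ)
          simpa using Asymptotics.IsBigO.congr' h2 (hgeq.mono fun ζ hζ => hζ.symm) .rfl
        have h3 : (fun ζ : ℂ => ζ ^ (m + 1)) =o[𝓝 0] fun ζ : ℂ => ζ ^ m :=
          Asymptotics.isLittleO_pow_pow (Nat.lt_succ_self m)
        simpa [hp0] using (h1.trans_isLittleO h3).norm_right
      -- The disc is centred at the graph point `p`, where the order along the line is at least `m +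
      -- 1`; the parameter `-G q` leads back to `q`. Since `G q₀ = 0`, the factor `‖G q‖` is `O(‖q -
      -- q₀‖)`.
      have hsch := Complex.dist_le_mul_div_pow_of_mapsTo_ball_of_isLittleO
        (f := fun ζ : ℂ => F (p + ζ • b)) (c := 0) (z := -G q)
        (R₁ := δ / 2) (R₂ := M) (n := m) ?_ ?_ hlit (by simpa using hGq)
      · have : p + -(G q • b) = q := by rw [hp]; simp
        simpa [this, hp0] using hsch
      · intro ζ hζ
        have h1 : DifferentiableAt ℂ (fun ζ : ℂ => p + ζ • b) ζ := by fun_prop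
        exact (DifferentiableAt.comp ζ (hF _ (hRb _ (hline ζ hζ)).1).differentiableAt
          h1).differentiableWithinAt
      · intro ζ hζ
        simpa [hp0] using (hRb _ (hline ζ hζ)).2
    have hGO : G =O[𝓝 q₀] fun z => z - q₀ := by
      simpa [hG0] using hGA.differentiableAt.isBigO_sub
    have h1 : F =O[𝓝 q₀] fun q => ‖G q‖ ^ (m + 1) := by
      refine Asymptotics.IsBigO.of_bound (M / (δ / 2) ^ (m + 1)) ?_
      filter_upwards [hbound] with q hq
      rw [div_pow] at hq
      rw [norm_pow, norm_norm]
      calc _ ≤ _ := hq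
        _ = _ := by ring
    exact h1.trans (hGO.norm_norm.pow (m + 1))
  · push Not at hcase
    obtain ⟨j, hj, hfreq⟩ := hcase
    obtain ⟨ρ₁, hρ₁, hnull⟩ := exists_null_zeros (hFj j) hfreq
    obtain ⟨ρ₂, hρ₂, huniq⟩ := Metric.eventually_nhds_iff_ball.1 hGuniq
    refine ⟨min ρ₁ ρ₂, lt_min hρ₁ hρ₂, measure_mono_null ?_ hnull⟩
    rintro q ⟨hq, ζ, hζ, hqS', hord', -⟩
    refine ⟨Metric.ball_subset_ball (min_le_left _ _) hq, ?_⟩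
    have hv := (le_order_slice_iff hS hF hqS' (m + 1)).1 hord'.ge
    have hmem : (q, ζ) ∈ Metric.ball (q₀, (0 : ℂ)) ρ₂ := by
      rw [← ball_prod_same]
      exact ⟨Metric.ball_subset_ball (min_le_right _ _) hq,
        by simpa using hζ.trans_le (min_le_right _ _)⟩
    have hGz : G q = ζ := (huniq _ hmem).1 (hv m (by omega))
    simp only [hGz]
    exact hv j hj

/-- The local statement only sees bad points close to the base point of the line. A countable
subcover of the bad set, and translations of the base point by parameters from a countable dense
set, reduce every line to that case. For `k = 0` there are no bad points. -/
theorem volume_lines_meeting_badSet {b : Cn n} {F : Cn n → ℂ} {S : Set (Cn n)} (hS : IsOpen S)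
    (hF : AnalyticOnNhd ℂ F S) (k : ℕ) :
    volume {z : Cn n | ∃ ζ : ℂ, z + ζ • b ∈ badSet b F S k} = 0 := by
  rcases k with _ | m
  · have : badSet b F S 0 = ∅ := by
      ext q
      simp only [badSet, mem_ofPred_eq, mem_empty_iff_false, iff_false]
      rintro ⟨hq, -, h⟩
      exact h (by simpa using (hF q hq).continuousAt.isBigO_one ℝ)
    simp [this]
  have hloc := fun q : badSet b F S (m + 1) => exists_null_badSet_local hS hF q.2
  choose ρ hρ hnull using hloc
  obtain ⟨t, htc, ht⟩ := TopologicalSpace.isOpen_iUnion_countable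
    (fun q : badSet b F S (m + 1) => Metric.ball (q : Cn n) (ρ q / 2)) fun q => Metric.isOpen_ball
  obtain ⟨D, hDc, hD⟩ := TopologicalSpace.exists_countable_dense ℂ
  refine measure_mono_null (t := ⋃ q ∈ t, ⋃ η ∈ D, (fun z : Cn n => z + η • b) ⁻¹'
    {x ∈ Metric.ball (q : Cn n) (ρ q) |
      ∃ ζ : ℂ, ‖ζ‖ < ρ q ∧ x + ζ • b ∈ badSet b F S (m + 1)}) ?_ ?_
  · rintro z ⟨ζ, hζ⟩
    have hz : z + ζ • b ∈ ⋃ q ∈ t, Metric.ball (q : Cn n) (ρ q / 2) := by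
      rw [ht]
      exact mem_iUnion.2 ⟨⟨_, hζ⟩, Metric.mem_ball_self (half_pos (hρ _))⟩
    simp only [mem_iUnion] at hz ⊢
    obtain ⟨q, hq, hzq⟩ := hz
    -- Replacing `ζ` by such an `η` moves the point by less than `ρ q / 2` and leaves a parameter `ζ
    -- - η` smaller than `ρ q`.
    have hε : 0 < ρ q / 2 / (‖b‖ + 1) := div_pos (half_pos (hρ q)) (by positivity)
    obtain ⟨η, hηD, hη⟩ := Metric.dense_iff.1 hD ζ _ hε
    rw [Metric.mem_ball, dist_eq_norm, lt_div_iff₀ (by positivity)] at hηD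
    rw [Metric.mem_ball] at hzq
    have hb0 := norm_nonneg b
    have hd0 := norm_nonneg (η - ζ)
    refine ⟨q, hq, η, hη, ?_, ζ - η, ?_, ?_⟩
    · have h1 : dist (z + η • b) (z + ζ • b) = ‖η - ζ‖ * ‖b‖ := by
        rw [dist_add_left, dist_eq_norm, ← sub_smul, norm_smul]
      rw [Metric.mem_ball]
      nlinarith [dist_triangle (z + η • b) (z + ζ • b) q]
    · rw [norm_sub_rev]
      have := hρ q
      nlinarith
    · have : z + η • b + (ζ - η) • b = z + ζ • b := by
        rw [add_assoc, ← add_smul]; simp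
      rwa [this]
  · refine (measure_biUnion_null_iff htc).2 fun q _ => (measure_biUnion_null_iff hDc).2 fun η _ => ?_
    rw [measure_preimage_add_right]
    exact hnull q

/-! ### Dividing a subharmonic function on the disc by the zeros of a holomorphic function -/

lemma EReal_sub_coe_ne_top {x : EReal} {c : ℝ} (hx : x ≠ ⊤) : x - (c : EReal) ≠ ⊤ := by
  induction x with
  | bot => simp
  | top => exact absurd rfl hx
  | coe x => rw [← EReal.coe_sub]; exact EReal.coe_ne_top _

/-- Near a zero of order `k` of `h`, `s - (1 - ε) log |h|` tends to `-∞` if `s` has a logarithmic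
pole of order at least `k`. -/
lemma eventually_sub_log_lt {s : ℂ → EReal} {h : ℂ → ℂ} {a : ℂ} {k : ℕ} (hh : AnalyticAt ℂ h a)
    (hk : analyticOrderAt h a = k) (hk0 : k ≠ 0) {ε : ℝ} (hε : 0 < ε) (hε1 : ε < 1)
    (hs : ∀ δ > 0, δ < 1 → ∃ C : ℝ, ∀ᶠ ζ in 𝓝[≠] a, s ζ ≤ (((k - δ) * Real.log ‖ζ - a‖ + C : ℝ) : EReal))
    (c : ℝ) :
    ∀ᶠ ζ in 𝓝[≠] a, s ζ - (((1 - ε) * Real.log ‖h ζ‖ : ℝ) : EReal) < c := by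
  obtain ⟨g, hg, hg0, hgeq⟩ := (hh.analyticOrderAt_eq_natCast).1 hk
  obtain ⟨C, hC⟩ := hs (ε / 2) (by positivity) (by linarith)
  have hk1 : (1 : ℝ) ≤ k := by exact_mod_cast Nat.one_le_iff_ne_zero.2 hk0
  -- This is the coefficient `(k - ε / 2) - (1 - ε) * k` left in front of `log ‖ζ - a‖`.
  have hcoef : 0 < ε * k - ε / 2 := by nlinarith
  have hlog : Tendsto (fun ζ : ℂ => Real.log ‖ζ - a‖) (𝓝[≠] a) atBot := by
    refine Real.tendsto_log_nhdsNE_zero.comp (tendsto_nhdsWithin_iff.2 ⟨?_, ?_⟩)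
    · have : Tendsto (fun ζ : ℂ => ‖ζ - a‖) (𝓝 a) (𝓝 ‖a - a‖) :=
        Continuous.tendsto (by fun_prop) a
      simpa using this.mono_left nhdsWithin_le_nhds
    · filter_upwards [self_mem_nhdsWithin] with ζ hζ
      simpa [sub_eq_zero] using hζ
  have hgl : Tendsto (fun ζ : ℂ => C - (1 - ε) * Real.log ‖g ζ‖) (𝓝[≠] a)
      (𝓝 (C - (1 - ε) * Real.log ‖g a‖)) := by
    have h1 : ContinuousAt (fun ζ => Real.log ‖g ζ‖) a :=
      hg.continuousAt.norm.log (norm_ne_zero_iff.2 hg0)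
    exact (tendsto_const_nhds.sub (h1.tendsto.const_mul _)).mono_left nhdsWithin_le_nhds
  have hbot := (hlog.const_mul_atBot hcoef).atBot_add hgl
  filter_upwards [hC, hbot.eventually_lt_atBot c, nhdsWithin_le_nhds hgeq,
    nhdsWithin_le_nhds (hg.continuousAt.eventually_ne hg0), self_mem_nhdsWithin]
    with ζ h1 h2 h3 h4 h5
  have h6 : Real.log ‖h ζ‖ = k * Real.log ‖ζ - a‖ + Real.log ‖g ζ‖ := by
    have h7 : ‖ζ - a‖ ≠ 0 := by simpa [sub_eq_zero] using h5
    rw [h3, smul_eq_mul, norm_mul, norm_pow, Real.log_mul (pow_ne_zero _ h7)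
      (norm_ne_zero_iff.2 h4), Real.log_pow]
  refine (EReal.sub_le_sub h1 le_rfl).trans_lt ?_
  rw [← EReal.coe_sub, EReal.coe_lt_coe_iff, h6]
  refine lt_of_eq_of_lt ?_ h2
  ring

/-- Apply the maximum principle to `s - (1 - ε) log |h|`, set to `-∞` at the zeros of `h`, and let
`ε` tend to `0`. The exponent `1 - ε` is needed because a Lelong number at least `k` only yields
poles of order `k - δ`. -/
theorem le_log_of_poles {s : ℂ → EReal} {h : ℂ → ℂ} {c₀ : ℝ} (hc₀ : 0 < c₀)
    (hs : UpperSemicontinuousOn s (Metric.closedBall 0 1))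
    (hs0 : ∀ ζ ∈ Metric.closedBall (0 : ℂ) 1, s ζ ≤ 0) (hsub : LocallySubMean s)
    (hh : AnalyticOnNhd ℂ h (Metric.closedBall 0 1))
    (hhc : ∀ ζ ∈ Metric.sphere (0 : ℂ) 1, c₀ ≤ ‖h ζ‖)
    (hpole : ∀ a ∈ Metric.ball (0 : ℂ) 1, ∀ k : ℕ, k ≠ 0 → analyticOrderAt h a = k → ∀ δ > 0,
      δ < 1 → ∃ C : ℝ, ∀ᶠ ζ in 𝓝[≠] a, s ζ ≤ (((k - δ) * Real.log ‖ζ - a‖ + C : ℝ) : EReal))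
    (h0 : h 0 ≠ 0) : s 0 ≤ ((Real.log ‖h 0‖ - Real.log c₀ : ℝ) : EReal) := by
  classical
  have h0D : (0 : ℂ) ∈ Metric.closedBall (0 : ℂ) 1 := Metric.mem_closedBall_self zero_le_one
  -- As `h 0 ≠ 0`, the identity theorem makes all orders finite, and the lower bound on the circle
  -- keeps the zeros inside.
  have hord : ∀ a ∈ Metric.closedBall (0 : ℂ) 1, h a = 0 →
      a ∈ Metric.ball (0 : ℂ) 1 ∧ ∃ k : ℕ, k ≠ 0 ∧ analyticOrderAt h a = k := by
    intro a ha ha0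
    constructor
    · rw [Metric.mem_closedBall] at ha
      rcases ha.lt_or_eq with h1 | h1
      · exact h1
      · have := hhc a h1
        simp only [ha0, norm_zero] at this
        linarith
    · have hne : analyticOrderAt h a ≠ ⊤ := by
        intro htop
        have := hh.eqOn_zero_of_preconnected_of_eventuallyEq_zero
          (convex_closedBall (0 : ℂ) 1).isPreconnected ha (analyticOrderAt_eq_top.1 htop)
        exact h0 (this h0D)
      obtain ⟨k, hk⟩ := ENat.ne_top_iff_exists.1 hne
      refine ⟨k, ?_, hk.symm⟩
      rintro rfl
      have := (hh a ha).analyticOrderAt_ne_zero.2 ha0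
      exact this (by rw [← hk]; rfl)
  have key : ∀ ε : ℝ, 0 < ε → ε < 1 →
      s 0 ≤ (((1 - ε) * (Real.log ‖h 0‖ - Real.log c₀) : ℝ) : EReal) := by
    intro ε hε hε1
    let t : ℂ → EReal := fun ζ =>
      if h ζ = 0 then ⊥ else s ζ - (((1 - ε) * Real.log ‖h ζ‖ : ℝ) : EReal)
    have ht0 : ∀ ζ, h ζ ≠ 0 → t ζ = s ζ - (((1 - ε) * Real.log ‖h ζ‖ : ℝ) : EReal) :=
      fun ζ hζ => if_neg hζ
    have htop : ∀ ζ ∈ Metric.closedBall (0 : ℂ) 1, t ζ ≠ ⊤ := by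
      intro ζ hζ
      by_cases hz : h ζ = 0
      · simp [t, hz]
      · rw [ht0 ζ hz]
        exact EReal_sub_coe_ne_top (ne_top_of_le_ne_top EReal.zero_ne_top (hs0 ζ hζ))
    have husc : UpperSemicontinuousOn t (Metric.closedBall 0 1) := by
      intro a ha
      by_cases hz : h a = 0
      · intro c hc
        obtain ⟨-, k, hk0, hk⟩ := hord a ha hz
        have hta : t a = ⊥ := by simp [t, hz]
        obtain ⟨c', -, hc'⟩ := EReal.lt_iff_exists_real_btwn.1 hc
        have hev := eventually_sub_log_lt (hh a ha) hk hk0 hε hε1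
          (hpole a (hord a ha hz).1 k hk0 hk) c'
        rw [eventually_nhdsWithin_iff] at hev
        refine nhdsWithin_le_nhds ?_
        filter_upwards [hev] with ζ hζ
        by_cases hζ0 : h ζ = 0
        · simp only [t, hζ0, if_true]
          exact hta ▸ hc
        · rw [ht0 ζ hζ0]
          exact (hζ (fun h' => hζ0 (h' ▸ hz))).trans hc'
      · intro c hc
        have hcont : ContinuousWithinAt h (Metric.closedBall 0 1) a := hh.continuousOn a ha
        have hne := hcont.eventually_ne hz
        rw [ht0 a hz] at hc
        have h1 : ∀ᶠ ζ in 𝓝[Metric.closedBall 0 1 ∩ h ⁻¹' {0}ᶜ] a,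
            s ζ - (((1 - ε) * Real.log ‖h ζ‖ : ℝ) : EReal) < c := by
          refine usc_sub_coe (D := Metric.closedBall 0 1 ∩ h ⁻¹' {0}ᶜ) (hs.mono inter_subset_left)
            (g := fun ζ => (1 - ε) * Real.log ‖h ζ‖) ?_ a ⟨ha, hz⟩ c hc
          exact continuousOn_const.mul ((hh.continuousOn.mono inter_subset_left).norm.log
            fun ζ hζ => norm_ne_zero_iff.2 hζ.2)
        rw [nhdsWithin_inter_of_mem' (by exact hne)] at h1
        filter_upwards [h1, hne] with ζ h2 h3
        rwa [ht0 ζ h3]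
    have hloc : LocallySubMean t := by
      intro a ha hb
      have hz : h a ≠ 0 := fun hz => hb (by simp [t, hz])
      have hb' : s a ≠ ⊥ := fun hb' => hb (by rw [ht0 a hz, hb']; simp)
      have hlog := eventually_log_norm_mean Metric.isOpen_ball
        (hh.mono Metric.ball_subset_closedBall) ha hz 1
      filter_upwards [hlog, hsub a ha hb'] with r ⟨hr1, hr2, hr3⟩ hr4
      simp only [smul_eq_mul, mul_one] at hr1 hr2 hr3
      have hin : ∀ θ : ℝ, circleMap 0 1 θ ∈ Metric.closedBall (0 : ℂ) 1 := fun θ =>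
        Metric.sphere_subset_closedBall (circleMap_zero_one_mem_sphere θ)
      have hst : ∀ ζ ∈ Metric.closedBall (0 : ℂ) 1, s (a + r * ζ) ≠ ⊤ := fun ζ hζ =>
        ne_top_of_le_ne_top EReal.zero_ne_top
          (hs0 _ (Metric.ball_subset_closedBall (hr1 ζ hζ).1))
      refine (hr4.sub (g := fun ζ => (1 - ε) * Real.log ‖h (a + r * ζ)‖) (hst 0 h0D)
        (fun θ => hst _ (hin θ)) ?_ ?_).congr ?_ fun θ => ?_
      · exact IntervalIntegrable.const_mul hr2 (1 - ε)
      · have : Real.circleAverage (fun ζ => (1 - ε) * Real.log ‖h (a + r * ζ)‖) 0 1 =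
            (1 - ε) * Real.circleAverage (fun ζ => Real.log ‖h (a + r * ζ)‖) 0 1 := by
          simp only [← smul_eq_mul]
          exact Real.circleAverage_fun_smul
        rw [this, hr3]
        simp
      · exact (ht0 _ (hr1 0 h0D).2).symm
      · exact (ht0 _ (hr1 _ (hin θ)).2).symm
    have hmax := le_of_locallySubMean (M := ((-((1 - ε) * Real.log c₀) : ℝ) : EReal))
      husc htop hloc ?_ 0 h0D
    · rw [ht0 0 h0] at hmax
      rw [EReal.sub_le_iff_le_add (Or.inl (EReal.coe_ne_bot _)) (Or.inl (EReal.coe_ne_top _)),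
        ← EReal.coe_add] at hmax
      refine hmax.trans_eq ?_
      congr 1
      ring
    · intro ζ hζ
      have hcz := hhc ζ hζ
      have hz : h ζ ≠ 0 := norm_pos_iff.1 (hc₀.trans_le hcz)
      rw [ht0 ζ hz]
      refine (EReal.sub_le_sub (hs0 ζ (Metric.sphere_subset_closedBall hζ)) le_rfl).trans ?_
      rw [zero_sub, ← EReal.coe_neg, EReal.coe_le_coe_iff]
      have := Real.log_le_log hc₀ hcz
      nlinarith
  induction hs0' : s 0 with
  | bot => exact bot_le
  | top => have := hs0 0 h0D; simp [hs0'] at this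
  | coe x =>
    rw [EReal.coe_le_coe_iff]
    have hlim : Tendsto (fun ε : ℝ => (1 - ε) * (Real.log ‖h 0‖ - Real.log c₀)) (𝓝[>] 0)
        (𝓝 ((1 - 0) * (Real.log ‖h 0‖ - Real.log c₀))) :=
      (Continuous.tendsto (by fun_prop) 0).mono_left nhdsWithin_le_nhds
    rw [sub_zero, one_mul] at hlim
    refine ge_of_tendsto hlim ?_
    filter_upwards [self_mem_nhdsWithin, nhdsWithin_le_nhds (gt_mem_nhds zero_lt_one)] with ε h1 h2
    have := key ε h1 h2
    rw [hs0'] at this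
    exact_mod_cast this

/-! ### Lelong numbers -/

lemma EReal_add_coe_div {x : EReal} {C L : ℝ} (hL : L < 0) :
    (x + (C : EReal)) / (L : EReal) = x / (L : EReal) + ((C / L : ℝ) : EReal) := by
  induction x with
  | bot =>
    rw [EReal.bot_add, EReal.bot_div_of_neg_ne_bot (by exact_mod_cast hL) (EReal.coe_ne_bot _),
      EReal.top_add_coe]
  | top =>
    rw [EReal.top_add_coe, EReal.top_div_of_neg_ne_bot (by exact_mod_cast hL) (EReal.coe_ne_bot _),
      EReal.bot_add]
  | coe x => rw [← EReal.coe_add, ← EReal.coe_div, ← EReal.coe_div, ← EReal.coe_add, add_div]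

lemma eventually_log_neg : ∀ᶠ r : ℝ in 𝓝[>] 0, Real.log r < 0 :=
  Real.tendsto_log_nhdsGT_zero.eventually_lt_atBot 0

lemma tendsto_const_div_log (C : ℝ) :
    Tendsto (fun r : ℝ => C / Real.log r) (𝓝[>] 0) (𝓝 0) :=
  Real.tendsto_log_nhdsGT_zero.const_div_atBot C

lemma eventually_sphere {E : Type*} [NormedAddCommGroup E] {P : E → Prop} {a : E}
    (h : ∀ᶠ z in 𝓝[≠] a, P z) : ∀ᶠ r : ℝ in 𝓝[>] 0, ∀ z ∈ Metric.sphere a r, P z := by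
  rw [eventually_nhdsWithin_iff, Metric.eventually_nhds_iff_ball] at h
  obtain ⟨δ, hδ, hP⟩ := h
  filter_upwards [self_mem_nhdsWithin, nhdsWithin_le_nhds (gt_mem_nhds hδ)] with r h1 h2 z hz
  have hz' : dist z a = r := hz
  refine hP z (by rw [Metric.mem_ball, hz']; exact h2) ?_
  rintro rfl
  rw [dist_self] at hz'
  exact (h1 : 0 < r).ne hz'

/-- Additive constants disappear after division by `log r`, whose sign reverses the inequality. -/
lemma lelongNumber_anti {u w : X → EReal} {p : X} {C : ℝ}
    (h : ∀ᶠ x in 𝓝 p, u x ≤ w x + (C : EReal)) : lelongNumber n w p ≤ lelongNumber n u p := by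
  set χ := chartAt (Cn n) p with hχ
  have hev : ∀ᶠ z in 𝓝[≠] (χ p), u (χ.symm z) ≤ w (χ.symm z) + (C : EReal) := by
    refine nhdsWithin_le_nhds ?_
    have ht : Tendsto χ.symm (𝓝 (χ p)) (𝓝 p) := by
      have := χ.tendsto_symm (mem_chart_source (Cn n) p)
      exact this
    exact ht.eventually h
  unfold lelongNumber
  have hsub : ∀ᶠ r : ℝ in 𝓝[>] 0,
      (⨆ z ∈ Metric.sphere (χ p) r, w (χ.symm z)) / ((Real.log r : ℝ) : EReal) +
        ((C / Real.log r : ℝ) : EReal) ≤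
      (⨆ z ∈ Metric.sphere (χ p) r, u (χ.symm z)) / ((Real.log r : ℝ) : EReal) := by
    filter_upwards [eventually_sphere hev, eventually_log_neg] with r h1 h2
    rw [← EReal_add_coe_div h2]
    refine EReal.div_le_div_right_of_nonpos (by exact_mod_cast h2.le) ?_
    refine iSup₂_le fun z hz => (h1 z hz).trans ?_
    gcongr
    exact le_iSup₂ (f := fun z _ => w (χ.symm z)) z hz
  have hC : liminf (fun r : ℝ => ((C / Real.log r : ℝ) : EReal)) (𝓝[>] 0) = 0 := by
    refine Tendsto.liminf_eq ?_
    exact (continuous_coe_real_ereal.tendsto 0).comp (tendsto_const_div_log C)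
  refine le_trans ?_ (liminf_le_liminf hsub)
  refine le_trans ?_ EReal.le_liminf_add
  rw [hC, add_zero]

lemma le_lelongNumber {u : X → EReal} {p : X} {k C : ℝ}
    (h : ∀ᶠ z in 𝓝[≠] (chartAt (Cn n) p p), u ((chartAt (Cn n) p).symm z) ≤
      ((k * Real.log ‖z - chartAt (Cn n) p p‖ + C : ℝ) : EReal)) :
    (k : EReal) ≤ lelongNumber n u p := by
  unfold lelongNumber
  have hk : liminf (fun r : ℝ => ((k + C / Real.log r : ℝ) : EReal)) (𝓝[>] 0) = k := by
    refine Tendsto.liminf_eq ((continuous_coe_real_ereal.tendsto k).comp ?_)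
    simpa using (tendsto_const_div_log C).const_add k
  rw [← hk]
  refine liminf_le_liminf ?_
  filter_upwards [eventually_sphere h, eventually_log_neg] with r h1 h2
  have h3 : (k + C / Real.log r : ℝ) = (k * Real.log r + C) / Real.log r := by
    field_simp [h2.ne]
  rw [h3, EReal.coe_div]
  refine EReal.div_le_div_right_of_nonpos (by exact_mod_cast h2.le) ?_
  refine iSup₂_le fun z hz => (h1 z hz).trans_eq ?_
  rw [mem_sphere_iff_norm] at hz
  rw [hz]

/-- The bound of the liminf on the sphere through `z` is a pointwise bound at `z`; existence of the
limit plays no role. -/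
lemma eventually_le_of_lt_lelongNumber {u : X → EReal} {p : X} {c : ℝ}
    (h : (c : EReal) < lelongNumber n u p) :
    ∀ᶠ z in 𝓝[≠] (chartAt (Cn n) p p), u ((chartAt (Cn n) p).symm z) ≤
      ((c * Real.log ‖z - chartAt (Cn n) p p‖ : ℝ) : EReal) := by
  have hev := (eventually_lt_of_lt_liminf h).and eventually_log_neg
  have ht : Tendsto (fun z => ‖z - chartAt (Cn n) p p‖) (𝓝[≠] (chartAt (Cn n) p p)) (𝓝[>] 0) :=
    tendsto_norm_sub_self_nhdsNE _
  filter_upwards [ht.eventually hev] with z ⟨h1, h2⟩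
  by_contra! hcon
  refine absurd h1 (not_lt.2 ?_)
  have h3 : (c : EReal) = ((c * Real.log ‖z - chartAt (Cn n) p p‖ : ℝ) : EReal) /
      ((Real.log ‖z - chartAt (Cn n) p p‖ : ℝ) : EReal) := by
    rw [← EReal.coe_div, mul_div_cancel_right₀ _ h2.ne]
  conv_rhs => rw [h3]
  refine EReal.div_le_div_right_of_nonpos (by exact_mod_cast h2.le) (hcon.le.trans ?_)
  exact le_iSup₂ (f := fun y (_ : y ∈ Metric.sphere (chartAt (Cn n) p p)
    ‖z - chartAt (Cn n) p p‖) => u ((chartAt (Cn n) p).symm y)) z (by simp)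

/-! ### Charts -/

lemma analyticAt_comp_symm {e : OpenPartialHomeomorph X (Cn n)}
    (he : e ∈ IsManifold.maximalAtlas 𝓘(ℂ, Cn n) ω X) {f : X → ℂ} {z : Cn n} (hz : z ∈ e.target)
    (hf : ContMDiffAt 𝓘(ℂ, Cn n) 𝓘(ℂ) ω f (e.symm z)) :
    AnalyticAt ℂ (fun z => f (e.symm z)) z := by
  have h1 : ContMDiffAt 𝓘(ℂ, Cn n) 𝓘(ℂ, Cn n) ω e.symm z :=
    (contMDiffOn_symm_of_mem_maximalAtlas he).contMDiffAt (e.open_target.mem_nhds hz)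
  exact (contMDiffAt_iff_contDiffAt.1 (hf.comp z h1)).analyticAt

lemma isBigO_transition {e e' : OpenPartialHomeomorph X (Cn n)}
    (he : e ∈ IsManifold.maximalAtlas 𝓘(ℂ, Cn n) ω X)
    (he' : e' ∈ IsManifold.maximalAtlas 𝓘(ℂ, Cn n) ω X) {p : X} (hp : p ∈ e.source)
    (hp' : p ∈ e'.source) :
    (fun z => e' (e.symm z) - e' p) =O[𝓝 (e p)] fun z => z - e p := by
  have h1 : ContMDiffAt 𝓘(ℂ, Cn n) 𝓘(ℂ, Cn n) ω e.symm (e p) :=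
    (contMDiffOn_symm_of_mem_maximalAtlas he).contMDiffAt (e.open_target.mem_nhds (e.map_source hp))
  have h2 : ContMDiffAt 𝓘(ℂ, Cn n) 𝓘(ℂ, Cn n) ω e' (e.symm (e p)) := by
    rw [e.left_inv hp]
    exact (contMDiffOn_of_mem_maximalAtlas he').contMDiffAt (e'.open_source.mem_nhds hp')
  have h3 := contMDiffAt_iff_contDiffAt.1 (h2.comp (e p) h1)
  have h4 := (h3.differentiableAt (by simp)).isBigO_sub
  simpa [e.left_inv hp] using h4

lemma tendsto_transition {Y : Type*} [TopologicalSpace Y]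
    {e e' : OpenPartialHomeomorph Y (Cn n)} {p : Y} (hp : p ∈ e.source)
    (hp' : p ∈ e'.source) :
    Tendsto (fun z => e' (e.symm z)) (𝓝[≠] (e p)) (𝓝[≠] (e' p)) := by
  have h1 : Tendsto e.symm (𝓝 (e p)) (𝓝 p) := e.tendsto_symm hp
  refine tendsto_nhdsWithin_iff.2 ⟨((e'.continuousAt hp').tendsto.comp h1).mono_left
    nhdsWithin_le_nhds, ?_⟩
  filter_upwards [nhdsWithin_le_nhds (h1.eventually (e'.open_source.mem_nhds hp')),
    nhdsWithin_le_nhds (e.open_target.mem_nhds (e.map_source hp)), self_mem_nhdsWithin] with z h2 h3 h4 h5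
  have h6 : e.symm z = p := e'.injOn h2 hp' h5
  exact h4 (by rw [mem_singleton_iff, ← h6, e.right_inv h3])

/-- A bound for the Lelong number of `u` bounds `u` in arbitrary coordinates. -/
lemma exists_eventually_le_of_lt_lelongNumber [IsManifold 𝓘(ℂ, Cn n) ω X] {u : X → EReal} {p : X}
    {c : ℝ} (hc : 0 ≤ c) (h : (c : EReal) < lelongNumber n u p)
    {e : OpenPartialHomeomorph X (Cn n)} (he : e ∈ IsManifold.maximalAtlas 𝓘(ℂ, Cn n) ω X)
    (hp : p ∈ e.source) :
    ∃ C : ℝ, ∀ᶠ z in 𝓝[≠] (e p), u (e.symm z) ≤ ((c * Real.log ‖z - e p‖ + C : ℝ) : EReal) := by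
  set χ := chartAt (Cn n) p with hχ
  have hpχ : p ∈ χ.source := mem_chart_source (Cn n) p
  obtain ⟨L, hL, hLb⟩ := (isBigO_transition he (IsManifold.chart_mem_maximalAtlas p) hp
    hpχ).exists_pos
  have h1 : Tendsto e.symm (𝓝 (e p)) (𝓝 p) := e.tendsto_symm hp
  -- `L` is a Lipschitz constant at `p` for the change of coordinates; since `c ≥ 0` it only costs
  -- an additive constant.
  refine ⟨c * Real.log L, ?_⟩
  filter_upwards [(tendsto_transition hp hpχ).eventually (eventually_le_of_lt_lelongNumber h),
    (tendsto_transition hp hpχ).eventually self_mem_nhdsWithin,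
    nhdsWithin_le_nhds hLb.bound, nhdsWithin_le_nhds (h1.eventually (χ.open_source.mem_nhds hpχ)),
    self_mem_nhdsWithin] with z h2 h3 h4 h5 h6
  rw [← hχ, χ.left_inv h5] at h2
  refine h2.trans ?_
  rw [EReal.coe_le_coe_iff, ← mul_add]
  refine mul_le_mul_of_nonneg_left ?_ hc
  have h7 : 0 < ‖χ (e.symm z) - χ p‖ := norm_pos_iff.2 (sub_ne_zero.2 h3)
  have h8 : 0 < ‖z - e p‖ := norm_pos_iff.2 (sub_ne_zero.2 h6)
  rw [add_comm, ← Real.log_mul hL.ne' h8.ne']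
  exact Real.log_le_log h7 h4

lemma IsPSHOn.pshFlat {u : X → EReal} {Ω : Set X} (h : IsPSHOn n u Ω)
    {e : OpenPartialHomeomorph X (Cn n)} (he : e ∈ IsManifold.maximalAtlas 𝓘(ℂ, Cn n) ω X) :
    PshFlat (fun z => u (e.symm z)) (e.target ∩ e.symm ⁻¹' Ω) := by
  refine ⟨fun z hz c hc => ?_, fun z hz => h.2.1 _ hz.2, fun a b hab => h.2.2 e he a b hab⟩
  have ht : Tendsto e.symm (𝓝[e.target ∩ e.symm ⁻¹' Ω] z) (𝓝[Ω] (e.symm z)) := by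
    refine tendsto_nhdsWithin_iff.2 ⟨?_, eventually_mem_nhdsWithin.mono fun y hy => hy.2⟩
    exact (e.continuousAt_symm hz.1).tendsto.mono_left nhdsWithin_le_nhds
  exact ht.eventually (h.1 _ hz.2 c hc)

lemma isPSHOn_of_pshFlat {u : X → EReal} {Ω : Set X} (hu : UpperSemicontinuousOn u Ω)
    (htop : ∀ x ∈ Ω, u x ≠ ⊤) (h : ∀ e ∈ IsManifold.maximalAtlas 𝓘(ℂ, Cn n) ω X,
      PshFlat (fun z => u (e.symm z)) (e.target ∩ e.symm ⁻¹' Ω)) : IsPSHOn n u Ω :=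
  ⟨hu, htop, fun e he a b hab => (h e he).2.2 a b hab⟩

lemma isOpen_chart_preimage {Y : Type*} [TopologicalSpace Y]
    (e : OpenPartialHomeomorph Y (Cn n)) {Ω : Set Y} (hΩ : IsOpen Ω) :
    IsOpen (e.target ∩ e.symm ⁻¹' Ω) := e.symm.isOpen_inter_preimage hΩ

/-! ### Generators of the ideal sheaf -/

/-- The germ of a holomorphic function. -/
def holGerm {f : X → ℂ} {p : X} (hf : ContMDiffAt 𝓘(ℂ, Cn n) 𝓘(ℂ) ω f p) : HolGerm n p :=
  ⟨(f : Germ (𝓝 p) ℂ), f, hf, rfl⟩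

lemma generatesAt_iff {ι : Type*} {p : X} {I : Ideal (HolGerm n p)} {f : ι → X → ℂ}
    (hf : ∀ i, ContMDiffAt 𝓘(ℂ, Cn n) 𝓘(ℂ) ω (f i) p) :
    GeneratesAt p I f ↔ I = Ideal.span (range fun i => holGerm (hf i)) := by
  have : {g : HolGerm n p | ∃ i, (g : Germ (𝓝 p) ℂ) = (f i : Germ (𝓝 p) ℂ)} =
      range fun i => holGerm (hf i) := by
    ext g
    simp only [mem_ofPred_eq, mem_range, Subtype.ext_iff]
    exact exists_congr fun i => eq_comm
  rw [GeneratesAt, this]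
  exact and_iff_right hf

lemma generatesAt_unit_iff {p : X} {I : Ideal (HolGerm n p)} {f : X → ℂ}
    (hf : ContMDiffAt 𝓘(ℂ, Cn n) 𝓘(ℂ) ω f p) :
    GeneratesAt p I (fun _ : Unit => f) ↔ I = Ideal.span {holGerm hf} := by
  rw [generatesAt_iff fun _ => hf, range_const]

lemma holGerm_eq_iff {p : X} {f g : X → ℂ} (hf : ContMDiffAt 𝓘(ℂ, Cn n) 𝓘(ℂ) ω f p)
    (hg : ContMDiffAt 𝓘(ℂ, Cn n) 𝓘(ℂ) ω g p) : holGerm hf = holGerm hg ↔ f =ᶠ[𝓝 p] g := by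
  rw [Subtype.ext_iff]
  exact Germ.coe_eq

lemma exists_eq_holGerm {p : X} (g : HolGerm n p) :
    ∃ (f : X → ℂ) (hf : ContMDiffAt 𝓘(ℂ, Cn n) 𝓘(ℂ) ω f p), g = holGerm hf := by
  obtain ⟨f, hf, hfg⟩ := g.2
  exact ⟨f, hf, Subtype.ext hfg.symm⟩

lemma holGerm_mem_span_range_iff {ι : Type*} [Fintype ι] {p : X} {f : ι → X → ℂ} {g : X → ℂ}
    (hf : ∀ i, ContMDiffAt 𝓘(ℂ, Cn n) 𝓘(ℂ) ω (f i) p)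
    (hg : ContMDiffAt 𝓘(ℂ, Cn n) 𝓘(ℂ) ω g p) :
    holGerm hg ∈ Ideal.span (range fun i => holGerm (hf i)) ↔ ∃ a : ι → X → ℂ,
      (∀ i, ContMDiffAt 𝓘(ℂ, Cn n) 𝓘(ℂ) ω (a i) p) ∧ ∀ᶠ x in 𝓝 p, g x = ∑ i, a i x * f i x := by
  have hsum : ∀ (a : ι → X → ℂ) (ha : ∀ i, ContMDiffAt 𝓘(ℂ, Cn n) 𝓘(ℂ) ω (a i) p),
      (∑ i, holGerm (ha i) * holGerm (hf i) = holGerm hg) ↔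
        ∀ᶠ x in 𝓝 p, g x = ∑ i, a i x * f i x := by
    intro a ha
    have h1 : ((∑ i, holGerm (ha i) * holGerm (hf i) : HolGerm n p) : Germ (𝓝 p) ℂ) =
        ((∑ i, a i * f i : X → ℂ) : Germ (𝓝 p) ℂ) := by
      have h2 : ((∑ i, a i * f i : X → ℂ) : Germ (𝓝 p) ℂ) =
          Germ.coeRingHom (𝓝 p) (∑ i, a i * f i) := rfl
      rw [h2, map_sum, AddSubmonoidClass.coe_finsetSum]
      rfl
    rw [Subtype.ext_iff, h1]
    refine Germ.coe_eq.trans ⟨fun h => ?_, fun h => ?_⟩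
    · filter_upwards [h] with x hx
      simpa using hx.symm
    · filter_upwards [h] with x hx
      simpa using hx.symm
  rw [Ideal.mem_span_range_iff_exists_fun]
  constructor
  · rintro ⟨c, hc⟩
    choose a ha hac using fun i => exists_eq_holGerm (c i)
    refine ⟨a, ha, (hsum a ha).1 ?_⟩
    rw [← hc]
    exact Finset.sum_congr rfl fun i _ => by rw [hac i]
  · rintro ⟨a, ha, h⟩
    exact ⟨fun i => holGerm (ha i), (hsum a ha).2 h⟩

lemma holGerm_mem_span_singleton_iff {p : X} {f g : X → ℂ}
    (hf : ContMDiffAt 𝓘(ℂ, Cn n) 𝓘(ℂ) ω f p) (hg : ContMDiffAt 𝓘(ℂ, Cn n) 𝓘(ℂ) ω g p) :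
    holGerm hg ∈ Ideal.span {holGerm hf} ↔ ∃ a : X → ℂ,
      ContMDiffAt 𝓘(ℂ, Cn n) 𝓘(ℂ) ω a p ∧ ∀ᶠ x in 𝓝 p, g x = a x * f x := by
  have := holGerm_mem_span_range_iff (ι := Unit) (fun _ => hf) hg
  rw [range_const] at this
  rw [this]
  constructor
  · rintro ⟨a, ha, h⟩
    exact ⟨a (), ha (), by simpa using h⟩
  · rintro ⟨a, ha, h⟩
    exact ⟨fun _ => a, fun _ => ha, by simpa using h⟩

lemma GeneratesAt.exists_eq_mul {ι : Type*} {p : X} {I : Ideal (HolGerm n p)} {f : X → ℂ}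
    {g : ι → X → ℂ} (hf : GeneratesAt p I fun _ : Unit => f) (hg : GeneratesAt p I g) (i : ι) :
    ∃ a : X → ℂ, ContMDiffAt 𝓘(ℂ, Cn n) 𝓘(ℂ) ω a p ∧ ∀ᶠ x in 𝓝 p, g i x = a x * f x := by
  have h1 : holGerm (hg.1 i) ∈ I := by
    have := (generatesAt_iff hg.1).1 hg
    exact this.ge (Ideal.subset_span (mem_range_self i))
  rw [← holGerm_mem_span_singleton_iff (hf.1 ()) (hg.1 i)]
  exact ((generatesAt_unit_iff (hf.1 ())).1 hf).le h1

/-! ### Local generators of a divisor and the number `ν_A` -/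

namespace ComplexSubspace

variable {A : ComplexSubspace n X}

lemma GeneratedOn.continuousAt {f : X → ℂ} {U : Set X} (h : A.GeneratedOn f U) {x : X}
    (hx : x ∈ U) : ContinuousAt f x := ((h x hx).1 ()).continuousAt

lemma GeneratedOn.mem_support_iff {f : X → ℂ} {U : Set X} (h : A.GeneratedOn f U) {x : X}
    (hx : x ∈ U) : x ∈ A.support ↔ f x = 0 := by
  have hf := (h x hx).1 ()
  have h1 : ContMDiffAt 𝓘(ℂ, Cn n) 𝓘(ℂ) ω (fun _ : X => (1 : ℂ)) x := contMDiffAt_const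
  rw [← not_iff_not]
  change ¬ (A.stalk x ≠ ⊤) ↔ _
  rw [not_not, Ideal.eq_top_iff_one, (generatesAt_unit_iff hf).1 (h x hx)]
  have : (1 : HolGerm n x) = holGerm h1 := rfl
  rw [this, holGerm_mem_span_singleton_iff]
  constructor
  · rintro ⟨a, -, ha⟩ h0
    have := ha.self_of_nhds
    simp [h0] at this
  · intro h0
    refine ⟨fun x => (f x)⁻¹, hf.inv₀ h0, ?_⟩
    filter_upwards [hf.continuousAt.eventually_ne h0] with y hy
    exact (inv_mul_cancel₀ hy).symm

lemma GeneratedOn.frequently_ne_zero {f : X → ℂ} {U : Set X} (h : A.GeneratedOn f U) {x : X}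
    (hx : x ∈ U) (hne : A.stalk x ≠ ⊥) : ∃ᶠ y in 𝓝 x, f y ≠ 0 := by
  intro hcon
  apply hne
  have hf := (h x hx).1 ()
  rw [(generatesAt_unit_iff hf).1 (h x hx), Ideal.span_singleton_eq_bot]
  have h1 : ContMDiffAt 𝓘(ℂ, Cn n) 𝓘(ℂ) ω (fun _ : X => (0 : ℂ)) x := contMDiffAt_const
  have : (0 : HolGerm n x) = holGerm h1 := rfl
  rw [this, holGerm_eq_iff]
  filter_upwards [hcon] with y hy
  exact not_not.1 hy

/-- The germs `f i` from the finite type condition and the generator `f` at `p` express each other.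
These finitely many identities hold in a neighbourhood, so `f` generates the nearby stalks too. -/
lemma exists_generatedOn [IsManifold 𝓘(ℂ, Cn n) ω X] (A : ComplexSubspace n X) {p : X}
    (hp : (A.stalk p).IsPrincipal) :
    ∃ U : Set X, IsOpen U ∧ p ∈ U ∧ ∃ f : X → ℂ, A.GeneratedOn f U := by
  obtain ⟨g, hg⟩ := hp.principal
  obtain ⟨f, hf, rfl⟩ := exists_eq_holGerm g
  obtain ⟨V, hV, m, fi, hfi⟩ := A.finiteType p
  have hgen : A.stalk p = Ideal.span {holGerm hf} := hg
  have hpV := hfi p (mem_of_mem_nhds hV)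
  choose b hb hbf using fun i =>
    ((generatesAt_unit_iff hf).2 hgen).exists_eq_mul hpV i
  have hmem : holGerm hf ∈ Ideal.span (range fun i => holGerm (hpV.1 i)) := by
    rw [← (generatesAt_iff hpV.1).1 hpV, hgen]
    exact Ideal.mem_span_singleton_self _
  obtain ⟨a, ha, haf⟩ := (holGerm_mem_span_range_iff hpV.1 hf).1 hmem
  have hω : (ω : WithTop ℕ∞) ≠ ∞ := by simp
  have hev : ∀ᶠ q in 𝓝 p, q ∈ V ∧ ContMDiffAt 𝓘(ℂ, Cn n) 𝓘(ℂ) ω f q ∧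
      (∀ i, ContMDiffAt 𝓘(ℂ, Cn n) 𝓘(ℂ) ω (a i) q) ∧
      (∀ i, ContMDiffAt 𝓘(ℂ, Cn n) 𝓘(ℂ) ω (b i) q) ∧
      (∀ i, ∀ᶠ x in 𝓝 q, fi i x = b i x * f x) ∧ ∀ᶠ x in 𝓝 q, f x = ∑ i, a i x * fi i x := by
    filter_upwards [hV, (contMDiffAt_iff_contMDiffAt_nhds hω).1 hf,
      eventually_all.2 fun i => (contMDiffAt_iff_contMDiffAt_nhds hω).1 (ha i),
      eventually_all.2 fun i => (contMDiffAt_iff_contMDiffAt_nhds hω).1 (hb i),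
      eventually_all.2 fun i => eventually_eventually_nhds.2 (hbf i),
      eventually_eventually_nhds.2 haf] with q h1 h2 h3 h4 h5 h6
    exact ⟨h1, h2, h3, h4, h5, h6⟩
  obtain ⟨U, hU, hUo, hpU⟩ := eventually_nhds_iff.1 hev
  refine ⟨U, hUo, hpU, f, fun q hq => ?_⟩
  obtain ⟨h1, h2, h3, h4, h5, h6⟩ := hU q hq
  have hq := hfi q h1
  rw [generatesAt_unit_iff h2, (generatesAt_iff hq.1).1 hq]
  refine le_antisymm (Ideal.span_le.2 ?_) ((Ideal.span_singleton_le_iff_mem _).2 ?_)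
  · rintro _ ⟨i, rfl⟩
    exact (holGerm_mem_span_singleton_iff h2 (hq.1 i)).2 ⟨b i, h4 i, h5 i⟩
  · exact (holGerm_mem_span_range_iff hq.1 h2).2 ⟨a, h3, h6⟩

lemma nu_le_lelongNumber {f : X → ℂ} {p : X} (h : GeneratesAt p (A.stalk p) fun _ : Unit => f) :
    A.nu p ≤ lelongNumber n (logAbs f) p := by
  have h1 : GeneratesAt p (A.stalk p) (fun _ : Fin 1 => f) := by
    rw [generatesAt_iff fun _ => h.1 (), range_const]
    exact (generatesAt_unit_iff (h.1 ())).1 h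
  refine (iInf_le_of_le 1 (iInf₂_le_of_le _ h1 ?_))
  simp

/-- Any generators are holomorphic multiples of `f`, so they vanish to the same order `k`, and a
change of coordinates preserves this. -/
lemma natCast_le_nu [IsManifold 𝓘(ℂ, Cn n) ω X] {f : X → ℂ} {p : X}
    (h : GeneratesAt p (A.stalk p) fun _ : Unit => f)
    {e : OpenPartialHomeomorph X (Cn n)} (he : e ∈ IsManifold.maximalAtlas 𝓘(ℂ, Cn n) ω X)
    (hp : p ∈ e.source) {k : ℕ}
    (hO : (fun z => f (e.symm z)) =O[𝓝 (e p)] fun z => ‖z - e p‖ ^ k) :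
    ((k : ℝ) : EReal) ≤ A.nu p := by
  set χ := chartAt (Cn n) p with hχ
  have hpχ : p ∈ χ.source := mem_chart_source (Cn n) p
  have hχsymm : Tendsto χ.symm (𝓝 (χ p)) (𝓝 p) := χ.tendsto_symm hpχ
  have htrans := isBigO_transition (IsManifold.chart_mem_maximalAtlas p) he hpχ hp
  have hcont : Tendsto (fun z => e (χ.symm z)) (𝓝 (χ p)) (𝓝 (e p)) :=
    (e.continuousAt hp).tendsto.comp hχsymm
  have hOχ : (fun z => f (χ.symm z)) =O[𝓝 (χ p)] fun z => ‖z - χ p‖ ^ k := by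
    have h1 := (hO.comp_tendsto hcont).trans (htrans.norm_norm.pow k)
    refine Asymptotics.IsBigO.congr' h1 ?_ .rfl
    filter_upwards [hχsymm.eventually (e.open_source.mem_nhds hp)] with z hz
    simp [e.left_inv hz]
  refine le_iInf fun m => le_iInf₂ fun g hg => ?_
  choose a ha haf using fun i => h.exists_eq_mul hg i
  have hgO : ∀ i, (fun z => g i (χ.symm z)) =O[𝓝 (χ p)] fun z => ‖z - χ p‖ ^ k := by
    intro i
    have h1 : (fun z => a i (χ.symm z)) =O[𝓝 (χ p)] fun _ => (1 : ℝ) :=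
      (((ha i).continuousAt.tendsto.comp hχsymm).isBigO_one ℝ)
    have h2 := h1.mul hOχ
    simp only [one_mul] at h2
    exact Asymptotics.IsBigO.congr' h2
      ((hχsymm.eventually (haf i)).mono fun z hz => hz.symm) .rfl
  choose C hC0 hC using fun i => (hgO i).exists_pos
  obtain ⟨C', hC'⟩ := Finite.exists_le C
  -- The maximum with `1` keeps the logarithm meaningful when the family of generators is empty.
  refine le_lelongNumber (C := Real.log (max C' 1)) ?_
  filter_upwards [eventually_all.2 fun i => nhdsWithin_le_nhds (hC i).bound,
    self_mem_nhdsWithin] with z hz hne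
  refine iSup_le fun i => ?_
  by_cases h0 : g i (χ.symm z) = 0
  · rw [logAbs_of_eq_zero h0]; exact bot_le
  have hpos : 0 < ‖z - χ p‖ := norm_pos_iff.2 (sub_ne_zero.2 hne)
  have hm : 0 < max C' 1 := lt_max_of_lt_right one_pos
  rw [logAbs_of_ne_zero h0, EReal.coe_le_coe_iff, ← Real.log_pow, add_comm, ← Real.log_mul hm.ne'
    (pow_pos hpos k).ne']
  refine Real.log_le_log (norm_pos_iff.2 h0) ((hz i).trans ?_)
  rw [norm_pow, norm_norm]
  gcongr
  exact (hC' i).trans (le_max_left _ _)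

end ComplexSubspace

/-! ### The uniform upper bound for the competitors of the Green function -/

/-- A line through `z₀` on which `F` has no zeros on the unit circle. -/
lemma exists_good_direction {F : Cn n → ℂ} {S : Set (Cn n)} (hS : IsOpen S)
    (hF : AnalyticOnNhd ℂ F S) {z₀ : Cn n} (hz₀ : z₀ ∈ S) (hne : ∃ᶠ z in 𝓝 z₀, F z ≠ 0) :
    ∃ b : Cn n, (∀ ζ ∈ Metric.closedBall (0 : ℂ) 1, z₀ + ζ • b ∈ S) ∧
      ∀ ζ ∈ Metric.sphere (0 : ℂ) 1, F (z₀ + ζ • b) ≠ 0 := by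
  obtain ⟨R, hR, hRS⟩ := Metric.isOpen_iff.1 hS z₀ hz₀
  obtain ⟨q, hq0, hq⟩ := (hne.and_eventually (Metric.ball_mem_nhds z₀ hR)).exists
  set D : Set ℂ := (fun ζ : ℂ => z₀ + ζ • (q - z₀)) ⁻¹' Metric.ball z₀ R with hD
  have hDc : Convex ℝ D := by
    intro x hx y hy s t hs ht hst
    have h1 := convex_ball z₀ R hx hy hs ht hst
    have h2 : s • (z₀ + x • (q - z₀)) + t • (z₀ + y • (q - z₀)) =
        z₀ + (s • x + t • y) • (q - z₀) := by
      rw [smul_add, smul_add, add_smul, smul_assoc, smul_assoc, add_add_add_comm, ← add_smul, hst,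
        one_smul]
    simp only [hD, mem_preimage]
    rwa [← h2]
  have hφ : AnalyticOnNhd ℂ (fun ζ : ℂ => F (z₀ + ζ • (q - z₀))) D := by
    intro ζ hζ
    have h1 : AnalyticAt ℂ (fun ζ : ℂ => z₀ + ζ • (q - z₀)) ζ := by fun_prop
    exact AnalyticAt.fun_comp (hF _ (hRS hζ)) h1
  have h0D : (0 : ℂ) ∈ D := by simpa [hD] using hR
  have h1D : (1 : ℂ) ∈ D := by simpa [hD] using hq
  have hev : ∀ᶠ ζ in 𝓝[≠] (0 : ℂ), F (z₀ + ζ • (q - z₀)) ≠ 0 := by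
    -- The line runs through a point `q` with `F q ≠ 0`, so `F` is not identically zero along it and
    -- the zero at `z₀`, if any, is isolated.
    refine (hφ 0 h0D).eventually_eq_zero_or_eventually_ne_zero.resolve_left fun h => ?_
    have := hφ.eqOn_zero_of_preconnected_of_eventuallyEq_zero hDc.isPreconnected h0D h h1D
    simp at this
    exact hq0 this
  have hDo : IsOpen D := Metric.isOpen_ball.preimage (by fun_prop)
  rw [eventually_nhdsWithin_iff] at hev
  obtain ⟨r, hr, hrb⟩ := Metric.eventually_nhds_iff_ball.1 (hev.and (hDo.eventually_mem h0D))
  have hmul : ∀ ζ : ℂ, ‖ζ‖ ≤ 1 → ζ * ((r / 2 : ℝ) : ℂ) ∈ Metric.ball (0 : ℂ) r := by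
    intro ζ hζ
    rw [mem_ball_zero_iff, norm_mul, Complex.norm_real, Real.norm_of_nonneg (by positivity)]
    nlinarith [norm_nonneg ζ]
  refine ⟨((r / 2 : ℝ) : ℂ) • (q - z₀), fun ζ hζ => ?_, fun ζ hζ => ?_⟩
  · rw [smul_smul]
    exact hRS (hrb _ (hmul ζ (by simpa using hζ))).2
  · rw [smul_smul]
    have hζ1 : ‖ζ‖ = 1 := by simpa using hζ
    refine (hrb _ (hmul ζ hζ1.le)).1 ?_
    refine mul_ne_zero (norm_ne_zero_iff.1 (by simp [hζ1])) ?_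
    exact_mod_cast (by positivity : (r / 2 : ℝ) ≠ 0)

lemma analyticOrderAt_comp_const_add {h : ℂ → ℂ} {a : ℂ} {k : ℕ} (hh : AnalyticAt ℂ h a)
    (hk : analyticOrderAt h a = k) : analyticOrderAt (fun ζ => h (a + ζ)) 0 = k := by
  have hh' : AnalyticAt ℂ (fun ζ => h (a + ζ)) 0 :=
    AnalyticAt.fun_comp (by simpa using hh) (by fun_prop)
  obtain ⟨g, hg, hg0, hgeq⟩ := hh.analyticOrderAt_eq_natCast.1 hk
  refine hh'.analyticOrderAt_eq_natCast.2 ⟨fun ζ => g (a + ζ),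
    AnalyticAt.fun_comp (by simpa using hg) (by fun_prop), by simpa using hg0, ?_⟩
  have ht : Tendsto (fun ζ : ℂ => a + ζ) (𝓝 0) (𝓝 a) := by
    simpa using (Continuous.tendsto (f := fun ζ : ℂ => a + ζ) (by fun_prop) 0)
  filter_upwards [ht.eventually hgeq] with ζ hζ
  simpa using hζ

namespace ComplexSubspace

variable {A : ComplexSubspace n X}

/-- The bound on a single line that avoids the exceptional points. -/
lemma le_log_on_good_line [IsManifold 𝓘(ℂ, Cn n) ω X] {f : X → ℂ} {U : Set X}
    (hf : A.GeneratedOn f U) {e : OpenPartialHomeomorph X (Cn n)}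
    (he : e ∈ IsManifold.maximalAtlas 𝓘(ℂ, Cn n) ω X) {z b : Cn n} {c₀ : ℝ} (hc₀ : 0 < c₀)
    (hdisc : ∀ ζ ∈ Metric.closedBall (0 : ℂ) 1, z + ζ • b ∈ e.target ∩ e.symm ⁻¹' U)
    (hcirc : ∀ ζ ∈ Metric.sphere (0 : ℂ) 1, c₀ ≤ ‖f (e.symm (z + ζ • b))‖) (hb : b ≠ 0)
    (hgood : ∀ (k : ℕ) (ζ : ℂ), z + ζ • b ∉
      badSet b (fun z => f (e.symm z)) (e.target ∩ e.symm ⁻¹' U) k)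
    (h0 : f (e.symm z) ≠ 0) {u : X → EReal} (hu : u ∈ A.family) :
    u (e.symm z) ≤ ((Real.log ‖f (e.symm z)‖ - Real.log c₀ : ℝ) : EReal) := by
  obtain ⟨hpsh, hneg, hnu⟩ := hu
  set F : Cn n → ℂ := fun z => f (e.symm z) with hFdef
  set S : Set (Cn n) := e.target ∩ e.symm ⁻¹' U with hSdef
  have hF : AnalyticOnNhd ℂ F S := fun z hz => analyticAt_comp_symm he hz.1 ((hf _ hz.2).1 ())
  have hflat := hpsh.pshFlat he
  have hST : ∀ ζ ∈ Metric.closedBall (0 : ℂ) 1, z + ζ • b ∈ e.target ∩ e.symm ⁻¹' univ :=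
    fun ζ hζ => ⟨(hdisc ζ hζ).1, trivial⟩
  have hh : AnalyticOnNhd ℂ (fun ζ : ℂ => F (z + ζ • b)) (Metric.closedBall 0 1) := by
    intro ζ hζ
    have h1 : AnalyticAt ℂ (fun ζ : ℂ => z + ζ • b) ζ := by fun_prop
    exact AnalyticAt.fun_comp (hF _ (hdisc ζ hζ)) h1
  have := le_log_of_poles (s := fun ζ => u (e.symm (z + ζ • b))) (h := fun ζ => F (z + ζ • b))
    hc₀ (usc_comp_line hflat.1 hST) (fun ζ _ => hneg _) ?_ hh hcirc ?_ (by simpa using h0)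
  · simpa using this
  · intro a ha _
    filter_upwards [eventually_small_disc_subset Metric.isOpen_ball ha (1 : ℂ)] with r hr
    have h1 := hflat.2.2 (z + a • b) ((r : ℂ) • b) ?_
    · refine h1.congr ?_ fun θ => ?_
      · simp
      · rw [smul_smul, add_assoc, ← add_smul, mul_comm]
    · intro ζ hζ
      rw [smul_smul, add_assoc, ← add_smul, mul_comm]
      exact hST _ (Metric.ball_subset_closedBall (by simpa using hr ζ hζ))
  · intro a ha k hk0 hk δ hδ hδ1
    have haD := Metric.ball_subset_closedBall ha
    set q := z + a • b with hq
    have hqS : q ∈ S := hdisc a haD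
    have hord : analyticOrderAt (fun ζ : ℂ => F (q + ζ • b)) 0 = k := by
      have := analyticOrderAt_comp_const_add (hh a haD) hk
      simpa only [add_smul, ← add_assoc] using this
    -- Off the bad set, order `k` along the line forces order `k` in the whole space; this is where
    -- `ν_u ≥ ν_A` becomes usable on the line.
    have hO : F =O[𝓝 q] fun y => ‖y - q‖ ^ k := by
      by_contra hcon
      exact hgood k a ⟨hqS, hord, hcon⟩
    have hk1 : (1 : ℝ) ≤ k := by exact_mod_cast Nat.one_le_iff_ne_zero.2 hk0
    have hqs : e.symm q ∈ e.source := e.map_target hqS.1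
    have heq : e (e.symm q) = q := e.right_inv hqS.1
    have hlel : ((k - δ : ℝ) : EReal) < lelongNumber n u (e.symm q) := by
      have h1 : ((k : ℝ) : EReal) ≤ A.nu (e.symm q) :=
        natCast_le_nu (hf _ hqS.2) he hqs (by rwa [heq])
      refine lt_of_lt_of_le ?_ (h1.trans (hnu _))
      exact_mod_cast sub_lt_self _ hδ
    obtain ⟨C, hC⟩ := exists_eventually_le_of_lt_lelongNumber (by linarith) hlel he hqs
    rw [heq] at hC
    have hb0 : 0 < ‖b‖ := norm_pos_iff.2 hb
    refine ⟨(k - δ) * Real.log ‖b‖ + C, ?_⟩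
    have ht : Tendsto (fun ζ : ℂ => z + ζ • b) (𝓝[≠] a) (𝓝[≠] q) := by
      refine tendsto_nhdsWithin_iff.2 ⟨(Continuous.tendsto (by fun_prop) a).mono_left
        nhdsWithin_le_nhds, ?_⟩
      filter_upwards [self_mem_nhdsWithin] with ζ hζ
      simpa [hq, hb] using hζ
    filter_upwards [ht.eventually hC, self_mem_nhdsWithin] with ζ h1 h2
    refine h1.trans_eq ?_
    have h3 : z + ζ • b - q = (ζ - a) • b := by rw [hq, sub_smul]; abel
    have h4 : ‖ζ - a‖ ≠ 0 := by simpa [sub_eq_zero] using h2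
    rw [h3, norm_smul, Real.log_mul h4 hb0.ne']
    congr 1
    ring

/-- Direction, lower bound `c₀`, neighbourhood and exceptional null set are all chosen from `f`
alone, before any competitor, which makes the bound uniform. Where `f p ≠ 0` it suffices that `u ≤
0` and `log |f|` is bounded below. -/
theorem exists_uniform_bound [IsManifold 𝓘(ℂ, Cn n) ω X] {f : X → ℂ} {U : Set X}
    (hU : IsOpen U) (hf : A.GeneratedOn f U) {p : X} (hp : p ∈ U) (hne : A.stalk p ≠ ⊥) :
    ∃ V ∈ 𝓝 p, ∃ C : ℝ, ∀ u ∈ A.family, ∀ x ∈ V, u x ≤ logAbs f x + (C : EReal) := by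
  by_cases hfp : f p = 0
  swap
  · have hlog := continuousAt_logAbs (hf.continuousAt hp)
    have hlt : ((Real.log ‖f p‖ - 1 : ℝ) : EReal) < logAbs f p := by
      rw [logAbs_of_ne_zero hfp, EReal.coe_lt_coe_iff]
      linarith
    refine ⟨_, hlog.eventually (lt_mem_nhds hlt), 1 - Real.log ‖f p‖, fun u hu x hx => ?_⟩
    refine (hu.2.1 x).trans ?_
    have h1 : ((Real.log ‖f p‖ - 1 : ℝ) : EReal) + ((1 - Real.log ‖f p‖ : ℝ) : EReal) ≤
        logAbs f x + ((1 - Real.log ‖f p‖ : ℝ) : EReal) := by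
      gcongr
      exact le_of_lt hx
    refine le_trans (le_of_eq ?_) h1
    rw [← EReal.coe_add]
    simp
  set e := chartAt (Cn n) p with hedef
  have he : e ∈ IsManifold.maximalAtlas 𝓘(ℂ, Cn n) ω X := IsManifold.chart_mem_maximalAtlas p
  have hpe : p ∈ e.source := mem_chart_source (Cn n) p
  set F : Cn n → ℂ := fun z => f (e.symm z) with hFdef
  set S : Set (Cn n) := e.target ∩ e.symm ⁻¹' U with hSdef
  have hS : IsOpen S := isOpen_chart_preimage e hU
  have hF : AnalyticOnNhd ℂ F S := fun z hz => analyticAt_comp_symm he hz.1 ((hf _ hz.2).1 ())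
  have hpS : e p ∈ S := ⟨e.map_source hpe, by simpa [e.left_inv hpe] using hp⟩
  have hFfreq : ∃ᶠ z in 𝓝 (e p), F z ≠ 0 := by
    have h1 := hf.frequently_ne_zero hp hne
    have h2 : ∃ᶠ y in 𝓝 p, F (e y) ≠ 0 := by
      refine (h1.and_eventually (e.open_source.mem_nhds hpe)).mono fun y hy => ?_
      simpa [hFdef, e.left_inv hy.2] using hy.1
    exact (e.continuousAt hpe).tendsto.frequently h2
  obtain ⟨b, hbS, hb0⟩ := exists_good_direction hS hF hpS hFfreq
  have hb : b ≠ 0 := by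
    rintro rfl
    have := hb0 1 (by simp)
    simp [hFdef, e.left_inv hpe, hfp] at this
  -- a lower bound for `F` near the circle
  obtain ⟨c₀, hc₀, hev₀⟩ : ∃ c₀ > 0, ∀ ζ ∈ Metric.sphere (0 : ℂ) 1, c₀ < ‖F (e p + ζ • b)‖ := by
    have hcont : ContinuousOn (fun ζ : ℂ => ‖F (e p + ζ • b)‖) (Metric.sphere (0 : ℂ) 1) := by
      refine ContinuousOn.norm (hF.continuousOn.comp (by fun_prop) fun ζ hζ => ?_)
      exact hbS ζ (Metric.sphere_subset_closedBall hζ)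
    obtain ⟨ζ₁, hζ₁, hmin⟩ := (isCompact_sphere (0 : ℂ) 1).exists_isMinOn ⟨1, by simp⟩ hcont
    have hpos : 0 < ‖F (e p + ζ₁ • b)‖ := norm_pos_iff.2 (hb0 ζ₁ hζ₁)
    exact ⟨‖F (e p + ζ₁ • b)‖ / 2, by positivity, fun ζ hζ =>
      (half_lt_self hpos).trans_le (hmin hζ)⟩
  have hevc : ∀ᶠ z in 𝓝 (e p), ∀ ζ ∈ Metric.sphere (0 : ℂ) 1, c₀ < ‖F (z + ζ • b)‖ := by
    refine (isCompact_sphere (0 : ℂ) 1).eventually_forall_of_forall_eventually fun ζ hζ => ?_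
    have hc : ContinuousAt (fun v : Cn n × ℂ => ‖F (v.1 + v.2 • b)‖) (e p, ζ) := by
      have h1 : ContinuousAt F (e p + ζ • b) :=
        (hF _ (hbS ζ (Metric.sphere_subset_closedBall hζ))).continuousAt
      have h2 : ContinuousAt (fun v : Cn n × ℂ => v.1 + v.2 • b) (e p, ζ) := by fun_prop
      exact (ContinuousAt.comp (f := fun v : Cn n × ℂ => v.1 + v.2 • b) (x := (e p, ζ)) h1 h2).norm
    exact hc.eventually (lt_mem_nhds (hev₀ ζ hζ))
  obtain ⟨ρ₁, hρ₁, hnull⟩ := exists_null_zeros (hF _ hpS) hFfreq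
  obtain ⟨ρ₂, hρ₂, hball⟩ := Metric.eventually_nhds_iff_ball.1
    ((eventually_disc_subset hS hbS).and hevc)
  set ρ := min ρ₁ ρ₂ with hρdef
  have hρ : 0 < ρ := lt_min hρ₁ hρ₂
  have hae : ∀ᵐ z : Cn n, z ∈ Metric.ball (e p) ρ → ∀ u ∈ A.family,
      u (e.symm z) ≤ ((Real.log ‖F z‖ - Real.log c₀ : ℝ) : EReal) ∧ F z ≠ 0 := by
    have hbad : ∀ᵐ z : Cn n, ∀ k : ℕ, ¬ ∃ ζ : ℂ, z + ζ • b ∈ badSet b F S k :=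
      ae_all_iff.2 fun k => by
        rw [ae_iff]
        simpa using volume_lines_meeting_badSet hS hF k
    have hzero : ∀ᵐ z : Cn n, ¬ (z ∈ Metric.ball (e p) ρ₁ ∧ F z = 0) := by
      rw [ae_iff]
      simpa using hnull
    filter_upwards [hbad, hzero] with z h1 h2 h3 u hu
    have h4 : F z ≠ 0 := fun h => h2 ⟨Metric.ball_subset_ball (min_le_left _ _) h3, h⟩
    obtain ⟨h5, h6⟩ := hball z (Metric.ball_subset_ball (min_le_right _ _) h3)
    exact ⟨le_log_on_good_line hf he hc₀ h5 (fun ζ hζ => (h6 ζ hζ).le) hb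
      (fun k ζ h => h1 k ⟨ζ, h⟩) h4 hu, h4⟩
  have hballS : Metric.ball (e p) ρ ⊆ S := fun z hz => by
    simpa using (hball z (Metric.ball_subset_ball (min_le_right _ _) hz)).1 0 (by simp)
  refine ⟨e.source ∩ e ⁻¹' Metric.ball (e p) ρ,
    (e.isOpen_inter_preimage Metric.isOpen_ball).mem_nhds ⟨hpe, Metric.mem_ball_self hρ⟩,
    -Real.log c₀, fun u hu x hx => ?_⟩
  by_contra! hcon
  -- By continuity the right-hand side stays below `c` on a small ball, so `u ≤ c` almost everywhere
  -- there, hence also at its centre.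
  obtain ⟨c, hc1, hc2⟩ := exists_between hcon
  have hxS : e x ∈ S := hballS hx.2
  have hcx : ContinuousAt (fun z => logAbs F z + ((-Real.log c₀ : ℝ) : EReal)) (e x) := by
    have h1 := continuousAt_logAbs (hF _ hxS).continuousAt
    have h2 : ContinuousAt (fun p : EReal × EReal => p.1 + p.2)
        (logAbs F (e x), ((-Real.log c₀ : ℝ) : EReal)) :=
      EReal.continuousAt_add (Or.inr (EReal.coe_ne_bot _)) (Or.inr (EReal.coe_ne_top _))
    exact ContinuousAt.comp (f := fun z => (logAbs F z, ((-Real.log c₀ : ℝ) : EReal))) h2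
      (h1.prodMk continuousAt_const)
  have hval : logAbs F (e x) = logAbs f x := by simp [logAbs, hFdef, e.left_inv hx.1]
  have hev := hcx.eventually (gt_mem_nhds (by simpa only [hval] using hc1))
  obtain ⟨δ, hδ, hδb⟩ := Metric.nhds_basis_closedBall.mem_iff.1
    (hev.and (Metric.isOpen_ball.eventually_mem hx.2))
  have hflat : PshFlat (fun z => u (e.symm z)) (Metric.closedBall (e x) δ) :=
    (hu.1.pshFlat he).mono fun z hz => ⟨(hballS (hδb hz).2).1, trivial⟩
  have hle : u (e.symm (e x)) ≤ c := by
    refine hflat.le_of_ae_le hδ ?_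
    rw [ae_restrict_iff' measurableSet_closedBall]
    filter_upwards [hae] with z hz hzδ
    obtain ⟨h1, h2⟩ := hz (hδb hzδ).2 u hu
    refine h1.trans (le_trans (le_of_eq ?_) (hδb hzδ).1.le)
    rw [logAbs_of_ne_zero h2, ← EReal.coe_add, sub_eq_add_neg]
  rw [e.left_inv hx.1] at hle
  exact absurd hc2 (not_lt.2 hle)

end ComplexSubspace

/-! ### Upper semicontinuous regularization -/

lemma usc_limsup_nhds {Y : Type*} [TopologicalSpace Y] (g : Y → EReal) :
    UpperSemicontinuous fun x => limsup g (𝓝 x) := by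
  intro x c hc
  obtain ⟨c', hc', hcc'⟩ := exists_between hc
  have hev := eventually_lt_of_limsup_lt hc'
  filter_upwards [eventually_eventually_nhds.2 hev] with y hy
  exact (limsup_le_of_le (by isBoundedDefault) (hy.mono fun _ h => le_of_lt h)).trans_lt hcc'

lemma le_limsup_nhds {Y : Type*} [TopologicalSpace Y] (g : Y → EReal) (x : Y) :
    g x ≤ limsup g (𝓝 x) := by
  refine le_limsup_of_frequently_le ?_ (by isBoundedDefault)
  have h : ∃ᶠ y in pure x, g x ≤ g y := frequently_pure.2 le_rfl
  exact h.filter_mono (pure_le_nhds x)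

lemma limsup_nhds_le_of_usc {Y : Type*} [TopologicalSpace Y] {g : Y → EReal} {x : Y}
    (h : UpperSemicontinuousAt g x) : limsup g (𝓝 x) ≤ g x := by
  refine le_of_forall_gt fun c hc => ?_
  obtain ⟨c', hc', hcc'⟩ := exists_between hc
  exact (limsup_le_of_le (by isBoundedDefault) ((h c' hc').mono fun _ h => le_of_lt h)).trans_lt hcc'

/-- Points where `g` is large near `e.symm a`, seen in the chart `e`. -/
lemma frequently_lt_comp_symm {Y : Type*} [TopologicalSpace Y] {g : Y → EReal}
    {e : OpenPartialHomeomorph Y (Cn n)} {a : Cn n} (ha : a ∈ e.target) {c : EReal}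
    (hc : c < limsup g (𝓝 (e.symm a))) : ∃ᶠ z in 𝓝 a, c < g (e.symm z) := by
  have h1 := frequently_lt_of_lt_limsup (by isBoundedDefault) hc
  have hs : e.symm a ∈ e.source := e.map_target ha
  have h2 : ∃ᶠ y in 𝓝 (e.symm a), c < g (e.symm (e y)) := by
    refine (h1.and_eventually (e.open_source.mem_nhds hs)).mono fun y hy => ?_
    simpa [e.left_inv hy.2] using hy.1
  have ht : Tendsto e (𝓝 (e.symm a)) (𝓝 a) := by
    have := (e.continuousAt hs).tendsto
    rwa [e.right_inv ha] at this
  exact ht.frequently h2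

lemma usc_comp_symm {Y : Type*} [TopologicalSpace Y] {g : Y → EReal}
    {e : OpenPartialHomeomorph Y (Cn n)}
    (hg : UpperSemicontinuous g) {S : Set (Cn n)} (hS : S ⊆ e.target) :
    UpperSemicontinuousOn (fun z => g (e.symm z)) S := fun _ hz c hc =>
  nhdsWithin_le_nhds ((e.continuousAt_symm (hS hz)).eventually (hg _ c hc))

/-! ### The Green function belongs to its defining family -/

namespace ComplexSubspace

variable {A : ComplexSubspace n X}

lemma le_green {u : X → EReal} (hu : u ∈ A.family) (x : X) : u x ≤ A.green x :=
  le_iSup₂ (f := fun (u : X → EReal) (_ : u ∈ A.family) => u x) u hu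

lemma green_nonpos (x : X) : A.green x ≤ 0 := iSup₂_le fun _ hu => hu.2.1 x

/-- A value `c` below the regularization at `a` is exceeded by some competitor at points arbitrarily
close to `a`. Its sub-mean inequality there feeds `subMean_of_frequently`. -/
lemma isPSHOn_limsup_green : IsPSHOn n (fun x => limsup A.green (𝓝 x)) univ := by
  have hle0 : ∀ x, limsup A.green (𝓝 x) ≤ 0 := fun x =>
    limsup_le_of_le (by isBoundedDefault) (.of_forall green_nonpos)
  have htop : ∀ x, limsup A.green (𝓝 x) ≠ ⊤ := fun x =>
    ne_top_of_le_ne_top EReal.zero_ne_top (hle0 x)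
  refine isPSHOn_of_pshFlat ((usc_limsup_nhds _).upperSemicontinuousOn _) (fun x _ => htop x)
    fun e he => ?_
  have husc := usc_comp_symm (e := e) (S := e.target ∩ e.symm ⁻¹' univ)
    (usc_limsup_nhds A.green) inter_subset_left
  have hS := isOpen_chart_preimage e (isOpen_univ (X := X))
  refine ⟨husc, fun x _ => htop _, fun a b hab => ?_⟩
  refine subMean_of_frequently hS husc (fun x _ => htop _) hab fun c hc => ?_
  have ha : a ∈ e.target := by simpa using (hab 0 (by simp)).1
  refine ((frequently_lt_comp_symm ha hc).and_eventually
    (eventually_disc_subset hS hab)).mono fun z hz => ?_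
  obtain ⟨u, hu'⟩ := lt_iSup_iff.1 hz.1
  obtain ⟨hu, hcu⟩ := lt_iSup_iff.1 hu'
  refine ⟨fun ζ => u (e.symm (z + ζ • b)), (hu.1.pshFlat he).2.2 z b hz.2, ?_, ?_, fun θ => ?_⟩
  · simpa using hcu.le
  · simpa using (le_green hu _).trans (le_limsup_nhds A.green _)
  · exact (le_green hu _).trans (le_limsup_nhds A.green _)

/-- The uniform bound passes to the supremum and, as `log |f| + C` is continuous with values in
`[-∞, ∞)`, to its regularization. This bound yields the required Lelong numbers. -/
lemma limsup_green_mem_family [IsManifold 𝓘(ℂ, Cn n) ω X] (hA : A.IsEffectiveDivisor) :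
    (fun x => limsup A.green (𝓝 x)) ∈ A.family := by
  refine ⟨isPSHOn_limsup_green, fun x =>
    limsup_le_of_le (by isBoundedDefault) (.of_forall green_nonpos), fun p => ?_⟩
  obtain ⟨U, hU, hpU, f, hf⟩ := A.exists_generatedOn (hA p).1
  obtain ⟨V, hV, C, hC⟩ := exists_uniform_bound hU hf hpU (hA p).2
  refine (nu_le_lelongNumber (hf p hpU)).trans (lelongNumber_anti (C := C) ?_)
  filter_upwards [eventually_mem_nhds_iff.2 hV, hU.mem_nhds hpU] with x hxV hxU
  have hcx : ContinuousAt (fun z => logAbs f z + (C : EReal)) x := by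
    have h2 : ContinuousAt (fun p : EReal × EReal => p.1 + p.2) (logAbs f x, (C : EReal)) :=
      EReal.continuousAt_add (Or.inr (EReal.coe_ne_bot _)) (Or.inr (EReal.coe_ne_top _))
    exact ContinuousAt.comp (f := fun z => (logAbs f z, (C : EReal))) h2
      ((continuousAt_logAbs (hf.continuousAt hxU)).prodMk continuousAt_const)
  refine le_trans (limsup_le_limsup ?_) (limsup_nhds_le_of_usc hcx.upperSemicontinuousAt)
  filter_upwards [hxV] with y hy
  exact iSup₂_le fun u hu => hC u hu y hy

lemma green_mem_family [IsManifold 𝓘(ℂ, Cn n) ω X] (hA : A.IsEffectiveDivisor) :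
    A.green ∈ A.family := by
  have h := limsup_green_mem_family hA
  have : A.green = fun x => limsup A.green (𝓝 x) :=
    funext fun x => le_antisymm (le_limsup_nhds A.green x) (le_green h x)
  rw [this]
  exact h

end ComplexSubspace

/-! ### Removing the logarithmic pole -/

/-- The quotient `g - γ log |F| - κ`, set to `-∞` on the zeros of `F`. -/
def divLog {Y : Type*} (g : Y → EReal) (F : Y → ℂ) (γ κ : ℝ) (z : Y) : EReal :=
  open scoped Classical in
  if F z = 0 then ⊥ else g z - ((γ * Real.log ‖F z‖ + κ : ℝ) : EReal)

lemma divLog_of_eq_zero {Y : Type*} {g : Y → EReal} {F : Y → ℂ} {γ κ : ℝ} {z : Y} (h : F z = 0) :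
    divLog g F γ κ z = ⊥ := if_pos h

lemma divLog_of_ne_zero {Y : Type*} {g : Y → EReal} {F : Y → ℂ} {γ κ : ℝ} {z : Y} (h : F z ≠ 0) :
    divLog g F γ κ z = g z - ((γ * Real.log ‖F z‖ + κ : ℝ) : EReal) := if_neg h

lemma divLog_le {Y : Type*} {g : Y → EReal} {F : Y → ℂ} {γ κ C : ℝ} {z : Y} (h : F z ≠ 0)
    (hC : g z ≤ logAbs F z + (C : EReal)) :
    divLog g F γ κ z ≤ (((1 - γ) * Real.log ‖F z‖ + (C - κ) : ℝ) : EReal) := by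
  rw [divLog_of_ne_zero h]
  rw [logAbs_of_ne_zero h, ← EReal.coe_add] at hC
  refine (EReal.sub_le_sub hC le_rfl).trans_eq ?_
  rw [← EReal.coe_sub]
  congr 1
  ring

lemma uscAt_divLog {Y : Type*} [TopologicalSpace Y] {g : Y → EReal} {F : Y → ℂ} {γ κ : ℝ} {x : Y}
    (hg : UpperSemicontinuousAt g x) (hF : ContinuousAt F x) (h0 : F x ≠ 0) :
    UpperSemicontinuousAt (divLog g F γ κ) x := by
  have h1 : ContinuousAt (fun z => ((-(γ * Real.log ‖F z‖ + κ) : ℝ) : EReal)) x := by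
    refine continuous_coe_real_ereal.continuousAt.comp ?_
    exact ((continuousAt_const.mul (hF.norm.log (norm_ne_zero_iff.2 h0))).add
      continuousAt_const).neg
  have h2 := hg.add' h1.upperSemicontinuousAt
    (EReal.continuousAt_add (Or.inr (EReal.coe_ne_bot _)) (Or.inr (EReal.coe_ne_top _)))
  intro c hc
  rw [divLog_of_ne_zero h0] at hc
  have h3 := h2 c (by simpa only [EReal.coe_neg, ← sub_eq_add_neg] using hc)
  filter_upwards [h3, hF.eventually_ne h0] with z h4 h5
  rw [divLog_of_ne_zero h5]
  simpa only [EReal.coe_neg, ← sub_eq_add_neg] using h4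

/-- For `γ < 1` the bound by `log |F| + C` leaves a positive multiple of `log |F|`, so the quotient
tends to `-∞` at the zeros of `F` and is upper semicontinuous there. Off the zeros a harmonic
function is subtracted on each small disc. -/
theorem pshFlat_divLog {g : Cn n → EReal} {F : Cn n → ℂ} {S : Set (Cn n)} (hS : IsOpen S)
    (hg : PshFlat g S) (hF : AnalyticOnNhd ℂ F S)
    (hbd : ∀ x ∈ S, ∃ C : ℝ, ∀ᶠ z in 𝓝 x, g z ≤ logAbs F z + (C : EReal))
    {γ : ℝ} (hγ : γ < 1) (κ : ℝ) : PshFlat (divLog g F γ κ) S := by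
  have hgu : ∀ x ∈ S, UpperSemicontinuousAt g x := fun x hx c hc => by
    have := hg.1 x hx c hc
    rwa [hS.nhdsWithin_eq hx] at this
  refine pshFlat_of_local (fun x hx => ?_) (fun x hx => ?_) fun a ha hb b => ?_
  · refine UpperSemicontinuousAt.upperSemicontinuousWithinAt _ ?_
    by_cases h0 : F x = 0
    · intro c hc
      rw [divLog_of_eq_zero h0] at hc
      obtain ⟨c', hc'0, hc'⟩ := EReal.lt_iff_exists_real_btwn.1 hc
      obtain ⟨C, hC⟩ := hbd x hx
      have hlog : Tendsto (fun r : ℝ => (1 - γ) * Real.log r + (C - κ)) (𝓝[≠] 0) atBot :=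
        (Real.tendsto_log_nhdsNE_zero.const_mul_atBot (by linarith)).atBot_add tendsto_const_nhds
      have hev := hlog.eventually_lt_atBot c'
      rw [eventually_nhdsWithin_iff] at hev
      have hFn : Tendsto (fun z => ‖F z‖) (𝓝 x) (𝓝 0) := by
        simpa [h0] using (hF x hx).continuousAt.norm.tendsto
      filter_upwards [hFn.eventually hev, hC] with z h1 h2
      by_cases hz : F z = 0
      · rw [divLog_of_eq_zero hz]; exact hc'0.trans hc'
      · refine (divLog_le hz h2).trans_lt (lt_trans ?_ hc')
        exact_mod_cast h1 (norm_ne_zero_iff.2 hz)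
    · exact uscAt_divLog (hgu x hx) (hF x hx).continuousAt h0
  · by_cases h0 : F x = 0
    · rw [divLog_of_eq_zero h0]; exact bot_ne_top
    · rw [divLog_of_ne_zero h0]
      exact EReal_sub_coe_ne_top (hg.2.1 x hx)
  · have h0 : F a ≠ 0 := fun h0 => hb (divLog_of_eq_zero h0)
    filter_upwards [eventually_log_norm_mean hS hF ha h0 b] with r ⟨hr1, hr2, hr3⟩
    have hsm := hg.2.2 a ((r : ℂ) • b) fun ζ hζ => by
      rw [smul_smul, mul_comm]; exact (hr1 ζ hζ).1
    have hsm' : SubMean fun ζ => g (a + ((r : ℂ) * ζ) • b) :=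
      hsm.congr (by simp) fun θ => by rw [smul_smul, mul_comm]
    have hin : ∀ θ : ℝ, circleMap 0 1 θ ∈ Metric.closedBall (0 : ℂ) 1 := fun θ =>
      Metric.sphere_subset_closedBall (circleMap_zero_one_mem_sphere θ)
    have h0D : (0 : ℂ) ∈ Metric.closedBall (0 : ℂ) 1 := Metric.mem_closedBall_self zero_le_one
    have hint : CircleIntegrable (fun ζ => γ * Real.log ‖F (a + ((r : ℂ) * ζ) • b)‖) 0 1 :=
      IntervalIntegrable.const_mul hr2 γ
    refine (hsm'.sub (g := fun ζ => γ * Real.log ‖F (a + ((r : ℂ) * ζ) • b)‖ + κ)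
      (hg.2.1 _ (hr1 0 h0D).1) (fun θ => hg.2.1 _ (hr1 _ (hin θ)).1) ?_ ?_).congr ?_ fun θ => ?_
    · exact hint.add (circleIntegrable_const κ 0 1)
    · have h1 : Real.circleAverage (fun ζ => γ * Real.log ‖F (a + ((r : ℂ) * ζ) • b)‖) 0 1 =
          γ * Real.circleAverage (fun ζ => Real.log ‖F (a + ((r : ℂ) * ζ) • b)‖) 0 1 := by
        simp only [← smul_eq_mul]
        exact Real.circleAverage_fun_smul
      rw [Real.circleAverage_fun_add hint (circleIntegrable_const κ 0 1), h1, hr3,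
        Real.circleAverage_const]
      simp
    · exact (divLog_of_ne_zero (hr1 0 h0D).2).symm
    · exact (divLog_of_ne_zero (hr1 _ (hin θ)).2).symm

lemma divLog_mono {Y : Type*} {g : Y → EReal} {F : Y → ℂ} {γ κ γ' κ' : ℝ} {z : Y}
    (h : F z ≠ 0 → γ' * Real.log ‖F z‖ + κ' ≤ γ * Real.log ‖F z‖ + κ) :
    divLog g F γ κ z ≤ divLog g F γ' κ' z := by
  by_cases h0 : F z = 0
  · rw [divLog_of_eq_zero h0]; exact bot_le
  · rw [divLog_of_ne_zero h0, divLog_of_ne_zero h0]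
    exact EReal.sub_le_sub le_rfl (by exact_mod_cast h h0)

/-! ### The Green function divided by a local generator -/

namespace ComplexSubspace

variable {A : ComplexSubspace n X}

/-- The plurisubharmonic extension of `G_A - log |f|` across the divisor. -/
def greenQuotient (A : ComplexSubspace n X) (f : X → ℂ) (x : X) : EReal :=
  limsup (divLog A.green f 1 0) (𝓝 x)

/-- Off the support the unregularized quotient is already upper semicontinuous, since `G_A` is. -/
lemma greenQuotient_eq [IsManifold 𝓘(ℂ, Cn n) ω X] (hA : A.IsEffectiveDivisor) {U : Set X}
    {f : X → ℂ} (hf : A.GeneratedOn f U) {x : X} (hx : x ∈ U \ A.support) :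
    A.greenQuotient f x = A.green x - logAbs f x := by
  have h0 : f x ≠ 0 := fun h => hx.2 ((hf.mem_support_iff hx.1).2 h)
  have hg : UpperSemicontinuousAt A.green x := fun c hc => by
    simpa using (green_mem_family hA).1.1 x (mem_univ x) c hc
  have h1 : A.greenQuotient f x = divLog A.green f 1 0 x :=
    le_antisymm (limsup_nhds_le_of_usc (uscAt_divLog hg (hf.continuousAt hx.1) h0))
      (le_limsup_nhds _ x)
  rw [h1, divLog_of_ne_zero h0, logAbs_of_ne_zero h0]
  simp

/-- With exponent `1` the quotient need not tend to `-∞` at the zeros, so `pshFlat_divLog` does not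
apply. Where `|F| < M + 1`, the plurisubharmonic functions with exponent `1 - ε` and constant `ε log
(M + 1)` lie below it and converge to it as `ε → 0` at any point off the zeros where `G_A` is
finite. -/
theorem isPSHOn_greenQuotient [IsManifold 𝓘(ℂ, Cn n) ω X] (hA : A.IsEffectiveDivisor) {U : Set X}
    (hU : IsOpen U) {f : X → ℂ} (hf : A.GeneratedOn f U) : IsPSHOn n (A.greenQuotient f) U := by
  have hG := green_mem_family hA
  have hbd : ∀ x ∈ U, ∃ C : ℝ, ∀ᶠ y in 𝓝 x, A.green y ≤ logAbs f y + (C : EReal) := fun x hx => by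
    obtain ⟨V, hV, C, hC⟩ := exists_uniform_bound hU hf hx (hA x).2
    exact ⟨C, eventually_of_mem hV fun y hy => hC _ hG y hy⟩
  have htop : ∀ x ∈ U, A.greenQuotient f x ≠ ⊤ := by
    intro x hx
    obtain ⟨C, hC⟩ := hbd x hx
    refine ne_top_of_le_ne_top (EReal.coe_ne_top C)
      (limsup_le_of_le (by isBoundedDefault) (hC.mono fun y hy => ?_))
    by_cases h0 : f y = 0
    · rw [divLog_of_eq_zero h0]; exact bot_le
    · simpa using divLog_le (γ := 1) (κ := 0) h0 hy
  refine isPSHOn_of_pshFlat ((usc_limsup_nhds _).upperSemicontinuousOn _) htop fun e he => ?_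
  set S : Set (Cn n) := e.target ∩ e.symm ⁻¹' U with hSdef
  have hS : IsOpen S := isOpen_chart_preimage e hU
  set F : Cn n → ℂ := fun z => f (e.symm z) with hFdef
  have hF : AnalyticOnNhd ℂ F S := fun z hz => analyticAt_comp_symm he hz.1 ((hf _ hz.2).1 ())
  have hg : PshFlat (fun z => A.green (e.symm z)) S :=
    (hG.1.pshFlat he).mono (inter_subset_inter_right _ (preimage_mono (subset_univ U)))
  have hbd' : ∀ x ∈ S, ∃ C : ℝ, ∀ᶠ z in 𝓝 x, A.green (e.symm z) ≤ logAbs F z + (C : EReal) := by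
    intro x hx
    obtain ⟨C, hC⟩ := hbd _ hx.2
    exact ⟨C, (e.continuousAt_symm hx.1).eventually hC⟩
  have husc := usc_comp_symm (e := e) (S := S)
    (usc_limsup_nhds (divLog A.green f 1 0)) inter_subset_left
  refine ⟨husc, fun x hx => htop _ hx.2, fun a b hab => ?_⟩
  refine subMean_of_frequently hS husc (fun x hx => htop _ hx.2) hab fun c hc => ?_
  have ha : a ∈ e.target := by simpa using (hab 0 (by simp)).1
  -- `|F| < M` near the disc
  obtain ⟨M, hM⟩ : ∃ M : ℝ, ∀ ζ ∈ Metric.closedBall (0 : ℂ) 1, ‖F (a + ζ • b)‖ ≤ M := by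
    have hcont : ContinuousOn (fun ζ : ℂ => F (a + ζ • b)) (Metric.closedBall (0 : ℂ) 1) :=
      hF.continuousOn.comp (by fun_prop) hab
    exact (isCompact_closedBall (0 : ℂ) 1).exists_bound_of_continuousOn hcont
  have hT : IsOpen (S ∩ (fun z => ‖F z‖) ⁻¹' Iio (M + 1)) :=
    hF.continuousOn.norm.isOpen_inter_preimage hS isOpen_Iio
  have htube := eventually_disc_subset hT (a := a) (b := b) fun ζ hζ =>
    ⟨hab ζ hζ, (hM ζ hζ).trans_lt (lt_add_one M)⟩
  refine ((frequently_lt_comp_symm ha hc).and_eventually htube).mono fun z hz => ?_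
  obtain ⟨hcz, hzT⟩ := hz
  have hFz : F z ≠ 0 := fun h0 => by
    rw [divLog_of_eq_zero (show f (e.symm z) = 0 from h0)] at hcz
    exact not_lt_bot hcz
  have hzS : z ∈ S := by simpa using (hzT 0 (by simp)).1
  -- the choice of the exponent
  obtain ⟨ε, hε0, hε⟩ : ∃ ε : ℝ, 0 < ε ∧ (c : EReal) ≤
      divLog (fun z => A.green (e.symm z)) F (1 - ε) (ε * Real.log (M + 1)) z := by
    have hgt := hg.2.1 z hzS
    rw [divLog_of_ne_zero (show f (e.symm z) ≠ 0 from hFz)] at hcz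
    simp only [divLog_of_ne_zero hFz]
    have hgb : A.green (e.symm z) ≠ ⊥ := fun h => by simp [h] at hcz
    lift A.green (e.symm z) to ℝ using ⟨hgt, hgb⟩ with x
    rw [← EReal.coe_sub, EReal.coe_lt_coe_iff] at hcz
    simp only [← EReal.coe_sub, EReal.coe_le_coe_iff]
    have hlim : Tendsto (fun ε : ℝ => x - ((1 - ε) * Real.log ‖F z‖ + ε * Real.log (M + 1)))
        (𝓝[>] 0) (𝓝 (x - ((1 - 0) * Real.log ‖F z‖ + 0 * Real.log (M + 1)))) :=
      (Continuous.tendsto (by fun_prop) 0).mono_left nhdsWithin_le_nhds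
    have hlt : c < x - ((1 - 0) * Real.log ‖F z‖ + 0 * Real.log (M + 1)) := by
      simpa [hFdef] using hcz
    obtain ⟨ε, h1, h2⟩ := ((hlim.eventually (lt_mem_nhds hlt)).and self_mem_nhdsWithin).exists
    exact ⟨ε, h2, h1.le⟩
  have hps := pshFlat_divLog hS hg hF hbd' (γ := 1 - ε) (by linarith) (ε * Real.log (M + 1))
  have hle : ∀ ζ ∈ Metric.closedBall (0 : ℂ) 1,
      divLog (fun z => A.green (e.symm z)) F (1 - ε) (ε * Real.log (M + 1)) (z + ζ • b) ≤
        A.greenQuotient f (e.symm (z + ζ • b)) := by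
    intro ζ hζ
    refine le_trans (divLog_mono (γ' := 1) (κ' := 0) fun h0 => ?_)
      (le_limsup_nhds (divLog A.green f 1 0) _)
    have h1 := Real.log_le_log (norm_pos_iff.2 h0) (le_of_lt (hzT ζ hζ).2)
    nlinarith
  refine ⟨_, hps.2.2 z b fun ζ hζ => (hzT ζ hζ).1, ?_, ?_, fun θ => ?_⟩
  · simpa using hε
  · have h0 := hle 0 (by simp)
    simp only [zero_smul, add_zero] at h0 ⊢
    exact h0
  · exact hle _ (Metric.sphere_subset_closedBall (circleMap_zero_one_mem_sphere θ))

lemma green_sub_logAbs_bounded [IsManifold 𝓘(ℂ, Cn n) ω X] (hA : A.IsEffectiveDivisor) {U : Set X}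
    (hU : IsOpen U) {f : X → ℂ} (hf : A.GeneratedOn f U) {p : X} (hp : p ∈ U) :
    ∃ V ∈ 𝓝 p, ∃ C : ℝ, ∀ x ∈ V ∩ (U \ A.support), A.green x - logAbs f x ≤ (C : EReal) := by
  obtain ⟨V, hV, C, hC⟩ := exists_uniform_bound hU hf hp (hA p).2
  refine ⟨V, hV, C, fun x hx => ?_⟩
  have h0 : f x ≠ 0 := fun h => hx.2.2 ((hf.mem_support_iff hx.2.1).2 h)
  rw [EReal.sub_le_iff_le_add (Or.inl fun h => h0 (logAbs_eq_bot_iff.1 h)) (Or.inl logAbs_ne_top),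
    add_comm]
  exact hC _ (green_mem_family hA) x hx.1

end ComplexSubspace

/-! ### Local integrability -/

/-- A plurisubharmonic function that is finite somewhere near `x` is finite almost everywhere and
integrable near `x`. -/
lemma PshFlat.exists_integrableOn {w : Cn n → EReal} {S : Set (Cn n)} (hS : IsOpen S)
    (hw : PshFlat w S) {x : Cn n} (hx : x ∈ S) (hf : ∃ᶠ y in 𝓝 x, w y ≠ ⊥) :
    ∃ ρ > 0, (∀ᵐ z ∂volume.restrict (Metric.ball x ρ), w z ≠ ⊥) ∧
      IntegrableOn (fun z => (w z).toReal) (Metric.ball x ρ) := by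
  obtain ⟨R, hR, hball⟩ := Metric.isOpen_iff.1 hS x hx
  obtain ⟨y, hy0, hy⟩ := (hf.and_eventually (Metric.ball_mem_nhds x (ε := R / 3)
    (by positivity))).exists
  have hy : dist y x < R / 3 := hy
  have hsub : Metric.closedBall y (R / 2) ⊆ S := fun z hz => by
    refine hball (Metric.mem_ball.2 ?_)
    have := Metric.mem_closedBall.1 hz
    linarith [dist_triangle z y x]
  have hsub' : Metric.ball x (R / 6) ⊆ Metric.closedBall y (R / 2) := fun z hz => by
    have := Metric.mem_ball.1 hz
    rw [Metric.mem_closedBall]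
    linarith [dist_triangle z x y, dist_comm x y]
  obtain ⟨h1, h2⟩ := (hw.mono hsub).integrableOn_closedBall hy0 (by positivity)
  exact ⟨R / 6, by positivity, ae_restrict_of_ae_restrict_of_subset hsub' h1, h2.mono_set hsub'⟩

lemma PshFlat.locallyIntegrableOn {w : Cn n → EReal} {S : Set (Cn n)} (hS : IsOpen S)
    (hw : PshFlat w S) (hf : ∀ x ∈ S, ∃ᶠ y in 𝓝 x, w y ≠ ⊥) :
    (∀ᵐ z ∂volume.restrict S, w z ≠ ⊥) ∧ LocallyIntegrableOn (fun z => (w z).toReal) S := by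
  constructor
  · rw [ae_restrict_iff' hS.measurableSet, ae_iff]
    refine measure_null_of_locally_null _ fun x hx => ?_
    simp only [mem_ofPred_eq, Classical.not_imp, not_not] at hx
    obtain ⟨ρ, hρ, h, -⟩ := hw.exists_integrableOn hS hx.1 (hf x hx.1)
    refine ⟨_, inter_mem_nhdsWithin _ (Metric.ball_mem_nhds x hρ), ?_⟩
    rw [ae_restrict_iff' measurableSet_ball, ae_iff] at h
    refine measure_mono_null (fun z hz => ?_) h
    simp only [mem_inter_iff, mem_ofPred_eq, Classical.not_imp, not_not] at hz ⊢
    exact ⟨hz.2, hz.1.2⟩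
  · intro x hx
    obtain ⟨ρ, hρ, -, h⟩ := hw.exists_integrableOn hS hx (hf x hx)
    exact ⟨_, nhdsWithin_le_nhds (Metric.ball_mem_nhds x hρ), h⟩

lemma frequently_of_ae_restrict {S : Set (Cn n)} (hS : IsOpen S) {P : Cn n → Prop}
    (h : ∀ᵐ z ∂volume.restrict S, P z) {x : Cn n} (hx : x ∈ S) : ∃ᶠ z in 𝓝 x, P z := by
  intro hcon
  obtain ⟨V, hV, hVo, hxV⟩ := eventually_nhds_iff.1 (hcon.and (hS.mem_nhds hx))
  rw [ae_restrict_iff' hS.measurableSet, ae_iff] at h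
  have h0 : volume V = 0 := measure_mono_null (fun z hz => by
    simpa using ⟨(hV z hz).2, (hV z hz).1⟩) h
  exact (hVo.measure_pos volume ⟨x, hxV⟩).ne' h0

/-! ### The Levi form of a smooth function -/

lemma leviSmooth_eq (φ : Cn n → ℝ) (ξ z : Cn n) :
    leviSmooth φ ξ z = (fderiv ℝ (fderiv ℝ φ) z ξ ξ +
      fderiv ℝ (fderiv ℝ φ) z (Complex.I • ξ) (Complex.I • ξ)) / 4 := by
  simp [leviSmooth, iteratedFDeriv_two_apply]

/-- The mixed terms cancel between the directions `c • ξ` and `i c • ξ`. Rotation invariance later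
removes the angle from the circle means. -/
lemma leviSmooth_smul (φ : Cn n → ℝ) (ξ z : Cn n) {c : ℂ} (hc : ‖c‖ = 1) :
    leviSmooth φ (c • ξ) z = leviSmooth φ ξ z := by
  have h1 : c • ξ = c.re • ξ + c.im • (Complex.I • ξ) := by
    conv_lhs => rw [← Complex.re_add_im c]
    rw [add_smul, mul_smul, Complex.coe_smul, Complex.coe_smul]
  have h2 : Complex.I • c • ξ = c.re • (Complex.I • ξ) - c.im • ξ := by
    rw [h1, smul_add, smul_comm Complex.I c.re, smul_comm Complex.I c.im, smul_smul Complex.I,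
      Complex.I_mul_I, neg_one_smul, smul_neg, sub_eq_add_neg]
  have h3 : c.re ^ 2 + c.im ^ 2 = 1 := by
    have := Complex.sq_norm c
    rw [hc, Complex.normSq_apply] at this
    linarith
  rw [leviSmooth_eq, leviSmooth_eq, h2, h1]
  simp only [map_add, map_sub, map_smul, add_apply,
    sub_apply, smul_apply, smul_eq_mul]
  linear_combination (1 / 4 * (fderiv ℝ (fderiv ℝ φ) z ξ ξ +
      fderiv ℝ (fderiv ℝ φ) z (Complex.I • ξ) (Complex.I • ξ))) * h3

section SecondDifference

variable {E : Type*} [NormedAddCommGroup E] [NormedSpace ℝ E]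

lemma hasDerivAt_symm_sum {φ : E → ℝ} (hφ : Differentiable ℝ φ) (z h : E) (t : ℝ) :
    HasDerivAt (fun s : ℝ => φ (z + s • h) + φ (z - s • h) - 2 * φ z)
      (fderiv ℝ φ (z + t • h) h - fderiv ℝ φ (z - t • h) h) t := by
  have h1 : HasDerivAt (fun s : ℝ => s • h) h t := by
    simpa using (hasDerivAt_id t).smul_const h
  have h2 := (hφ (z + t • h)).hasFDerivAt.comp_hasDerivAt t (h1.const_add z)
  have h3 := (hφ (z - t • h)).hasFDerivAt.comp_hasDerivAt t (h1.const_sub z)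
  simpa [sub_eq_add_neg] using (h2.add h3).sub_const (2 * φ z)

/-- Uniform in `z`, to serve as the dominating bound when the step tends to zero. -/
lemma abs_second_difference_le {φ : E → ℝ} (hφ : ContDiff ℝ 2 φ) {C : ℝ}
    (hC : ∀ z, ‖fderiv ℝ (fderiv ℝ φ) z‖ ≤ C) (z h : E) {t : ℝ} (ht : 0 ≤ t) :
    |φ (z + t • h) + φ (z - t • h) - 2 * φ z| ≤ 2 * C * ‖h‖ ^ 2 * t ^ 2 := by
  have hd : Differentiable ℝ φ := hφ.differentiable (by norm_num)
  have hd1 : Differentiable ℝ (fderiv ℝ φ) :=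
    (hφ.fderiv_right (m := 1) (by norm_num)).differentiable (by norm_num)
  have hC0 : 0 ≤ C := (norm_nonneg (fderiv ℝ (fderiv ℝ φ) z)).trans (hC z)
  have key : ∀ s ∈ Icc 0 t, ‖fderiv ℝ φ (z + s • h) h - fderiv ℝ φ (z - s • h) h‖ ≤
      2 * C * ‖h‖ ^ 2 * t := by
    intro s hs
    have h1 : ‖fderiv ℝ φ (z + s • h) - fderiv ℝ φ (z - s • h)‖ ≤
        C * ‖(z + s • h) - (z - s • h)‖ :=
      convex_univ.norm_image_sub_le_of_norm_fderiv_le (fun x _ => hd1 x) (fun x _ => hC x)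
        (mem_univ _) (mem_univ _)
    have h2 : (z + s • h) - (z - s • h) = (2 * s) • h := by
      rw [mul_smul, two_smul]; abel
    rw [h2, norm_smul, Real.norm_of_nonneg (by linarith [hs.1])] at h1
    calc _ = ‖(fderiv ℝ φ (z + s • h) - fderiv ℝ φ (z - s • h)) h‖ := rfl
      _ ≤ ‖fderiv ℝ φ (z + s • h) - fderiv ℝ φ (z - s • h)‖ * ‖h‖ :=
        ContinuousLinearMap.le_opNorm _ _
      _ ≤ C * (2 * s * ‖h‖) * ‖h‖ := by gcongr
      _ = 2 * C * ‖h‖ ^ 2 * s := by ring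
      _ ≤ _ := by gcongr; exact hs.2
  have := norm_image_sub_le_of_norm_deriv_le_segment'
    (fun s _ => (hasDerivAt_symm_sum hd z h s).hasDerivWithinAt)
    (fun s hs => key s (Ico_subset_Icc_self hs)) t (right_mem_Icc.2 ht)
  simp only [zero_smul, add_zero, sub_zero, Real.norm_eq_abs] at this
  calc _ = _ := by congr 1; ring
    _ ≤ _ := this
    _ = _ := by ring

lemma tendsto_second_difference {φ : E → ℝ} (hφ : ContDiff ℝ 2 φ) (z h : E) :
    Tendsto (fun t : ℝ => (φ (z + t • h) + φ (z - t • h) - 2 * φ z) / t ^ 2) (𝓝[>] 0)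
      (𝓝 (fderiv ℝ (fderiv ℝ φ) z h h)) := by
  have hd : Differentiable ℝ φ := hφ.differentiable (by norm_num)
  have hd1 : Differentiable ℝ (fderiv ℝ φ) :=
    (hφ.fderiv_right (m := 1) (by norm_num)).differentiable (by norm_num)
  have hg := hasDerivAt_symm_sum hd z h
  have hg2 : HasDerivAt (fun t : ℝ => fderiv ℝ φ (z + t • h) h - fderiv ℝ φ (z - t • h) h)
      (2 * fderiv ℝ (fderiv ℝ φ) z h h) 0 := by
    have h1 : HasDerivAt (fun s : ℝ => s • h) h 0 := by
      simpa using (hasDerivAt_id (0 : ℝ)).smul_const h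
    have hL : HasFDerivAt (fun x => fderiv ℝ φ x h)
        ((ContinuousLinearMap.apply ℝ ℝ h).comp (fderiv ℝ (fderiv ℝ φ) z)) z :=
      (ContinuousLinearMap.apply ℝ ℝ h).hasFDerivAt.comp z (hd1 z).hasFDerivAt
    have h2 := HasFDerivAt.comp_hasDerivAt_of_eq (0 : ℝ) hL (h1.const_add z) (by simp)
    have h3 := HasFDerivAt.comp_hasDerivAt_of_eq (0 : ℝ) hL (h1.const_sub z) (by simp)
    refine (h2.sub h3).congr_deriv ?_
    -- The two one-sided shifts contribute equally, which produces the factor `2`.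
    simp [two_mul]
  refine HasDerivAt.lhopital_zero_nhdsGT (f' := fun t => fderiv ℝ φ (z + t • h) h -
    fderiv ℝ φ (z - t • h) h) (g' := fun t => 2 * t) (.of_forall hg)
    (.of_forall fun t => by simpa using hasDerivAt_pow 2 t)
    (eventually_mem_nhdsWithin.mono fun t ht => mul_ne_zero two_ne_zero (ne_of_gt ht)) ?_ ?_ ?_
  · have := (hg 0).continuousAt.tendsto.mono_left (nhdsWithin_le_nhds (s := Ioi 0))
    simpa [two_mul] using this
  · have : Tendsto (fun t : ℝ => t ^ 2) (𝓝 0) (𝓝 (0 ^ 2)) := (continuous_pow 2).tendsto 0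
    simpa using this.mono_left (nhdsWithin_le_nhds (s := Ioi 0))
  · have h3 := hg2.tendsto_slope_zero_right
    have h4 := h3.const_mul (1 / 2 : ℝ)
    refine (h4.congr' ?_).trans_eq (by congr 1; ring)
    filter_upwards [self_mem_nhdsWithin] with t ht
    have ht : t ≠ 0 := ne_of_gt ht
    simp only [zero_add, zero_smul, add_zero, sub_zero, sub_self, smul_eq_mul]
    field_simp

end SecondDifference

/-! ### Positivity of the Levi form of a plurisubharmonic function -/

/-- Lebesgue measure on one period of the circle, times Lebesgue measure on `ℂⁿ`. -/
abbrev circleProd (n : ℕ) : Measure (ℝ × Cn n) :=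
  (volume.restrict (Ioc 0 (2 * Real.pi))).prod volume

/-- The shear `(θ, z) ↦ (θ, z + e^{iθ} b)` preserves the product measure. -/
lemma integrable_circle_translate {w : Cn n → ℝ} (hw : Integrable w) (b : Cn n) :
    Integrable (fun p : ℝ × Cn n => w (p.2 + circleMap 0 1 p.1 • b)) (circleProd n) := by
  have hmp : MeasurePreserving (fun p : ℝ × Cn n => (id p.1, p.2 + circleMap 0 1 p.1 • b))
      (circleProd n) (circleProd n) := by
    refine (MeasurePreserving.id _).skew_product
      (g := fun θ z => z + circleMap 0 1 θ • b) ?_ (.of_forall fun θ => ?_)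
    · exact (Continuous.measurable (by unfold Function.uncurry; fun_prop))
    · exact map_add_right_eq_self _ _
  exact hmp.integrable_comp_of_integrable (hw.comp_snd _)

lemma integrable_mul_circle_translate {w φ : Cn n → ℝ} (hw : Integrable w) (hφ : Continuous φ)
    (hc : HasCompactSupport φ) (b : Cn n) :
    Integrable (fun p : ℝ × Cn n => w p.2 * φ (p.2 + circleMap 0 1 p.1 • b)) (circleProd n) := by
  obtain ⟨C, hC⟩ := hc.exists_bound_of_continuous hφ
  exact (hw.comp_snd _).mul_bdd (c := C)
    (Continuous.aestronglyMeasurable (by fun_prop)) (.of_forall fun p => hC _)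

/-- The sub-mean value inequality, integrated against a test function `φ`. -/
lemma integral_mul_le_circle {v : Cn n → EReal} {S K : Set (Cn n)} (hv : PshFlat v S)
    (hK : IsCompact K) (hKS : K ⊆ S) (hbot : ∀ᵐ z ∂volume.restrict S, v z ≠ ⊥)
    (hint : IntegrableOn (fun z => (v z).toReal) K) (hS : IsOpen S) {φ : Cn n → ℝ}
    (hφ : Continuous φ) (hc : HasCompactSupport φ) (hφ0 : ∀ z, 0 ≤ φ z) {b : Cn n}
    (hb : ∀ z, φ z ≠ 0 → Metric.closedBall z ‖b‖ ⊆ K) :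
    2 * Real.pi * ∫ z, K.indicator (fun z => (v z).toReal) z * φ z ≤
      ∫ p, K.indicator (fun z => (v z).toReal) p.2 * φ (p.2 - circleMap 0 1 p.1 • b)
        ∂(circleProd n) := by
  set w : Cn n → ℝ := K.indicator fun z => (v z).toReal with hwdef
  have hw : Integrable w := hint.integrable_indicator hK.measurableSet
  obtain ⟨C, hC⟩ := hc.exists_bound_of_continuous hφ
  have h1 := integrable_mul_circle_translate hw hφ hc (-b)
  simp only [smul_neg, ← sub_eq_add_neg] at h1
  have h2 : Integrable (fun p : ℝ × Cn n => w (p.2 + circleMap 0 1 p.1 • b) * φ p.2)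
      (circleProd n) := (integrable_circle_translate hw b).mul_bdd (c := C)
    (Continuous.aestronglyMeasurable (by fun_prop)) (.of_forall fun p => hC _)
  -- Translation invariance moves the shift from the test function to `w`, where the sub-mean
  -- inequality at `z` applies.
  have h3 : ∫ p, w p.2 * φ (p.2 - circleMap 0 1 p.1 • b) ∂(circleProd n) =
      ∫ p, w (p.2 + circleMap 0 1 p.1 • b) * φ p.2 ∂(circleProd n) := by
    rw [integral_prod _ h1, integral_prod _ h2]
    congr 1
    ext θ
    rw [← integral_add_right_eq_self _ (circleMap 0 1 θ • b)]
    simp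
  rw [h3, integral_prod_symm _ h2, ← integral_const_mul]
  rw [ae_restrict_iff' hS.measurableSet] at hbot
  have hwφ : Integrable fun z => w z * φ z :=
    hw.mul_bdd (c := C) hφ.aestronglyMeasurable (.of_forall hC)
  refine integral_mono_ae (hwφ.const_mul _) h2.integral_prod_right ?_
  filter_upwards [hbot] with z hz
  by_cases h0 : φ z = 0
  · simp [h0]
  have hsub := hb z h0
  have hmem : ∀ ζ ∈ Metric.closedBall (0 : ℂ) 1, z + ζ • b ∈ K := fun ζ hζ => by
    refine hsub ?_
    rw [mem_closedBall_iff_norm, add_sub_cancel_left, norm_smul]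
    exact mul_le_of_le_one_left (norm_nonneg _) (by simpa using hζ)
  have hzK : z ∈ K := hsub (Metric.mem_closedBall_self (norm_nonneg b))
  obtain ⟨-, -, hle⟩ := hv.2.2 z b (fun ζ hζ => hKS (hmem ζ hζ)) (by simpa using hz (hKS hzK))
  have hval : ∀ θ : ℝ, w (z + circleMap 0 1 θ • b) = (v (z + circleMap 0 1 θ • b)).toReal :=
    fun θ => indicator_of_mem (hmem _ (Metric.sphere_subset_closedBall
      (circleMap_zero_one_mem_sphere θ))) _
  simp only [hval]
  rw [integral_mul_const]
  have hwz : w z = (v z).toReal := indicator_of_mem hzK _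
  rw [hwz, ← mul_assoc]
  refine mul_le_mul_of_nonneg_right ?_ (hφ0 z)
  rw [Real.circleAverage_def, intervalIntegral.integral_of_le Real.two_pi_pos.le, smul_eq_mul,
    inv_mul_eq_div, le_div_iff₀ Real.two_pi_pos] at hle
  simp only [zero_smul, add_zero] at hle
  linarith

lemma continuous_leviSmooth {φ : Cn n → ℝ} (hφ : ContDiff ℝ ∞ φ) (ξ : Cn n) :
    Continuous (leviSmooth φ ξ) := by
  have h1 : ContDiff ℝ ∞ (fderiv ℝ φ) := hφ.fderiv_right (by simp)
  have h2 : Continuous (fderiv ℝ (fderiv ℝ φ)) := h1.continuous_fderiv (by simp)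
  have : leviSmooth φ ξ = fun z => (fderiv ℝ (fderiv ℝ φ) z ξ ξ +
      fderiv ℝ (fderiv ℝ φ) z (Complex.I • ξ) (Complex.I • ξ)) / 4 := funext (leviSmooth_eq φ ξ)
  rw [this]
  fun_prop

lemma leviSmooth_eq_zero {φ : Cn n → ℝ} (ξ : Cn n) {z : Cn n} (hz : z ∉ tsupport φ) :
    leviSmooth φ ξ z = 0 := by
  have : fderiv ℝ (fderiv ℝ φ) z = 0 :=
    image_eq_zero_of_notMem_tsupport fun h =>
      hz (tsupport_fderiv_subset ℝ (tsupport_fderiv_subset ℝ h))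
  simp [leviSmooth_eq, this]

lemma exists_bound_fderiv {E F : Type*} [NormedAddCommGroup E] [NormedSpace ℝ E]
    [NormedAddCommGroup F] [NormedSpace ℝ F] {g : E → F} (hg : ContDiff ℝ 1 g)
    (hc : HasCompactSupport g) : ∃ C : ℝ, ∀ z, ‖fderiv ℝ g z‖ ≤ C := by
  have h2 : Continuous (fderiv ℝ g) := hg.continuous_fderiv (by norm_num)
  have h4 : HasCompactSupport (fderiv ℝ g) := hc.fderiv ℝ
  exact h4.exists_bound_of_continuous h2

/-- Add the integrated sub-mean inequalities for the radii `±tξ` and `±itξ`. The excess over four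
central values pairs `v` with second differences of `φ` in two orthogonal real directions. Divided
by `t ^ 2`, these converge to `4 * leviSmooth φ ξ`, whatever the angle. All derivatives fall on `φ`,
so `v` needs no smoothing. -/
theorem PshFlat.integral_mul_leviSmooth_nonneg {v : Cn n → EReal} {S : Set (Cn n)} (hS : IsOpen S)
    (hv : PshFlat v S) (hbot : ∀ᵐ z ∂volume.restrict S, v z ≠ ⊥)
    (hint : LocallyIntegrableOn (fun z => (v z).toReal) S) {φ : Cn n → ℝ}
    (hφ : IsNonnegTest φ S) (ξ : Cn n) : 0 ≤ ∫ z, (v z).toReal * leviSmooth φ ξ z := by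
  obtain ⟨hsm, hc, hsub, hφ0⟩ := hφ
  -- The thickening leaves room for circles of radius `‖t • ξ‖ < δ` around every point of the
  -- support.
  obtain ⟨δ, hδ, hδS⟩ := hc.isCompact.exists_cthickening_subset_open hS hsub
  set K := Metric.cthickening δ (tsupport φ) with hKdef
  have hK : IsCompact K := hc.isCompact.cthickening
  have hintK := hint.integrableOn_compact_subset hδS hK
  have hsm2 : ContDiff ℝ 2 φ := hsm.of_le (by norm_cast)
  set w : Cn n → ℝ := K.indicator fun z => (v z).toReal with hwdef
  have hw : Integrable w := hintK.integrable_indicator hK.measurableSet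
  obtain ⟨C, hC⟩ := exists_bound_fderiv (hsm2.fderiv_right (m := 1) (by norm_num))
    (hc.fderiv ℝ)
  -- the second differences in the two real directions of a complex line
  let D : ℝ → Cn n → Cn n → ℝ := fun t h z => φ (z + t • h) + φ (z - t • h) - 2 * φ z
  let Q : ℝ → ℝ × Cn n → ℝ := fun t p =>
    w p.2 * (D t (circleMap 0 1 p.1 • ξ) p.2 + D t (Complex.I • circleMap 0 1 p.1 • ξ) p.2)
  have hpos : ∀ᶠ t : ℝ in 𝓝[>] 0, 0 ≤ ∫ p, Q t p / t ^ 2 ∂(circleProd n) := by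
    have hlim : Tendsto (fun t : ℝ => ‖t • ξ‖) (𝓝[>] 0) (𝓝 0) := by
      have : Tendsto (fun t : ℝ => ‖t • ξ‖) (𝓝 0) (𝓝 ‖(0 : ℝ) • ξ‖) :=
        Continuous.tendsto (by fun_prop) 0
      simpa using this.mono_left (nhdsWithin_le_nhds (s := Ioi 0))
    filter_upwards [hlim.eventually (gt_mem_nhds hδ)] with t ht
    have key : ∀ b : Cn n, ‖b‖ = ‖t • ξ‖ →
        Integrable (fun p : ℝ × Cn n => w p.2 * φ (p.2 - circleMap 0 1 p.1 • b)) (circleProd n) ∧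
        2 * Real.pi * ∫ z, w z * φ z ≤
          ∫ p, w p.2 * φ (p.2 - circleMap 0 1 p.1 • b) ∂(circleProd n) := by
      intro b hb
      constructor
      · have := integrable_mul_circle_translate hw hsm.continuous hc (-b)
        simpa only [smul_neg, ← sub_eq_add_neg] using this
      · refine integral_mul_le_circle hv hK hδS hbot hintK hS hsm.continuous hc hφ0
          fun z hz y hy => ?_
        refine Metric.mem_cthickening_of_dist_le y z δ _ (subset_tsupport _ hz) ?_
        exact (Metric.mem_closedBall.1 hy).trans (hb.trans_lt ht).le
    obtain ⟨i1, l1⟩ := key (t • ξ) rfl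
    obtain ⟨i2, l2⟩ := key (-(t • ξ)) (by simp)
    obtain ⟨i3, l3⟩ := key (Complex.I • t • ξ) (by simp [norm_smul])
    obtain ⟨i4, l4⟩ := key (-(Complex.I • t • ξ)) (by simp [norm_smul])
    have i5 : Integrable (fun p : ℝ × Cn n => w p.2 * φ p.2) (circleProd n) := by
      simpa using integrable_mul_circle_translate hw hsm.continuous hc 0
    have e5 : ∫ p, w p.2 * φ p.2 ∂(circleProd n) = 2 * Real.pi * ∫ z, w z * φ z := by
      rw [integral_prod _ i5]
      simp [Real.two_pi_pos.le]
    have hQ : Q t = fun p => w p.2 * φ (p.2 - circleMap 0 1 p.1 • (t • ξ)) +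
        w p.2 * φ (p.2 - circleMap 0 1 p.1 • (-(t • ξ))) +
        w p.2 * φ (p.2 - circleMap 0 1 p.1 • (Complex.I • t • ξ)) +
        w p.2 * φ (p.2 - circleMap 0 1 p.1 • (-(Complex.I • t • ξ))) - 4 * (w p.2 * φ p.2) := by
      ext p
      have e1 : t • (circleMap 0 1 p.1 • ξ) = circleMap 0 1 p.1 • t • ξ := smul_comm _ _ _
      have e2 : t • (Complex.I • circleMap 0 1 p.1 • ξ) =
          circleMap 0 1 p.1 • Complex.I • t • ξ := by
        rw [smul_comm Complex.I, smul_comm t, smul_comm t]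
      simp only [Q, D, e1, e2, smul_neg, sub_neg_eq_add]
      ring
    rw [integral_div]
    refine div_nonneg ?_ (sq_nonneg t)
    have i12 := i1.add i2
    have i123 := i12.add i3
    have i1234 := i123.add i4
    have e12 := integral_add i1 i2
    have e123 := integral_add i12 i3
    have e1234 := integral_add i123 i4
    have e12345 := integral_sub i1234 (i5.const_mul 4)
    rw [integral_const_mul, e5] at e12345
    simp only [Pi.add_apply] at e12 e123 e1234 e12345
    rw [hQ, e12345, e1234, e123, e12]
    linarith
  have hlim : Tendsto (fun t => ∫ p, Q t p / t ^ 2 ∂(circleProd n)) (𝓝[>] 0)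
      (𝓝 (∫ p, w p.2 * (4 * leviSmooth φ ξ p.2) ∂(circleProd n))) := by
    refine tendsto_integral_filter_of_dominated_convergence
      (fun p => ‖w p.2‖ * (4 * C * ‖ξ‖ ^ 2)) ?_ ?_ ?_ ?_
    · refine .of_forall fun t => ?_
      refine ((hw.comp_snd _).aestronglyMeasurable.mul
        (Continuous.aestronglyMeasurable ?_)).mul_const _
      have := hsm.continuous
      simp only [D]
      fun_prop
    · filter_upwards [self_mem_nhdsWithin] with t ht
      have ht : 0 < t := ht
      refine .of_forall fun p => ?_
      have hn : ‖circleMap 0 1 p.1‖ = 1 := by simp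
      have b1 := abs_second_difference_le hsm2 hC p.2 (circleMap 0 1 p.1 • ξ) ht.le
      have b2 := abs_second_difference_le hsm2 hC p.2 (Complex.I • circleMap 0 1 p.1 • ξ) ht.le
      rw [norm_smul, norm_smul, hn, Complex.norm_I, one_mul, one_mul] at b2
      rw [norm_smul, hn, one_mul] at b1
      rw [norm_div, norm_mul, Real.norm_of_nonneg (sq_nonneg t), mul_div_assoc]
      refine mul_le_mul_of_nonneg_left ?_ (norm_nonneg _)
      rw [div_le_iff₀ (by positivity)]
      refine (norm_add_le _ _).trans ?_
      simp only [D, Real.norm_eq_abs]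
      linarith
    · exact ((hw.comp_snd _).norm).mul_const _
    · refine .of_forall fun p => ?_
      have hn : ‖circleMap 0 1 p.1‖ = 1 := by simp
      have t1 := tendsto_second_difference hsm2 p.2 (circleMap 0 1 p.1 • ξ)
      have t2 := tendsto_second_difference hsm2 p.2 (Complex.I • circleMap 0 1 p.1 • ξ)
      have t3 := (t1.add t2).const_mul (w p.2)
      rw [← leviSmooth_smul φ ξ p.2 hn, leviSmooth_eq, mul_div_cancel₀ _ four_ne_zero]
      refine t3.congr fun t => ?_
      simp only [Q, D]
      ring
  have h0 := ge_of_tendsto hlim hpos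
  have hwφ : ∀ z, w z * leviSmooth φ ξ z = (v z).toReal * leviSmooth φ ξ z := fun z => by
    by_cases hz : z ∈ tsupport φ
    · rw [hwdef, indicator_of_mem (Metric.self_subset_cthickening _ hz)]
    · simp [leviSmooth_eq_zero ξ hz]
  have hci : Integrable fun z => w z * (4 * leviSmooth φ ξ z) := by
    have hcs : HasCompactSupport (leviSmooth φ ξ) :=
      hc.mono' fun z hz => by_contra fun h => hz (leviSmooth_eq_zero ξ h)
    obtain ⟨B, hB⟩ := hcs.exists_bound_of_continuous (continuous_leviSmooth hsm ξ)
    have := (hw.mul_bdd (c := B) (continuous_leviSmooth hsm ξ).aestronglyMeasurable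
      (.of_forall hB)).const_mul 4
    exact this.congr (.of_forall fun z => by ring)
  rw [integral_prod _ (hci.comp_snd _)] at h0
  have h4 : ∀ z, w z * (4 * leviSmooth φ ξ z) = 4 * ((v z).toReal * leviSmooth φ ξ z) :=
    fun z => by rw [← hwφ]; ring
  simp only [h4, integral_const_mul] at h0
  simp only [integral_const, smul_eq_mul, MeasurableSet.univ, measureReal_restrict_apply,
    univ_inter, Real.volume_real_Ioc, sub_zero, max_eq_left Real.two_pi_pos.le] at h0
  have := Real.two_pi_pos
  by_contra! hneg
  nlinarith

/-! ### The current inequality -/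

lemma frequently_comp_symm_iff {Y : Type*} [TopologicalSpace Y] {P : Y → Prop}
    {e : OpenPartialHomeomorph Y (Cn n)} {z : Cn n} (hz : z ∈ e.target) :
    (∃ᶠ z' in 𝓝 z, P (e.symm z')) ↔ ∃ᶠ y in 𝓝 (e.symm z), P y := by
  rw [← e.symm.map_nhds_eq (x := z) hz, frequently_map]

/-- The points near which a plurisubharmonic function is not identically `-∞` form a union of
connected components. -/
lemma IsPSHOn.frequently_ne_bot {u : X → EReal} (hu : IsPSHOn n u univ)
    [IsManifold 𝓘(ℂ, Cn n) ω X] {x₀ x : X} (h₀ : u x₀ ≠ ⊥) (hx : x ∈ connectedComponent x₀) :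
    ∃ᶠ y in 𝓝 x, u y ≠ ⊥ := by
  set T : Set X := closure {y | u y ≠ ⊥} with hT
  have hTmem : ∀ y, y ∈ T ↔ ∃ᶠ y' in 𝓝 y, u y' ≠ ⊥ := fun y => mem_closure_iff_frequently
  have hopen : IsOpen T := by
    rw [isOpen_iff_mem_nhds]
    intro y hy
    let e := chartAt (Cn n) y
    have hys : y ∈ e.source := mem_chart_source _ y
    have hyt : e y ∈ e.target := e.map_source hys
    have hw := hu.pshFlat (IsManifold.chart_mem_maximalAtlas (I := 𝓘(ℂ, Cn n)) (n := ω) y)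
    rw [preimage_univ, inter_univ] at hw
    have hf : ∃ᶠ z in 𝓝 (e y), u (e.symm z) ≠ ⊥ := by
      -- The set `T` is open because finiteness at points arbitrarily near `y` implies finiteness
      -- almost everywhere on a ball around `y` in the chart; so it is clopen.
      rw [frequently_comp_symm_iff (P := fun y => u y ≠ ⊥) hyt, e.left_inv hys]
      exact (hTmem y).1 hy
    obtain ⟨ρ, hρ, hae, -⟩ := hw.exists_integrableOn e.open_target hyt hf
    filter_upwards [e.open_source.mem_nhds hys,
      (e.continuousAt hys).preimage_mem_nhds (Metric.ball_mem_nhds _ hρ)] with y' h1 h2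
    have h3 := frequently_of_ae_restrict Metric.isOpen_ball hae h2
    rw [frequently_comp_symm_iff (P := fun y => u y ≠ ⊥) (e.map_source h1), e.left_inv h1] at h3
    exact (hTmem y').2 h3
  have hclopen : IsClopen T := ⟨isClosed_closure, hopen⟩
  exact (hTmem x).1 (hclopen.connectedComponent_subset (subset_closure h₀) hx)

lemma integrable_mul_leviSmooth {g φ : Cn n → ℝ} {S : Set (Cn n)}
    (hg : LocallyIntegrableOn g S) (hφ : IsNonnegTest φ S) (ξ : Cn n) :
    Integrable fun z => g z * leviSmooth φ ξ z := by
  obtain ⟨hsm, hc, hsub, -⟩ := hφ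
  have h1 : IntegrableOn (fun z => g z * leviSmooth φ ξ z) (tsupport φ) :=
    (hg.integrableOn_compact_subset hsub hc.isCompact).mul_continuousOn
      (continuous_leviSmooth hsm ξ).continuousOn hc.isCompact
  refine (integrableOn_iff_integrable_of_support_subset fun z hz => ?_).1 h1
  by_contra h
  exact hz (by simp [leviSmooth_eq_zero ξ h])

/-- Almost everywhere `G_A` is `log |h|` plus the plurisubharmonic extension of the quotient.
Integrating against `leviSmooth φ ξ`, the first summand gives `π [A]` and the second a nonnegative
number. -/
theorem ComplexSubspace.leviGePiIntegration_green [IsManifold 𝓘(ℂ, Cn n) ω X]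
    {A : ComplexSubspace n X} (hA : A.IsEffectiveDivisor) {x₀ : X} (h₀ : A.green x₀ ≠ ⊥) :
    LeviGePiIntegration A A.green (connectedComponent x₀) := by
  intro e he V h hV hVW hh
  have hG := (green_mem_family hA).1
  set S : Set (Cn n) := e.target ∩ e.symm ⁻¹' V with hSdef
  have hS : IsOpen S := isOpen_chart_preimage e hV
  have hGp : PshFlat (fun z => A.green (e.symm z)) S :=
    (hG.pshFlat he).mono (inter_subset_inter_right _ (preimage_mono (subset_univ V)))
  have hlp : PshFlat (logAbs fun z => h (e.symm z)) S :=
    pshFlat_logAbs hS fun z hz => analyticAt_comp_symm he hz.1 ((hh _ hz.2).1 ())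
  have hlp : PshFlat (fun z => logAbs h (e.symm z)) S := hlp
  have hvp : PshFlat (fun z => A.greenQuotient h (e.symm z)) S :=
    (isPSHOn_greenQuotient hA hV hh).pshFlat he
  obtain ⟨hGb, hGi⟩ := hGp.locallyIntegrableOn hS fun z hz =>
    (frequently_comp_symm_iff (P := fun y => A.green y ≠ ⊥) hz.1).2
      (hG.frequently_ne_bot h₀ (hVW hz.2))
  obtain ⟨hlb, hli⟩ := hlp.locallyIntegrableOn hS fun z hz =>
    (frequently_comp_symm_iff (P := fun y => logAbs h y ≠ ⊥) hz.1).2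
      ((hh.frequently_ne_zero hz.2 (hA _).2).mono fun y hy hb => hy (logAbs_eq_bot_iff.1 hb))
  have heq : ∀ᵐ z ∂volume.restrict S, A.greenQuotient h (e.symm z) ≠ ⊥ ∧
      (A.greenQuotient h (e.symm z)).toReal =
        (A.green (e.symm z)).toReal - (logAbs h (e.symm z)).toReal := by
    filter_upwards [hGb, hlb, ae_restrict_mem hS.measurableSet] with z h1 h2 hz
    have h3 : e.symm z ∉ A.support := fun hs =>
      h2 (logAbs_of_eq_zero ((hh.mem_support_iff hz.2).1 hs))
    rw [greenQuotient_eq hA hh ⟨hz.2, h3⟩]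
    have h4 := hGp.2.1 z hz
    have h5 := hlp.2.1 z hz
    refine ⟨?_, EReal.toReal_sub h4 h1 h5 h2⟩
    lift A.green (e.symm z) to ℝ using ⟨h4, h1⟩ with a
    lift logAbs h (e.symm z) to ℝ using ⟨h5, h2⟩ with b
    rw [← EReal.coe_sub]
    exact EReal.coe_ne_bot _
  -- The quotient is nowhere locally `-∞`, because it is finite wherever `G_A` and `log |h|` both
  -- are.
  obtain ⟨hvb, hvi⟩ := hvp.locallyIntegrableOn hS fun z hz =>
    frequently_of_ae_restrict hS (heq.mono fun _ h => h.1) hz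
  refine ⟨⟨?_, hGi⟩, ⟨?_, hli⟩, fun φ hφ ξ => ?_⟩
  · filter_upwards [hGb, ae_restrict_mem hS.measurableSet] with z h1 hz
    exact ⟨h1, hGp.2.1 z hz⟩
  · filter_upwards [hlb, ae_restrict_mem hS.measurableSet] with z h1 hz
    exact ⟨h1, hlp.2.1 z hz⟩
  have hpos := hvp.integral_mul_leviSmooth_nonneg hS hvb hvi hφ ξ
  have hsub : ∫ z, (A.greenQuotient h (e.symm z)).toReal * leviSmooth φ ξ z =
      levi e A.green ξ φ - levi e (logAbs h) ξ φ := by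
    rw [levi, levi, ← integral_sub (integrable_mul_leviSmooth hGi hφ ξ)
      (integrable_mul_leviSmooth hli hφ ξ)]
    rw [ae_restrict_iff' hS.measurableSet] at heq
    refine integral_congr_ae (heq.mono fun z hz => ?_)
    by_cases hzt : z ∈ tsupport φ
    · simp only [(hz (hφ.2.2.1 hzt)).2]
      ring
    · simp [leviSmooth_eq_zero ξ hzt]
  rw [integrationCurrent, one_div, mul_inv_cancel_left₀ Real.pi_ne_zero]
  linarith

end GreenDivisor

end

theorem proposition3p2 {n : ℕ} {X : Type*} [TopologicalSpace X] [T2Space X]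
    [SecondCountableTopology X] [ChartedSpace (GreenDivisor.Cn n) X]
    [IsManifold 𝓘(ℂ, GreenDivisor.Cn n) ω X]
    (A : GreenDivisor.ComplexSubspace n X) (hA : A.IsEffectiveDivisor) :
    (∀ (U : Set X) (f : X → ℂ), IsOpen U → A.GeneratedOn f U →
      (∀ p ∈ A.support ∩ U, ∃ V ∈ 𝓝 p, ∃ C : ℝ, ∀ x ∈ V ∩ (U \ A.support),
        A.green x - GreenDivisor.logAbs f x ≤ (C : EReal)) ∧
      ∃ v : X → EReal, GreenDivisor.IsPSHOn n v U ∧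
        ∀ x ∈ U \ A.support, v x = A.green x - GreenDivisor.logAbs f x) ∧
    ∀ x₀ : X, A.green x₀ ≠ ⊥ →
      GreenDivisor.LeviGePiIntegration A A.green (connectedComponent x₀) := by
  refine ⟨fun U f hU hf => ⟨fun p hp => ?_, A.greenQuotient f, ?_, fun x hx => ?_⟩,
    fun x₀ h₀ => GreenDivisor.ComplexSubspace.leviGePiIntegration_green hA h₀⟩
  · exact GreenDivisor.ComplexSubspace.green_sub_logAbs_bounded hA hU hf hp.2
  · exact GreenDivisor.ComplexSubspace.isPSHOn_greenQuotient hA hU hf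
  · exact GreenDivisor.ComplexSubspace.greenQuotient_eq hA hf hx
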